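/- Let $X$ be a real Hilbert space with norm $\|\cdot\|_X$, and let $\langle\cdot,\cdot\rangle_u$, $u\in X\setminus\{0\}$, be a family of scalar products on $X$ with induced norms $\|\cdot\|_u$ such that - (M1) every $u\in X\setminus\{0\}$ has a neighborhood $U\subset X\setminus\{0\}$ and a constant $C>0$ with $\frac1C\|v\|_X\le\|v\|_{\tilde u}\le C\|v\|_X$ for all $\tilde u\in U$, $v\in X$; - (M2) every $u\in X\setminus\{0\}$ has a neighborhood $U\subset X\setminus\{0\}$ and a constant $C>0$ with $|\langle v,w\rangle_{u_1}-\langle v,w\rangle_{u_2}|\le C\|u_1-u_2\|_X\|v\|_X\|w\|_X$ for all $u_1,u_2\in U$, $v,w\in X$. Let $G$ be a topological group acting linearly on $X$ from the left, $(g,u)\mapsto g\ast u$, such that - (M3) $\langle g\ast v,g\ast w\rangle_{g\ast u}=\langle v,w\rangle_u$ for all $u,v,w\in X\setminus\{0\}$, $g\in G$; - $(G_*)$ if $g_n\ast u\to v$ in $X$ for a sequence $(g_n)_n$ in $G$ and $u,v\in X$, then $g\ast u=v$ for some $g\in G$. Let $M\subset X\setminus\{0\}$ be a $G$-invariant submanifold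 of class $C^{1,1}$ with $M=-M$, and let $\Phi\in C^{1,1}(M)$ be an even and $G$-invariant real-valued functional. Let $G_0\subset G$ be a closed normal subgroup, and let $X_0=\{u\in X: g\ast u=u \text{ for all } g\in G_0\}$ and $M_0=M\cap X_0$. For $u,w\in M_0$ let $d(u,w)\in[0,\infty]$ be the infimum of the lengths $\int_0^1\|\gamma'(s)\|_{\gamma(s)}\,ds$ of the curves $\gamma\in C^1([0,1],M_0)$ from $u$ to $w$, and let $N(w)=\inf\{\|u\|_u+d(u,w): u\in M_0\}$. For $u \in M$ let $\Phi'(u)$ be the derivative of $\Phi$ on the tangent space $T_uM$, and let $\|\Phi'(u)\|_u=\sup\{|\Phi'(u)v|: v\in T_uM,\ \|v\|_u\le1\}$. For $c\in\mathbb R$ put $$\Phi^c=\{u\in M_0:\Phi(u)\le c\},\qquad K_c=\{u\in M_0:\Phi'(u)=0,\ \Phi(u)=c\}.$$ Let $\gamma(Z)$ denote the Krasnoselskii genus of a symmetric set $Z\subset X$: $\gamma(\varnothing)=0$, and otherwise $\gamma(Z)$ is the smallest integer $k\ge1$ for which there is an odd continuous map from $Z$ to the unit sphere of $\mathbb R^k$,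 with $\gamma(Z)=\infty$ if there is none. Let $$c_k=\inf\{c\in\mathbb R:\gamma(\Phi^c)\ge k\}\in[-\infty,\infty],\qquad k\in\mathbb N.$$ For $c\in\mathbb R$ consider the conditions - $(NCG_0)_c$: if $(u_n)_n\subset M_0$ is a sequence with $\Phi(u_n)\to c$ and $\|\Phi'(u_n)\|_{u_n}(1+N(u_n))\to0$, then, after passing to a subsequence, there are a sequence $(g_n)_n$ in $G$ and $u\in M_0$ with $g_n\ast u_n\to u$ in $X$; - $(I)'_c$: $g\ast u\ne-u$ for all $u\in K_c$ and $g\in G\setminus G_0$. Suppose that there are $c_*\in\mathbb R$ and $c_\infty\in\mathbb R\cup\{+\infty\}$ with $c_*<c_\infty$ and the following properties: 1. the set $\{u\in M_0: c_*\le\Phi(u)\le c\}$ is complete with respect to $d$ for all real $c<c_\infty$; 2. $k_*:=\lim_{c\to c_*,\,c>c_*}\gamma(\Phi^c)<\infty$; 3. $\lim_{c\to c_\infty,\,c<c_\infty}\gamma(\Phi^c)=\infty$; 4. $(NCG_0)_c$ and $(I)'_c$ hold for every $c\in(c_*,c_\infty)$. Then $$c_*<c_{k_*+1}\le c_{k_*+2}\le\dots,\qquad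 c_k<c_\infty\ \text{ for all } k>k_*,\qquad \lim_{k\to\infty}c_k=c_\infty,$$ and every $c_k$ with $k>k_*$ is a critical value of $\Phi$, attained at a critical point of $\Phi$ in $M_0$. Hence there is a sequence of pairs $\{\pm u_k\}$ of critical points of $\Phi$ in $M_0$ with $\Phi(u_k)\to c_\infty$ as $k\to\infty$. -/

import Mathlib

open Set Filter Topology
open scoped ENNReal

namespace LSTheory

noncomputable section

/-! ### Submanifolds and functions of class `C^{1,1}` -/

/-- `f` is of class `C^{1,1}` on the open set `s`: it is `C^1` there, with a locally Lipschitz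
derivative. -/
def IsC11On {E F : Type*} [NormedAddCommGroup E] [NormedSpace ℝ E] [NormedAddCommGroup F]
    [NormedSpace ℝ F] (f : E → F) (s : Set E) : Prop :=
  ContDiffOn ℝ 1 f s ∧ LocallyLipschitzOn s (fderiv ℝ f)

variable {X : Type*} [NormedAddCommGroup X] [InnerProductSpace ℝ X]

/-- `M` is an (embedded) submanifold of class `C^{1,1}` of the Hilbert space `X`: near each of its
points, a `C^{1,1}`-diffeomorphism between open subsets of `X` straightens `M` to a closed linear
subspace. -/
def IsC11Submanifold (M : Set X) : Prop :=
  ∀ u ∈ M, ∃ (ψ : OpenPartialHomeomorph X X) (E : Submodule ℝ X),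
    u ∈ ψ.source ∧ IsClosed (E : Set X) ∧
    IsC11On ψ ψ.source ∧ IsC11On ψ.symm ψ.target ∧
    ∀ x ∈ ψ.source, x ∈ M ↔ ψ x ∈ E

/-- `Φ ∈ C^{1,1}(M)`: near each point of `M`, the function `Φ` agrees on `M` with a
`C^{1,1}`-function defined on an open subset of `X`. Only the values of `Φ` on `M` matter. -/
def IsC11OnManifold (M : Set X) (Φ : X → ℝ) : Prop :=
  ∀ u ∈ M, ∃ U : Set X, IsOpen U ∧ u ∈ U ∧
    ∃ F : X → ℝ, IsC11On F U ∧ ∀ x ∈ U ∩ M, F x = Φ x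

/-- The tangent space `T_u M`: velocities at `u` of `C^1`-curves in `M` through `u`. -/
def tangentSpace (M : Set X) (u : X) : Set X :=
  {v | ∃ γ : ℝ → X, ContDiffAt ℝ 1 γ 0 ∧ (∀ᶠ t in 𝓝 0, γ t ∈ M) ∧ γ 0 = u ∧ deriv γ 0 = v}

/-- The derivative `Φ'(u) v` of `Φ : M → ℝ` at `u ∈ M` in the direction `v`. It is used for
`v ∈ T_u M` only, where it is the derivative of `Φ` along any curve in `M` with velocity `v`
at `u`, see `hasDerivAt_comp_curve`. -/
def dPhi (M : Set X) (Φ : X → ℝ) (u v : X) : ℝ := fderivWithin ℝ Φ M u v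

theorem hasDerivAt_comp_curve {M : Set X} {Φ : X → ℝ} (hΦ : IsC11OnManifold M Φ) {u v : X}
    (hu : u ∈ M) {γ : ℝ → X} (hγ : HasDerivAt γ v 0) (hM : ∀ᶠ t in 𝓝 0, γ t ∈ M)
    (h0 : γ 0 = u) : HasDerivAt (fun t => Φ (γ t)) (dPhi M Φ u v) 0 := by
  have hd : DifferentiableWithinAt ℝ Φ M u := by
    obtain ⟨U, hU, huU, F, hF, hFΦ⟩ := hΦ u hu
    have h1 : DifferentiableWithinAt ℝ F M u :=
      ((hF.1.differentiableOn (by norm_num) u huU).differentiableAt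
        (hU.mem_nhds huU)).differentiableWithinAt
    refine h1.congr_of_eventuallyEq ?_ (hFΦ u ⟨huU, hu⟩).symm
    filter_upwards [mem_nhdsWithin_of_mem_nhds (hU.mem_nhds huU), self_mem_nhdsWithin]
      with x hx hxM using (hFΦ x ⟨hx, hxM⟩).symm
  have h1 : HasFDerivWithinAt Φ (fderivWithin ℝ Φ M u) M (γ 0) := by
    rw [h0]; exact hd.hasFDerivWithinAt
  have h2 : HasDerivWithinAt (Φ ∘ γ) (fderivWithin ℝ Φ M u v) (γ ⁻¹' M) 0 :=
    h1.comp_hasDerivWithinAt 0 hγ.hasDerivWithinAt (fun _ h => h)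
  exact h2.hasDerivAt hM

/-- `u` is a critical point of `Φ : M → ℝ`, i.e. `Φ'(u) = 0` on `T_u M`. -/
def IsCritical (M : Set X) (Φ : X → ℝ) (u : X) : Prop :=
  ∀ v ∈ tangentSpace M u, dPhi M Φ u v = 0

/-! ### The family of scalar products

A family of bilinear forms is a map `B : X → X →ₗ[ℝ] X →ₗ[ℝ] ℝ`; `B u v w` is `⟨v, w⟩_u`. Only its
values at `u ≠ 0` are ever restricted. -/

/-- `⟨·,·⟩_u` is a scalar product for every `u ≠ 0`. -/
def IsScalarProductFamily (B : X → X →ₗ[ℝ] X →ₗ[ℝ] ℝ) : Prop :=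
  ∀ u ≠ 0, (∀ v w, B u v w = B u w v) ∧ ∀ v ≠ 0, 0 < B u v v

/-- The induced norm `‖v‖_u`. -/
def normAt (B : X → X →ₗ[ℝ] X →ₗ[ℝ] ℝ) (u v : X) : ℝ := √(B u v v)

/-- The norms `‖·‖_u` are locally uniformly equivalent to the norm of `X`. -/
def LocallyUniformlyEquivalent (B : X → X →ₗ[ℝ] X →ₗ[ℝ] ℝ) : Prop :=
  ∀ u ≠ 0, ∃ U ∈ 𝓝 u, (0 : X) ∉ U ∧ ∃ C > 0, ∀ u' ∈ U, ∀ v,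
    C⁻¹ * ‖v‖ ≤ normAt B u' v ∧ normAt B u' v ≤ C * ‖v‖

/-- The scalar products `⟨·,·⟩_u` depend in a locally Lipschitz way on `u`. -/
def LocallyLipschitzFamily (B : X → X →ₗ[ℝ] X →ₗ[ℝ] ℝ) : Prop :=
  ∀ u ≠ 0, ∃ U ∈ 𝓝 u, (0 : X) ∉ U ∧ ∃ C > 0, ∀ u₁ ∈ U, ∀ u₂ ∈ U, ∀ v w,
    |B u₁ v w - B u₂ v w| ≤ C * ‖u₁ - u₂‖ * ‖v‖ * ‖w‖

/-- `⟨g ∗ v, g ∗ w⟩_{g ∗ u} = ⟨v, w⟩_u`. -/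
def InvariantFamily (G : Type*) [Group G] [DistribMulAction G X]
    (B : X → X →ₗ[ℝ] X →ₗ[ℝ] ℝ) : Prop :=
  ∀ u v w : X, u ≠ 0 → v ≠ 0 → w ≠ 0 → ∀ g : G, B (g • u) (g • v) (g • w) = B u v w

/-- The norm of `Φ'(u)` as a linear functional on `(T_u M, ‖·‖_u)`. -/
def dualNormAt (B : X → X →ₗ[ℝ] X →ₗ[ℝ] ℝ) (M : Set X) (Φ : X → ℝ) (u : X) : ℝ≥0∞ :=
  ⨆ (v : X) (_ : v ∈ tangentSpace M u) (_ : normAt B u v ≤ 1), ENNReal.ofReal |dPhi M Φ u v|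

/-! ### The distance and the functional `N` -/

/-- The length of a curve `γ : [0,1] → X`. -/
def curveLength (B : X → X →ₗ[ℝ] X →ₗ[ℝ] ℝ) (γ : ℝ → X) : ℝ :=
  ∫ s in (0 : ℝ)..1, normAt B (γ s) (derivWithin γ (Icc 0 1) s)

/-- The distance `d` on `S`: the infimum of the lengths of the `C^1`-curves in `S` joining two
points; it is `∞` if there are none. -/
def pathDist (B : X → X →ₗ[ℝ] X →ₗ[ℝ] ℝ) (S : Set X) (u v : X) : ℝ≥0∞ :=
  ⨅ (γ : ℝ → X) (_ : ContDiffOn ℝ 1 γ (Icc 0 1)) (_ : ∀ s ∈ Icc (0 : ℝ) 1, γ s ∈ S)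
    (_ : γ 0 = u) (_ : γ 1 = v), ENNReal.ofReal (curveLength B γ)

/-- `N(w) = inf {‖u‖_u + d(u,w) : u ∈ S}`, with the distance `d` of `S`. -/
def NFun (B : X → X →ₗ[ℝ] X →ₗ[ℝ] ℝ) (S : Set X) (w : X) : ℝ≥0∞ :=
  ⨅ (u : X) (_ : u ∈ S), (ENNReal.ofReal (normAt B u u) + pathDist B S u w)

/-- `A` is complete with respect to `d`: every `d`-Cauchy sequence in `A` has a `d`-limit
in `A`. -/
def IsCompleteFor (d : X → X → ℝ≥0∞) (A : Set X) : Prop :=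
  ∀ x : ℕ → X, (∀ n, x n ∈ A) →
    (∀ ε > 0, ∃ n₀, ∀ m ≥ n₀, ∀ n ≥ n₀, d (x m) (x n) < ε) →
    ∃ a ∈ A, Tendsto (fun n => d (x n) a) atTop (𝓝 0)

/-! ### Genus and Ljusternik-Schnirelmann values -/

/-- The Krasnoselskii genus of a symmetric set `Z`: the least `k` for which there is an odd
continuous map from `Z` to the unit sphere of `ℝ^k`, and `∞` if there is none. The unit sphere of
`ℝ^0` is empty, so that `k = 0` occurs exactly if `Z` is empty. -/
def genus (Z : Set X) : ℕ∞ :=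
  ⨅ (k : ℕ) (_ : ∃ h : X → EuclideanSpace ℝ (Fin k), ContinuousOn h Z ∧
    ∀ z ∈ Z, ‖h z‖ = 1 ∧ h (-z) = -h z), (k : ℕ∞)

/-- The sublevel set `Φ^c` of `Φ : S → ℝ`. -/
def sublevel (S : Set X) (Φ : X → ℝ) (c : ℝ) : Set X := {u | u ∈ S ∧ Φ u ≤ c}

/-- The values `c_k = inf {c ∈ ℝ : γ(Φ^c) ≥ k} ∈ [-∞,∞]` of `Φ : S → ℝ`. -/
def lsValue (S : Set X) (Φ : X → ℝ) (k : ℕ) : EReal :=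
  ⨅ (c : ℝ) (_ : (k : ℕ∞) ≤ genus (sublevel S Φ c)), (c : EReal)

/-! ### The group action -/

section Action

variable {G : Type*} [Group G] [DistribMulAction G X]

/-- If `g_n ∗ u → v`, then `v` belongs to the orbit of `u`. -/
def GStar (G X : Type*) [NormedAddCommGroup X] [Group G] [DistribMulAction G X] : Prop :=
  ∀ (u v : X) (g : ℕ → G), Tendsto (fun n => g n • u) atTop (𝓝 v) → ∃ h : G, h • u = v

/-- The set `M₀` of `G₀`-invariant elements of `M`. -/
def invariantPart (G₀ : Subgroup G) (M : Set X) : Set X := {u | u ∈ M ∧ ∀ g ∈ G₀, g • u = u}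

/-- The condition `(NCG₀)_c`: a sequence in `M₀` with `Φ(u_n) → c` and
`‖Φ'(u_n)‖_{u_n} (1 + N(u_n)) → 0` converges in `X` to a point of `M₀`, after passing to a
subsequence and applying elements of `G`. -/
def NCG₀ (B : X → X →ₗ[ℝ] X →ₗ[ℝ] ℝ) (M : Set X) (Φ : X → ℝ) (G₀ : Subgroup G) (c : ℝ) : Prop :=
  ∀ x : ℕ → X, (∀ n, x n ∈ invariantPart G₀ M) →
    Tendsto (fun n => Φ (x n)) atTop (𝓝 c) →
    Tendsto (fun n => dualNormAt B M Φ (x n) * (1 + NFun B (invariantPart G₀ M) (x n)))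
      atTop (𝓝 0) →
    ∃ (φ : ℕ → ℕ) (g : ℕ → G), StrictMono φ ∧
      ∃ u ∈ invariantPart G₀ M, Tendsto (fun n => g n • x (φ n)) atTop (𝓝 u)

/-- The condition `(I)'_c`: `g ∗ u ≠ -u` for all `u ∈ K_c ⊆ M₀` and `g ∈ G \ G₀`. -/
def IPrime (M : Set X) (Φ : X → ℝ) (G₀ : Subgroup G) (c : ℝ) : Prop :=
  ∀ u ∈ invariantPart G₀ M, IsCritical M Φ u → Φ u = c → ∀ g : G, g ∉ G₀ → g • u ≠ -u

end Action

end

end LSTheory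

/-!
The values `c_k` are critical because the genus of `Φ^c` increases by a finite amount only when `c`
passes a level in `(c_*, c_∞)`, and not at all when that level is regular. This is
`LSTheory.IsSymmetricSetting.exists_genus_le`; everything else about the `c_k` follows from it and
from the monotonicity of the genus, since a supremum of the `c_k` below `c_∞` would be a level at
which the genus jumps from a finite value to `∞`.

*Descent.* The group `G₀` acts by isometries of `⟨·,·⟩_z` for `z ∈ M₀`. Hence the gradient of
`Φ` at `z` with respect to `⟨·,·⟩_z` is `G₀`-invariant, and the orthogonal projection to `T_z M`
yields a chart of `M` near `z` that maps `M₀` to the invariant part of `T_z M` (`exists_chart`,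
`exists_descent_direction`). Straight lines in this chart are curves in `M₀` along which `Φ`
decreases at almost the optimal rate (`exists_descent_homotopy`). No flow is needed: these local
homotopies are patched to countably many global ones, which are iterated
(`exists_countable_steps`, `exists_homotopy_of_steps`). A step from `x` has length at most a constant
times `1 + N(x)` times the decrease of `Φ`, and `N` is Lipschitz with constant `1` for the metric `d`,
so `N` grows at most exponentially in the decrease of `Φ`. Iterated sequences therefore have finite
length and converge by completeness (`exists_limit`).

*Symmetry.* The norms `‖·‖_u` and `‖·‖_{-u}` are unrelated, so that the homotopy obtained in this way
need not be odd. It is symmetrised afterwards. `X \ {0}` is covered by countably many open sets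
`U_n ∪ -U_n` with `U_n ∩ -U_n = ∅`; the homotopy is applied on `U_n` and its mirror image on `-U_n`,
one `n` after the other, for a time given by an even bump function of the initial point
(`exists_odd_map_of_homotopy`). The target is a symmetric set that both homotopies preserve, so that
the composition is an odd map into it.

*Critical orbits.* By `(NCG₀)_c`, the critical points at the level `c` are compact up to the action of
`G`, and `‖Φ'‖ (1 + N)` is bounded below away from their orbits (`exists_finite_cover`,
`exists_lower_bound`). By `(I)'_c` and `(G_*)`, a small `G`-invariant neighbourhood of an orbit is
disjoint from its mirror image, and hence carries an odd function that does not vanish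
(`exists_orbitBall_disjoint_neg`). So finitely many odd functions have no common zero near the
critical orbits, which are responsible for the finite increase of the genus (`genus_le_genus_add`).
-/

namespace LSTheory

/-! ### Countable families of homotopies -/

/-- The cover of a metric space by the sets `{f p > 0}` has a refinement by countably many disjoint
families of open sets. It is obtained by Stone's construction, for a well-ordering of the index set,
and hence is invariant under the isometries that preserve all functions `f p`. -/
theorem exists_disjoint_open_families {Y P : Type*} [PseudoMetricSpace Y] (f : P → Y → ℝ)
    (hf : ∀ p, LipschitzWith 1 (f p)) :
    ∃ V : ℕ → P → Set Y, (∀ n p, IsOpen (V n p)) ∧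
      (∀ n p q x, x ∈ V n p → x ∈ V n q → p = q) ∧
      (∀ n p x, x ∈ V n p → 0 < f p x) ∧
      (∀ x, (∃ p, 0 < f p x) → ∃ n p, x ∈ V n p) ∧
      ∀ ι : Y → Y, Isometry ι → (∀ p x, f p (ι x) = f p x) →
        ∀ n p x, x ∈ V n p → ι x ∈ V n p := by
  classical
  set r : P → P → Prop := WellOrderingRel with hr
  let η : ℕ → ℝ := fun n => 1 / (n + 1)
  have hη : ∀ n, 0 < η n := fun n => by positivity
  let C : ℕ → P → Set Y := fun n p => {x | 3 * η n ≤ f p x ∧ ∀ q, r q p → f q x ≤ 0}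
  have key1 : ∀ n p x, x ∈ Metric.thickening (η n) (C n p) → 2 * η n < f p x := by
    intro n p x hx
    obtain ⟨z, hz, hd⟩ := Metric.mem_thickening_iff.1 hx
    have := (hf p).dist_le_mul x z
    rw [Real.dist_eq] at this
    have h1 := neg_abs_le (f p x - f p z)
    have h2 := hz.1
    simp only [NNReal.coe_one, one_mul] at this
    linarith
  have key2 : ∀ n p q x, x ∈ Metric.thickening (η n) (C n p) → r q p → f q x < η n := by
    intro n p q x hx hqp
    obtain ⟨z, hz, hd⟩ := Metric.mem_thickening_iff.1 hx
    have := (hf q).dist_le_mul x z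
    rw [Real.dist_eq] at this
    have h1 := le_abs_self (f q x - f q z)
    have h2 := hz.2 q hqp
    simp only [NNReal.coe_one, one_mul] at this
    linarith
  refine ⟨fun n p => Metric.thickening (η n) (C n p), fun n p => Metric.isOpen_thickening,
    ?_, ?_, ?_, ?_⟩
  · intro n p q x hp hq
    rcases trichotomous_of r p q with h | h | h
    · have := key2 n q p x hq h
      have := key1 n p x hp
      linarith [hη n]
    · exact h
    · have := key2 n p q x hp h
      have := key1 n q x hq
      linarith [hη n]
  · intro n p x hx
    linarith [key1 n p x hx, hη n]
  · intro x hx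
    have wf : WellFounded r := IsWellFounded.wf
    set p := wf.min {p | 0 < f p x} hx with hp
    have hpx : 0 < f p x := wf.min_mem _ hx
    obtain ⟨n, hn⟩ := exists_nat_one_div_lt (show (0 : ℝ) < f p x / 3 by positivity)
    refine ⟨n, p, Metric.self_subset_thickening (hη n) _ ⟨?_, fun q hq => ?_⟩⟩
    · have : η n < f p x / 3 := hn
      linarith
    · by_contra hcon
      exact wf.not_lt_min {p | 0 < f p x} (not_le.1 hcon) hq
  · intro ι hι hfι n p x hx
    obtain ⟨z, hz, hd⟩ := Metric.mem_thickening_iff.1 hx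
    refine Metric.mem_thickening_iff.2 ⟨ι z, ⟨?_, ?_⟩, by rwa [hι.dist_eq]⟩
    · rw [hfι]; exact hz.1
    · intro q hq; rw [hfι]; exact hz.2 q hq

/-- An inner product space minus the origin is covered by countably many open sets `U n ∪ -U n` with
`U n` and `-U n` disjoint. -/
theorem exists_countable_odd_cover (X : Type*) [NormedAddCommGroup X] [InnerProductSpace ℝ X] :
    ∃ U : ℕ → Set X, (∀ n, IsOpen (U n)) ∧ (∀ n x, x ∈ U n → -x ∉ U n) ∧
      ∀ x, x ≠ 0 → ∃ n, x ∈ U n ∨ -x ∈ U n := by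
  obtain ⟨V, hVo, hVd, hVf, hVc, hVi⟩ := exists_disjoint_open_families
    (fun (p : Metric.closedBall (0 : X) 1) (x : X) => |inner ℝ (p : X) x|) (by
      intro p
      refine LipschitzWith.of_dist_le_mul fun x y => ?_
      rw [Real.dist_eq, NNReal.coe_one, one_mul, dist_eq_norm]
      refine (abs_abs_sub_abs_le_abs_sub _ _).trans ?_
      rw [← inner_sub_right]
      refine (abs_real_inner_le_norm _ _).trans ?_
      have : ‖(p : X)‖ ≤ 1 := mem_closedBall_zero_iff.1 p.2
      nlinarith [norm_nonneg (x - y)])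
  have hneg : ∀ n p x, x ∈ V n p → -x ∈ V n p := fun n p x hx =>
    hVi (fun x => -x) (IsometryEquiv.neg X).isometry (by simp) n p x hx
  refine ⟨fun n => ⋃ p, V n p ∩ {x | 0 < inner ℝ (p : X) x}, fun n => isOpen_iUnion fun p =>
    (hVo n p).inter (isOpen_lt continuous_const (by fun_prop)), ?_, ?_⟩
  · intro n x hx hx'
    obtain ⟨p, hp, hpx⟩ := mem_iUnion.1 hx
    obtain ⟨q, hq, hqx⟩ := mem_iUnion.1 hx'
    have : p = q := hVd n p q (-x) (hneg _ _ _ hp) hq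
    subst this
    simp only [mem_ofPred_eq, inner_neg_right] at hpx hqx
    linarith
  · intro x hx
    have hp : ‖x‖⁻¹ • x ∈ Metric.closedBall (0 : X) 1 := by
      simp [norm_smul, hx]
    obtain ⟨n, p, hxp⟩ := hVc x ⟨⟨_, hp⟩, by
      have : 0 < ‖x‖ := norm_pos_iff.2 hx
      simp only [inner_smul_left, real_inner_self_eq_norm_sq, abs_pos]
      simp [hx]⟩
    have h0 := abs_pos.1 (hVf n p x hxp)
    refine ⟨n, ?_⟩
    rcases lt_or_gt_of_ne h0 with h | h
    · right
      exact mem_iUnion.2 ⟨p, hneg _ _ _ hxp, by simpa [inner_neg_right] using h⟩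
    · left
      exact mem_iUnion.2 ⟨p, hxp, h⟩

/-- An open subset of a metric space is the set of positivity of a continuous function with values
in `[0,1]`. -/
theorem exists_continuous_pos_iff {Y : Type*} [PseudoMetricSpace Y] {U : Set Y} (hU : IsOpen U) :
    ∃ l : Y → unitInterval, Continuous l ∧ ∀ x, 0 < l x ↔ x ∈ U := by
  have hc : Continuous fun x => (min 1 (Metric.infEDist x Uᶜ)).toReal :=
    ENNReal.continuousOn_toReal.comp_continuous
      (continuous_const.min Metric.continuous_infEDist) (fun x => by simp)
  refine ⟨fun x => ⟨(min 1 (Metric.infEDist x Uᶜ)).toReal, ENNReal.toReal_nonneg, ?_⟩,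
    hc.subtype_mk _, fun x => ?_⟩
  · refine ENNReal.toReal_le_of_le_ofReal zero_le_one ?_
    simp
  · rw [← Subtype.coe_lt_coe]
    simp only [Set.Icc.coe_zero]
    rw [ENNReal.toReal_pos_iff]
    have h1 : min 1 (Metric.infEDist x Uᶜ) < ⊤ := by simp
    simp only [h1, and_true, lt_min_iff, zero_lt_one, true_and]
    by_cases h : Uᶜ.Nonempty
    · rw [pos_iff_ne_zero, Ne, ← Metric.mem_iff_infEDist_zero_of_closed hU.isClosed_compl]
      simp
    · rw [not_nonempty_iff_eq_empty] at h
      simp [compl_empty_iff.1 h]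

/-- Homotopies that are defined near each point of `O` and move the points of `O` strictly are
combined to countably many global homotopies, such that every point of `O` is moved
strictly by one of them. -/
theorem exists_countable_steps {Y : Type*} [PseudoMetricSpace Y] (O : Set Y)
    (Q R : Y → Y → Prop) (hQ : ∀ x, Q x x)
    (hloc : ∀ z ∈ O, ∃ r > 0, ∃ H : Y → ℝ → Y,
      ContinuousOn (Function.uncurry H) (Metric.ball z r ×ˢ Icc 0 1) ∧
      ∀ x ∈ Metric.ball z r, H x 0 = x ∧ ∀ t ∈ Icc (0 : ℝ) 1,
        Q x (H x t) ∧ dist (H x t) x ≤ t ∧ (0 < t → R x (H x t))) :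
    ∃ E : ℕ → Y × unitInterval → Y, (∀ n, Continuous (E n)) ∧ (∀ n y, E n (y, 0) = y) ∧
      (∀ n y t, Q y (E n (y, t))) ∧ ∀ z ∈ O, ∃ n, R z (E n (z, 1)) := by
  classical
  choose! r hr H hHc hH using hloc
  obtain ⟨V, hVo, hVd, hVf, hVc, -⟩ := exists_disjoint_open_families
    (fun (p : O) (x : Y) => r p - dist x p) (by
      intro p
      refine LipschitzWith.of_dist_le_mul fun x y => ?_
      rw [Real.dist_eq, NNReal.coe_one, one_mul]
      have := abs_dist_sub_le y x (p : Y)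
      rw [dist_comm y x] at this
      convert this using 2
      ring)
  have hball : ∀ n p x, x ∈ V n p → x ∈ Metric.ball (p : Y) (r p) := fun n p x hx => by
    have := hVf n p x hx
    simp only [Metric.mem_ball]
    linarith
  choose l hlc hl using fun n => exists_continuous_pos_iff (isOpen_iUnion (hVo n))
  -- the time is slowed down by `l n`, which vanishes at the boundary of the domain of `H p`
  let E : ℕ → Y × unitInterval → Y := fun n w =>
    if h : ∃ p, w.1 ∈ V n p then H h.choose w.1 (l n w.1 * w.2) else w.1
  have hmul : ∀ (s t : unitInterval), (s * t : ℝ) ∈ Icc (0 : ℝ) 1 := fun s t => (s * t).2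
  have hE1 : ∀ n p w, w.1 ∈ V n p → E n w = H p w.1 (l n w.1 * w.2) := by
    intro n p w hw
    have h : ∃ p, w.1 ∈ V n p := ⟨p, hw⟩
    have : h.choose = p := hVd n _ _ _ h.choose_spec hw
    simp only [E, dif_pos h, this]
  have hE2 : ∀ n w, (¬ ∃ p, w.1 ∈ V n p) → E n w = w.1 := fun n w h => dif_neg h
  have hEd : ∀ n w, dist (E n w) w.1 ≤ l n w.1 := by
    intro n w
    by_cases h : ∃ p, w.1 ∈ V n p
    · obtain ⟨p, hp⟩ := h
      rw [hE1 n p w hp]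
      refine ((hH p p.2 w.1 (hball _ _ _ hp)).2 _ (hmul _ _)).2.1.trans ?_
      exact mul_le_of_le_one_right (l n w.1).2.1 w.2.2.2
    · rw [hE2 n w h, dist_self]
      exact (l n w.1).2.1
  refine ⟨E, fun n => ?_, fun n y => ?_, fun n y t => ?_, fun z hz => ?_⟩
  · rw [continuous_iff_continuousAt]
    intro w
    by_cases h : ∃ p, w.1 ∈ V n p
    · obtain ⟨p, hp⟩ := h
      have hev : ∀ᶠ w' : Y × unitInterval in 𝓝 w, w'.1 ∈ V n p :=
        continuousAt_fst.eventually ((hVo n p).mem_nhds hp)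
      have : E n =ᶠ[𝓝 w] fun w' => H p w'.1 (l n w'.1 * w'.2) :=
        hev.mono fun w' hw' => hE1 n p w' hw'
      refine ContinuousAt.congr ?_ this.symm
      have hc : ContinuousOn (fun w' : Y × unitInterval =>
          Function.uncurry (H p) (w'.1, (l n w'.1 * w'.2 : ℝ))) (Prod.fst ⁻¹' V n p) := by
        refine (hHc p p.2).comp ?_ ?_
        · have := hlc n
          fun_prop
        · intro w' hw'
          exact ⟨hball n p _ hw', hmul _ _⟩
      exact hc.continuousAt (((hVo n p).preimage continuous_fst).mem_nhds hp)
    · have h0 : l n w.1 = 0 := by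
        by_contra h0
        have := (hl n w.1).1 (unitInterval.pos_iff_ne_zero.2 h0)
        exact h (mem_iUnion.1 this)
      rw [ContinuousAt, hE2 n w h, tendsto_iff_dist_tendsto_zero]
      have h1 : Tendsto (fun w' : Y × unitInterval => (l n w'.1 : ℝ) + dist w'.1 w.1) (𝓝 w)
          (𝓝 0) := by
        have : Continuous fun w' : Y × unitInterval => (l n w'.1 : ℝ) + dist w'.1 w.1 := by
          have := hlc n
          fun_prop
        simpa [h0] using this.tendsto w
      refine squeeze_zero (fun _ => dist_nonneg) (fun w' => ?_) h1
      exact (dist_triangle _ w'.1 _).trans (add_le_add_left (hEd n w') _)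
  · by_cases h : ∃ p, y ∈ V n p
    · obtain ⟨p, hp⟩ := h
      rw [hE1 n p _ hp]
      simpa using (hH p p.2 y (hball _ _ _ hp)).1
    · exact hE2 n _ h
  · by_cases h : ∃ p, y ∈ V n p
    · obtain ⟨p, hp⟩ := h
      rw [hE1 n p _ hp]
      exact ((hH p p.2 y (hball _ _ _ hp)).2 _ (hmul _ _)).1
    · rw [hE2 n _ h]; exact hQ y
  · obtain ⟨n, p, hp⟩ := hVc z ⟨⟨z, hz⟩, by simpa using hr z hz⟩
    refine ⟨n, ?_⟩
    rw [hE1 n p _ hp]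
    have hpos : 0 < l n z := (hl n z).2 (mem_iUnion.2 ⟨p, hp⟩)
    exact ((hH p p.2 z (hball _ _ _ hp)).2 _ (hmul _ _)).2.2 (by simpa using hpos)

/-- A sequence of continuous maps that is locally eventually constant has a continuous limit. -/
theorem exists_continuous_of_locally_eventually_const {W Y : Type*} [TopologicalSpace W]
    [TopologicalSpace Y] (F : ℕ → W → Y) (hF : ∀ n, Continuous (F n))
    (hloc : ∀ w, ∃ N, ∀ᶠ w' in 𝓝 w, ∀ n ≥ N, F (n + 1) w' = F n w') :
    ∃ G : W → Y, Continuous G ∧ ∀ w, ∃ N, ∀ n ≥ N, G w = F n w := by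
  choose N hN using hloc
  have hc : ∀ w, ∀ᶠ w' in 𝓝 w, ∀ n ≥ N w, F n w' = F (N w) w' := by
    intro w
    filter_upwards [hN w] with w' hw' n hn
    induction n, hn using Nat.le_induction with
    | base => rfl
    | succ n hn ih => rw [hw' n hn, ih]
  refine ⟨fun w => F (N w) w, ?_, fun w => ⟨N w, fun n hn => ((hc w).self_of_nhds n hn).symm⟩⟩
  rw [continuous_iff_continuousAt]
  intro w
  refine (hF (N w)).continuousAt.congr ?_
  filter_upwards [hc w] with w' hw'
  rcases le_total (N w) (N w') with h | h
  · exact (hw' _ h).symm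
  · exact (hc w').self_of_nhds _ h

/-- If countably many `Φ`-decreasing homotopies decrease `Φ` strictly on `{Φ ≥ a}`, and if the
sequences obtained by iterating them converge as long as they stay in `{Φ ≥ a}`, then their
iteration yields a `Φ`-decreasing homotopy that ends in `{Φ < a}`. -/
theorem exists_homotopy_of_steps {Y : Type*} [TopologicalSpace Y] [T2Space Y]
    [ParacompactSpace Y] {Φ : Y → ℝ} (hΦ : Continuous Φ) (a : ℝ) (E : ℕ → Y × unitInterval → Y)
    (hE : ∀ n, Continuous (E n)) (hE0 : ∀ n y, E n (y, 0) = y)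
    (hEΦ : ∀ n y t, Φ (E n (y, t)) ≤ Φ y)
    (hE1 : ∀ z, a ≤ Φ z → ∃ n, Φ (E n (z, 1)) < Φ z)
    (hlim : ∀ (s : ℕ → ℕ) (x : ℕ → Y), (∀ k, x (k + 1) = E (s k) (x k, 1)) →
      (∀ k, a ≤ Φ (x k)) → ∃ z, Tendsto x atTop (𝓝 z)) :
    ∃ r : Y × unitInterval → Y, Continuous r ∧ (∀ y, r (y, 0) = y) ∧
      (∀ y t, Φ (r (y, t)) ≤ Φ y) ∧ ∀ y, Φ (r (y, 1)) < a := by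
  -- each homotopy is applied infinitely often, so that it also acts near the limit of the iterates
  let s : ℕ → ℕ := fun k => (Nat.unpair k).1
  have hs : ∀ n, ∃ᶠ k in atTop, s k = n := by
    intro n
    rw [frequently_atTop]
    intro N
    exact ⟨Nat.pair n N, Nat.right_le_pair n N, by simp [s]⟩
  -- the iterates at full time
  let x : ℕ → Y → Y := fun k => Nat.rec id (fun k f y => E (s k) (f y, 1)) k
  have hx1 : ∀ k y, x (k + 1) y = E (s k) (x k y, 1) := fun k y => rfl
  have hxc : ∀ k, Continuous (x k) := by
    intro k
    induction k with
    | zero => exact continuous_id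
    | succ k ih => exact (hE _).comp (ih.prodMk continuous_const)
  have hxa : ∀ y, ∃ k, Φ (x k y) < a := by
    intro y
    by_contra! hcon
    obtain ⟨z, hz⟩ := hlim s (fun k => x k y) (fun k => hx1 k y) hcon
    have hΦz : Tendsto (fun k => Φ (x k y)) atTop (𝓝 (Φ z)) := (hΦ.tendsto z).comp hz
    have hanti : Antitone fun k => Φ (x k y) := antitone_nat_of_succ_le fun k => hEΦ _ _ _
    have hge : ∀ k, Φ z ≤ Φ (x k y) := fun k => hanti.le_of_tendsto hΦz k
    obtain ⟨n, hn⟩ := hE1 z (ge_of_tendsto' hΦz hcon)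
    have hcont : Tendsto (fun k => Φ (E n (x k y, 1))) atTop (𝓝 (Φ (E n (z, 1)))) :=
      ((hΦ.comp (hE n)).tendsto (z, 1)).comp (hz.prodMk_nhds tendsto_const_nhds)
    obtain ⟨k, hk, hsk⟩ := ((hs n).and_eventually (hcont.eventually_lt_const hn)).exists
    have := hge (k + 1)
    rw [hx1, hk] at this
    linarith
  -- a continuous number of iterations that suffices
  obtain ⟨T, hT⟩ := exists_continuous_forall_mem_convex_of_local_const
    (t := fun y => {t : ℝ | ∃ k : ℕ, (k : ℝ) ≤ t ∧ Φ (x k y) < a})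
    (fun y => by
      have : OrdConnected {t : ℝ | ∃ k : ℕ, (k : ℝ) ≤ t ∧ Φ (x k y) < a} := by
        refine IsUpperSet.ordConnected ?_
        rintro t t' htt' ⟨k, hk, hk'⟩
        exact ⟨k, hk.trans htt', hk'⟩
      exact this.convex)
    (fun y => by
      obtain ⟨k, hk⟩ := hxa y
      refine ⟨k, ?_⟩
      filter_upwards [(hΦ.comp (hxc k)).continuousAt.eventually_lt_const hk] with y' hy'
      exact ⟨k, le_rfl, hy'⟩)
  -- during the time `T`, one homotopy after the other runs, each of them for one unit of time
  let τ : ℕ → Y × unitInterval → unitInterval := fun k w =>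
    projIcc 0 1 zero_le_one (w.2 * T w.1 - k)
  have hτc : ∀ k, Continuous (τ k) := by
    intro k
    refine continuous_projIcc.comp ?_
    have := T.continuous
    fun_prop
  have hτ0 : ∀ (k : ℕ) w, (w.2 * T w.1 : ℝ) ≤ k → τ k w = 0 := fun k w h =>
    projIcc_of_le_left _ (by linarith)
  let F : ℕ → Y × unitInterval → Y :=
    fun k => Nat.rec Prod.fst (fun k f w => E (s k) (f w, τ k w)) k
  have hF1 : ∀ k w, F (k + 1) w = E (s k) (F k w, τ k w) := fun k w => rfl
  have hFc : ∀ k, Continuous (F k) := by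
    intro k
    induction k with
    | zero => exact continuous_fst
    | succ k ih => exact (hE _).comp (ih.prodMk (hτc k))
  obtain ⟨G, hGc, hG⟩ := exists_continuous_of_locally_eventually_const F hFc (by
    intro w
    obtain ⟨N, hN⟩ := exists_nat_gt ((w.2 * T w.1 : ℝ))
    have hc : Continuous fun w : Y × unitInterval => (w.2 * T w.1 : ℝ) := by
      have := T.continuous
      fun_prop
    refine ⟨N, ?_⟩
    filter_upwards [hc.continuousAt.eventually_lt_const hN] with w' hw' n hn
    rw [hF1, hτ0 n w' (hw'.le.trans (by exact_mod_cast hn)), hE0])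
  have hFanti : ∀ w, Antitone fun k => Φ (F k w) := fun w =>
    antitone_nat_of_succ_le fun k => hEΦ _ _ _
  refine ⟨G, hGc, fun y => ?_, fun y t => ?_, fun y => ?_⟩
  · obtain ⟨N, hN⟩ := hG (y, 0)
    have : ∀ k, F k (y, 0) = y := by
      intro k
      induction k with
      | zero => rfl
      | succ k ih => rw [hF1, ih, hτ0 _ _ (by simp), hE0]
    rw [hN N le_rfl, this]
  · obtain ⟨N, hN⟩ := hG (y, t)
    rw [hN N le_rfl]
    exact hFanti _ (Nat.zero_le N)
  · obtain ⟨k, hk, hka⟩ := hT y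
    obtain ⟨N, hN⟩ := hG (y, 1)
    have hFx : ∀ j ≤ k, F j (y, 1) = x j y := by
      intro j hj
      induction j with
      | zero => rfl
      | succ j ih =>
        have : τ j (y, 1) = 1 := by
          refine projIcc_of_right_le _ ?_
          have : ((j + 1 : ℕ) : ℝ) ≤ k := by exact_mod_cast hj
          push_cast at this
          simp only [Set.Icc.coe_one, one_mul]
          linarith
        rw [hF1, hx1, ih (by omega), this]
    rw [hN (max N k) (le_max_left _ _)]
    refine (hFanti _ (le_max_right N k)).trans_lt ?_
    simp only [hFx k le_rfl, hka]

/-- A homotopy of a symmetric set `Z` into a symmetric subset `A`, which need not be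
odd, gives rise to an odd map from `Z` to `A`: apply the homotopy `r`, or its mirror image
`y ↦ -r(-y)`, one after the other on the pieces of a locally finite cover of `Z` by
sets `U n ∪ -U n`, with a time that depends on the original point only. -/
theorem exists_odd_map_of_homotopy {X : Type*} [NormedAddCommGroup X] [InnerProductSpace ℝ X]
    {Z A : Set X} (h0 : (0 : X) ∉ Z) (hZ : ∀ x ∈ Z, -x ∈ Z) (hA : ∀ x ∈ A, -x ∈ A)
    (r : Z × unitInterval → Z) (hr : Continuous r) (hr0 : ∀ y : Z, r (y, 0) = y)
    (hrA : ∀ (y : Z) t, (y : X) ∈ A → (r (y, t) : X) ∈ A) (hr1 : ∀ y : Z, (r (y, 1) : X) ∈ A) :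
    ∃ F : Z → X, Continuous F ∧ (∀ z, F z ∈ A) ∧
      ∀ z : Z, F ⟨-z, hZ z z.2⟩ = -F z := by
  classical
  let ν : Z → Z := fun z => ⟨-z, hZ z z.2⟩
  have hν : Continuous ν := by
    refine Continuous.subtype_mk ?_ _
    fun_prop
  have hνν : ∀ z, ν (ν z) = z := fun z => by simp [ν]
  obtain ⟨U, hUo, hUd, hUc⟩ := exists_countable_odd_cover X
  let U' : ℕ → Set Z := fun n => {z | (z : X) ∈ U n}
  have hU'o : ∀ n, IsOpen (U' n) := fun n => (hUo n).preimage continuous_subtype_val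
  have hU'd : ∀ n z, z ∈ U' n → ν z ∉ U' n := fun n z h => hUd n _ h
  obtain ⟨f, hf⟩ := BumpCovering.exists_isSubordinate (s := (univ : Set Z)) isClosed_univ
    (fun n => U' n ∪ ν ⁻¹' U' n) (fun n => (hU'o n).union ((hU'o n).preimage hν)) (by
      intro z _
      have : (z : X) ≠ 0 := fun h => h0 (h ▸ z.2)
      obtain ⟨n, hn⟩ := hUc _ this
      exact mem_iUnion.2 ⟨n, hn⟩)
  -- an even function supported in `U n ∪ -U n`
  let τ : ℕ → Z → unitInterval := fun n z =>
    max ⟨f n z, f.nonneg n z, f.le_one n z⟩ ⟨f n (ν z), f.nonneg n _, f.le_one n _⟩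
  have hτc : ∀ n, Continuous (τ n) := by
    intro n
    have := (f n).continuous
    refine Continuous.max ?_ ?_
    · exact Continuous.subtype_mk this _
    · exact Continuous.subtype_mk (this.comp hν) _
  have hτν : ∀ n z, τ n (ν z) = τ n z := by
    intro n z
    simp only [τ, hνν]
    exact max_comm _ _
  have hτ0 : ∀ n z, f n z = 0 → f n (ν z) = 0 → τ n z = 0 := by
    intro n z h1 h2
    simp only [τ, h1, h2]
    exact max_self _
  have hτ1 : ∀ n z, f n z = 1 → τ n z = 1 := by
    intro n z h1
    simp only [τ, h1]
    exact max_eq_left (unitInterval.le_one' )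
  -- stage `n`: the first component of `w` is the initial point, the second one is moved
  let S : ℕ → Z × Z → Z := fun n w =>
    if w.1 ∈ U' n then r (w.2, τ n w.1) else
      if ν w.1 ∈ U' n then ν (r (ν w.2, τ n w.1)) else w.2
  have hS0 : ∀ n w, τ n w.1 = 0 → S n w = w.2 := by
    intro n w h
    simp only [S, h, hr0, hνν, ite_self]
  have hSc : ∀ n, Continuous (S n) := by
    intro n
    have hτn := hτc n
    rw [continuous_iff_continuousAt]
    intro w
    by_cases h1 : w.1 ∈ U' n
    · have hev : ∀ᶠ w' : Z × Z in 𝓝 w, w'.1 ∈ U' n :=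
        continuousAt_fst.eventually ((hU'o n).mem_nhds h1)
      have : Continuous fun w : Z × Z => r (w.2, τ n w.1) := by fun_prop
      refine this.continuousAt.congr ?_
      filter_upwards [hev] with w' hw'
      simp only [S, if_pos hw']
    by_cases h2 : ν w.1 ∈ U' n
    · have hev : ∀ᶠ w' : Z × Z in 𝓝 w, ν w'.1 ∈ U' n :=
        (hν.comp continuous_fst).continuousAt.eventually ((hU'o n).mem_nhds h2)
      have : Continuous fun w : Z × Z => ν (r (ν w.2, τ n w.1)) := by fun_prop
      refine this.continuousAt.congr ?_
      filter_upwards [hev] with w' hw'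
      have : w'.1 ∉ U' n := fun h => hU'd n _ h hw'
      simp only [S, if_pos hw', if_neg this]
    · have hts : ∀ z : Z, z ∉ U' n → ν z ∉ U' n → ∀ᶠ z' in 𝓝 z, f n z' = 0 := by
        intro z hz hz'
        have : z ∉ tsupport (f n) := fun h => (hf n h).elim hz hz'
        exact notMem_tsupport_iff_eventuallyEq.1 this
      have e1 := hts w.1 h1 h2
      have e2 : ∀ᶠ z' in 𝓝 w.1, f n (ν z') = 0 :=
        hν.continuousAt.eventually (hts (ν w.1) h2 (by rwa [hνν]))
      refine continuousAt_snd.congr ?_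
      filter_upwards [continuousAt_fst.eventually e1, continuousAt_fst.eventually e2]
        with w' hw1 hw2
      exact (hS0 n w' (hτ0 n _ hw1 hw2)).symm
  have hSν : ∀ n z y, S n (ν z, ν y) = ν (S n (z, y)) := by
    intro n z y
    by_cases h1 : z ∈ U' n
    · have h2 := hU'd n z h1
      simp only [S, if_neg h2, hνν, if_pos h1, hτν]
    · by_cases h2 : ν z ∈ U' n
      · simp only [S, if_neg h1, hνν, if_pos h2, hτν]
      · simp only [S, if_neg h1, hνν, if_neg h2]
  have hνA : ∀ z : Z, (z : X) ∈ A → (ν z : X) ∈ A := fun z hz => hA _ hz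
  have hSA : ∀ n z (y : Z), (y : X) ∈ A → (S n (z, y) : X) ∈ A := by
    intro n z y hy
    simp only [S]
    split_ifs
    · exact hrA _ _ hy
    · exact hνA _ (hrA _ _ (hνA _ hy))
    · exact hy
  have hS1 : ∀ n z y, f n z = 1 → (S n (z, y) : X) ∈ A := by
    intro n z y hz
    have hmem : z ∈ U' n ∪ ν ⁻¹' U' n := hf n (subset_tsupport _ (by simp [hz]))
    by_cases h1 : z ∈ U' n
    · simp only [S, if_pos h1, hτ1 n z hz]; exact hr1 _
    · have h2 : ν z ∈ U' n := hmem.resolve_left h1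
      simp only [S, if_neg h1, if_pos h2, hτ1 n z hz]; exact hνA _ (hr1 _)
  let F : ℕ → Z → Z := fun k => Nat.rec id (fun k f w => S k (w, f w)) k
  have hF1 : ∀ k w, F (k + 1) w = S k (w, F k w) := fun k w => rfl
  have hFc : ∀ k, Continuous (F k) := by
    intro k
    induction k with
    | zero => exact continuous_id
    | succ k ih => exact (hSc k).comp (continuous_id.prodMk ih)
  have hFν : ∀ k z, F k (ν z) = ν (F k z) := by
    intro k z
    induction k with
    | zero => rfl
    | succ k ih => rw [hF1, hF1, ih, hSν]
  obtain ⟨G, hGc, hG⟩ := exists_continuous_of_locally_eventually_const F hFc (by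
    intro w
    have hlf : ∀ z : Z, ∃ N, ∀ᶠ z' in 𝓝 z, ∀ n ≥ N, f n z' = 0 := by
      intro z
      obtain ⟨t, ht, hfin⟩ := f.locallyFinite z
      obtain ⟨N, hN⟩ := hfin.bddAbove
      refine ⟨N + 1, ?_⟩
      filter_upwards [ht] with z' hz' n hn
      by_contra hne
      have := hN (show n ∈ {i | (Function.support (f i) ∩ t).Nonempty} from ⟨z', hne, hz'⟩)
      omega
    obtain ⟨N1, h1⟩ := hlf w
    obtain ⟨N2, h2⟩ := hlf (ν w)
    refine ⟨max N1 N2, ?_⟩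
    filter_upwards [h1, hν.continuousAt.eventually h2] with w' hw1 hw2 n hn
    rw [hF1]
    exact hS0 n _ (hτ0 n _ (hw1 n (le_of_max_le_left hn)) (hw2 n (le_of_max_le_right hn))))
  refine ⟨fun z => G z, continuous_subtype_val.comp hGc, fun z => ?_, fun z => ?_⟩
  · obtain ⟨n, hn⟩ : ∃ n, f n =ᶠ[𝓝 z] 1 := ⟨_, f.eventuallyEq_one z (mem_univ z)⟩
    obtain ⟨N, hN⟩ := hG z
    have h1 : (F (n + 1) z : X) ∈ A := hS1 n z _ hn.self_of_nhds
    have h2 : ∀ k : ℕ, n + 1 ≤ k → (F k z).1 ∈ A := by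
      intro k hk
      induction k, hk using Nat.le_induction with
      | base => exact h1
      | succ k hk ih => exact hSA k z _ ih
    change (G z).1 ∈ A
    rw [hN (max N (n + 1)) (le_max_left _ _)]
    exact h2 _ (le_max_right _ _)
  · obtain ⟨N1, hN1⟩ := hG z
    obtain ⟨N2, hN2⟩ := hG (ν z)
    have : G (ν z) = ν (G z) := by
      rw [hN1 (max N1 N2) (le_max_left _ _), hN2 (max N1 N2) (le_max_right _ _), hFν]
    exact congrArg Subtype.val this

/-! ### The genus -/

section Genus

variable {X : Type*} [NormedAddCommGroup X]

/-- The values of an odd map without zeros can be normalised. -/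
theorem genus_le_finrank [InnerProductSpace ℝ X] {V : Type*} [NormedAddCommGroup V]
    [NormedSpace ℝ V] [FiniteDimensional ℝ V] {Z : Set X} (h : X → V) (hc : ContinuousOn h Z)
    (h0 : ∀ z ∈ Z, h z ≠ 0) (hodd : ∀ z ∈ Z, h (-z) = -h z) :
    genus Z ≤ Module.finrank ℝ V := by
  let e : V ≃L[ℝ] EuclideanSpace ℝ (Fin (Module.finrank ℝ V)) :=
    ContinuousLinearEquiv.ofFinrankEq (by simp)
  have he0 : ∀ z ∈ Z, e (h z) ≠ 0 := fun z hz => by simpa using h0 z hz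
  refine iInf₂_le _ ⟨fun z => ‖e (h z)‖⁻¹ • e (h z), ?_, fun z hz => ⟨?_, ?_⟩⟩
  · have h1 : ContinuousOn (fun z => e (h z)) Z := e.continuous.comp_continuousOn hc
    exact (h1.norm.inv₀ fun z hz => norm_ne_zero_iff.2 (he0 z hz)).smul h1
  · rw [norm_smul, norm_inv, norm_norm, inv_mul_cancel₀ (norm_ne_zero_iff.2 (he0 z hz))]
  · simp only [hodd z hz, map_neg, norm_neg, smul_neg]

theorem exists_odd_map_of_genus_ne_top [InnerProductSpace ℝ X] {Z : Set X} (hZ : genus Z ≠ ⊤) :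
    ∃ k : ℕ, genus Z = k ∧ ∃ h : X → EuclideanSpace ℝ (Fin k), ContinuousOn h Z ∧
      ∀ z ∈ Z, ‖h z‖ = 1 ∧ h (-z) = -h z := by
  obtain ⟨k, hk⟩ := ENat.ne_top_iff_exists.1 hZ
  have hlt : genus Z < (k + 1 : ℕ) := by
    rw [← hk]; exact_mod_cast Nat.lt_succ_self k
  obtain ⟨j, hj⟩ := iInf_lt_iff.1 hlt
  obtain ⟨h, hj⟩ := iInf_lt_iff.1 hj
  have h1 : genus Z ≤ j := iInf₂_le j h
  have h2 : j ≤ k := by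
    have : j < k + 1 := by exact_mod_cast hj
    omega
  have h3 : k ≤ j := by rw [← hk] at h1; exact_mod_cast h1
  obtain rfl : j = k := le_antisymm h2 h3
  exact ⟨j, hk.symm, h⟩

theorem genus_mono {Z A : Set X} (h : Z ⊆ A) : genus Z ≤ genus A :=
  le_iInf₂ fun k hk => by
    obtain ⟨g, hg, hg'⟩ := hk
    exact iInf₂_le k ⟨g, hg.mono h, fun z hz => hg' z (h hz)⟩

theorem genus_le_of_odd_map [InnerProductSpace ℝ X] {Z A : Set X} (hZ : ∀ z ∈ Z, -z ∈ Z)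
    (F : Z → X) (hF : Continuous F) (hFA : ∀ z, F z ∈ A)
    (hodd : ∀ z : Z, F ⟨-z, hZ z z.2⟩ = -F z) : genus Z ≤ genus A := by
  classical
  refine le_iInf₂ fun k hk => ?_
  obtain ⟨g, hg, hg'⟩ := hk
  have hval : ∀ z (hz : z ∈ Z), (fun z => if hz : z ∈ Z then g (F ⟨z, hz⟩) else 0) z
      = g (F ⟨z, hz⟩) := fun z hz => dif_pos hz
  refine iInf₂_le k ⟨fun z => if hz : z ∈ Z then g (F ⟨z, hz⟩) else 0, ?_, fun z hz => ?_⟩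
  · rw [continuousOn_iff_continuous_domRestrict]
    have : Continuous fun z : Z => g (F z) := hg.comp_continuous hF hFA
    refine this.congr fun z => ?_
    exact (hval z z.2).symm
  · rw [hval z hz, hval (-z) (hZ z hz), hodd ⟨z, hz⟩]
    exact hg' _ (hFA _)

/-- Subadditivity of the genus, for a set `Y` that is covered by a relatively closed
subset `Z` and a set on which `m` odd functions do not vanish simultaneously. -/
theorem genus_le_genus_add [InnerProductSpace ℝ X] {Y Z : Set X} (hY : ∀ y ∈ Y, -y ∈ Y)
    (hZY : Z ⊆ Y) (hZ : IsClosed ((fun y : Y => (y : X)) ⁻¹' Z)) (hZs : ∀ z ∈ Z, -z ∈ Z)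
    {ι : Type*} [Fintype ι] (p : ι → X → ℝ) (hp : ∀ i, ContinuousOn (p i) Y)
    (hodd : ∀ i, ∀ y ∈ Y, p i (-y) = -p i y) (hp0 : ∀ y ∈ Y, y ∉ Z → ∃ i, p i y ≠ 0) :
    genus Y ≤ genus Z + Fintype.card ι := by
  classical
  by_cases htop : genus Z = ⊤
  · simp [htop]
  obtain ⟨k, hk, h, hc, hh⟩ := exists_odd_map_of_genus_ne_top htop
  obtain ⟨g, hg⟩ := ContinuousMap.exists_restrict_eq (Y := EuclideanSpace ℝ (Fin k)) hZ
    ⟨fun y => h y, by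
      refine hc.comp_continuous (by fun_prop) fun y => y.2⟩
  have hgZ : ∀ z (hz : z ∈ Z), g ⟨z, hZY hz⟩ = h z := fun z hz =>
    congrArg (fun f => f ⟨⟨z, hZY hz⟩, hz⟩) hg
  -- an odd extension of `h` from `Z` to `Y`, completed by the functions `p i`
  let q : X → EuclideanSpace ℝ (Fin k) × (ι → ℝ) := fun y =>
    (if hy : y ∈ Y then g ⟨y, hy⟩ - g ⟨-y, hY y hy⟩ else 0, fun i => p i y)
  have hq : ∀ y (hy : y ∈ Y), q y = (g ⟨y, hy⟩ - g ⟨-y, hY y hy⟩, fun i => p i y) := by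
    intro y hy
    simp only [q, dif_pos hy]
  have hfin : Module.finrank ℝ (EuclideanSpace ℝ (Fin k) × (ι → ℝ)) = k + Fintype.card ι := by
    simp
  have := genus_le_finrank (Z := Y) q ?_ ?_ ?_
  · rw [hfin] at this
    rw [hk]
    exact_mod_cast this
  · rw [continuousOn_iff_continuous_domRestrict]
    have : Continuous fun y : Y => ((g y - g ⟨-y, hY y y.2⟩, fun i => p i y) :
        EuclideanSpace ℝ (Fin k) × (ι → ℝ)) := by
      refine Continuous.prodMk (g.continuous.sub (g.continuous.comp ?_)) ?_
      · exact Continuous.subtype_mk (by fun_prop) _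
      · refine continuous_pi fun i => ?_
        exact (continuousOn_iff_continuous_domRestrict.1 (hp i))
    exact this.congr fun y => (hq y y.2).symm
  · intro y hy h0
    rw [hq y hy, Prod.mk_eq_zero] at h0
    by_cases hyZ : y ∈ Z
    · have h1 := h0.1
      rw [hgZ y hyZ, hgZ (-y) (hZs y hyZ), (hh y hyZ).2, sub_neg_eq_add, ← two_smul ℝ,
        smul_eq_zero] at h1
      have h2 := (hh y hyZ).1
      rw [h1.resolve_left two_ne_zero] at h2
      simp at h2
    · obtain ⟨i, hi⟩ := hp0 y hy hyZ
      exact hi (congrFun h0.2 i)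
  · intro y hy
    rw [hq y hy, hq (-y) (hY y hy)]
    simp only [neg_neg, Prod.neg_mk, neg_sub]
    congr 1
    funext i
    exact hodd i y hy

end Genus

/-! ### The family of scalar products -/

section Family

variable {X : Type*} [NormedAddCommGroup X] [InnerProductSpace ℝ X]
  {B : X → X →ₗ[ℝ] X →ₗ[ℝ] ℝ}

/-- The standing assumptions on a family of scalar products. -/
structure IsMetricFamily (B : X → X →ₗ[ℝ] X →ₗ[ℝ] ℝ) : Prop where
  scalar : IsScalarProductFamily B
  equiv : LocallyUniformlyEquivalent B
  lipschitz : LocallyLipschitzFamily B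

theorem normAt_nonneg (u v : X) : 0 ≤ normAt B u v := Real.sqrt_nonneg _

theorem normAt_zero (u : X) : normAt B u 0 = 0 := by simp [normAt]

theorem normAt_smul (u v : X) (c : ℝ) : normAt B u (c • v) = |c| * normAt B u v := by
  simp only [normAt, map_smul, LinearMap.smul_apply, smul_eq_mul]
  rw [← mul_assoc, Real.sqrt_mul (mul_self_nonneg c), Real.sqrt_mul_self_eq_abs]

theorem normAt_neg (u v : X) : normAt B u (-v) = normAt B u v := by
  simp [normAt]

namespace IsMetricFamily

variable (hB : IsMetricFamily B)
include hB

theorem apply_self_nonneg {u : X} (hu : u ≠ 0) (v : X) : 0 ≤ B u v v := by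
  by_cases hv : v = 0
  · simp [hv]
  · exact ((hB.scalar u hu).2 v hv).le

theorem normAt_sq {u : X} (hu : u ≠ 0) (v : X) : normAt B u v ^ 2 = B u v v :=
  Real.sq_sqrt (hB.apply_self_nonneg hu v)

theorem abs_apply_le {u : X} (hu : u ≠ 0) (v w : X) :
    |B u v w| ≤ normAt B u v * normAt B u w := by
  have h := LinearMap.BilinForm.apply_mul_apply_le_of_forall_zero_le (B u)
    (hB.apply_self_nonneg hu) v w
  rw [(hB.scalar u hu).1 w v, ← hB.normAt_sq hu v, ← hB.normAt_sq hu w, ← mul_pow, ← sq] at h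
  exact abs_le_of_sq_le_sq h (mul_nonneg (normAt_nonneg _ _) (normAt_nonneg _ _))

/-- Near `u`, the norms `‖·‖_y` are uniformly equivalent to the norm of `X`. -/
theorem exists_ball {u : X} (hu : u ≠ 0) : ∃ R > 0, ∃ C > 0, ∀ y ∈ Metric.ball u R, y ≠ 0 ∧
    ∀ v, ‖v‖ ≤ C * normAt B y v ∧ normAt B y v ≤ C * ‖v‖ := by
  obtain ⟨U, hU, h0, C, hC, h⟩ := hB.equiv u hu
  obtain ⟨R, hR, hRU⟩ := Metric.mem_nhds_iff.1 hU
  refine ⟨R, hR, C, hC, fun y hy => ⟨fun hy0 => h0 (hy0 ▸ hRU hy), fun v => ?_⟩⟩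
  obtain ⟨h1, h2⟩ := h y (hRU hy) v
  exact ⟨(inv_mul_le_iff₀ hC).1 h1, h2⟩

theorem exists_equiv {u : X} (hu : u ≠ 0) : ∃ C > 0,
    ∀ v, ‖v‖ ≤ C * normAt B u v ∧ normAt B u v ≤ C * ‖v‖ := by
  obtain ⟨R, hR, C, hC, h⟩ := hB.exists_ball hu
  exact ⟨C, hC, (h u (Metric.mem_ball_self hR)).2⟩

/-- The scalar product `⟨·,·⟩_u` is bounded and coercive. -/
theorem exists_bilin {u : X} (hu : u ≠ 0) : ∃ b : X →L[ℝ] X →L[ℝ] ℝ,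
    (∀ v w, b v w = B u v w) ∧ IsCoercive b := by
  obtain ⟨C, hC, h⟩ := hB.exists_equiv hu
  have hb : ∀ v w, ‖B u v w‖ ≤ C * C * ‖v‖ * ‖w‖ := fun v w => by
    rw [Real.norm_eq_abs]
    refine (hB.abs_apply_le hu v w).trans ?_
    calc normAt B u v * normAt B u w ≤ (C * ‖v‖) * (C * ‖w‖) :=
          mul_le_mul (h v).2 (h w).2 (normAt_nonneg _ _) (by positivity)
      _ = _ := by ring
  refine ⟨LinearMap.mkContinuous₂ (B u) (C * C) hb, fun v w => rfl, (C * C)⁻¹, by positivity,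
    fun v => ?_⟩
  change _ ≤ B u v v
  rw [← hB.normAt_sq hu, mul_assoc, inv_mul_le_iff₀ (by positivity)]
  have := mul_self_le_mul_self (norm_nonneg v) (h v).1
  nlinarith

theorem continuousAt_normAt {u : X} (hu : u ≠ 0) (v : X) :
    ContinuousAt (fun p : X × X => normAt B p.1 p.2) (u, v) := by
  obtain ⟨b, hb, -⟩ := hB.exists_bilin hu
  obtain ⟨U, hU, -, C, hC, h⟩ := hB.lipschitz u hu
  refine ContinuousAt.sqrt ?_
  have h1 : ContinuousAt (fun p : X × X => b p.2 p.2) (u, v) := by fun_prop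
  have h2 : Tendsto (fun p : X × X => B p.1 p.2 p.2 - b p.2 p.2) (𝓝 (u, v)) (𝓝 0) := by
    have h3 : Tendsto (fun p : X × X => C * ‖p.1 - u‖ * ‖p.2‖ * ‖p.2‖) (𝓝 (u, v)) (𝓝 0) := by
      have : Continuous fun p : X × X => C * ‖p.1 - u‖ * ‖p.2‖ * ‖p.2‖ := by fun_prop
      simpa using this.tendsto (u, v)
    refine squeeze_zero_norm' ?_ h3
    filter_upwards [continuousAt_fst.eventually hU] with p hp
    rw [hb, Real.norm_eq_abs]
    exact h _ hp u (mem_of_mem_nhds hU) _ _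
  have h3 := h2.add h1.tendsto
  simp only [sub_add_cancel, zero_add] at h3
  rw [ContinuousAt, ← hb]
  exact h3

end IsMetricFamily

end Family

/-! ### The path metric -/

section PathDist

variable {X : Type*} [NormedAddCommGroup X] [InnerProductSpace ℝ X]
  {B : X → X →ₗ[ℝ] X →ₗ[ℝ] ℝ} {S : Set X} {u v w : X} {γ : ℝ → X}

/-- A `C^1`-curve `ℝ → S` that rests at `u` up to time `0` and at `v` from time `1` on. Such curves
can be concatenated. -/
structure IsRestingPath (S : Set X) (u v : X) (γ : ℝ → X) : Prop where
  contDiff : ContDiff ℝ 1 γ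
  mem : ∀ t, γ t ∈ S
  of_nonpos : ∀ t ≤ 0, γ t = u
  of_one_le : ∀ t, 1 ≤ t → γ t = v

/-- The length of `γ` on `[0,1]`, for a curve that is differentiable on `ℝ`. -/
noncomputable def arcLength (B : X → X →ₗ[ℝ] X →ₗ[ℝ] ℝ) (γ : ℝ → X) : ℝ :=
  ∫ s in (0 : ℝ)..1, normAt B (γ s) (deriv γ s)

theorem arcLength_nonneg (γ : ℝ → X) : 0 ≤ arcLength B γ :=
  intervalIntegral.integral_nonneg zero_le_one fun _ _ => normAt_nonneg _ _

theorem curveLength_eq_arcLength (hγ : ∀ t ∈ Icc (0 : ℝ) 1, DifferentiableAt ℝ γ t) :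
    curveLength B γ = arcLength B γ := by
  refine intervalIntegral.integral_congr fun s hs => ?_
  rw [uIcc_of_le zero_le_one] at hs
  simp only [(hγ s hs).derivWithin (uniqueDiffOn_Icc zero_lt_one s hs)]

theorem pathDist_le_arcLength (hγ : ∀ t ∈ Icc (0 : ℝ) 1, ContDiffAt ℝ 1 γ t)
    (hS : ∀ t ∈ Icc (0 : ℝ) 1, γ t ∈ S) (h0 : γ 0 = u) (h1 : γ 1 = v) :
    pathDist B S u v ≤ ENNReal.ofReal (arcLength B γ) := by
  refine iInf₂_le_of_le γ (fun t ht => (hγ t ht).contDiffWithinAt) ?_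
  refine iInf₂_le_of_le hS h0 ?_
  refine iInf_le_of_le h1 (le_of_eq ?_)
  rw [curveLength_eq_arcLength fun t ht => (hγ t ht).differentiableAt (by norm_num)]

theorem IsRestingPath.pathDist_le (h : IsRestingPath S u v γ) :
    pathDist B S u v ≤ ENNReal.ofReal (arcLength B γ) :=
  pathDist_le_arcLength (fun _ _ => h.contDiff.contDiffAt) (fun t _ => h.mem t)
    (h.of_nonpos 0 le_rfl) (h.of_one_le 1 le_rfl)

theorem IsRestingPath.continuous_deriv (h : IsRestingPath S u v γ) : Continuous (deriv γ) :=
  h.contDiff.continuous_deriv le_rfl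

theorem IsRestingPath.hasDerivAt (h : IsRestingPath S u v γ) (t : ℝ) :
    HasDerivAt γ (deriv γ t) t :=
  (h.contDiff.differentiable (by norm_num) t).hasDerivAt

theorem IsRestingPath.deriv_of_nonpos (h : IsRestingPath S u v γ) {t : ℝ} (ht : t ≤ 0) :
    deriv γ t = 0 := by
  rw [← (h.hasDerivAt t).differentiableAt.derivWithin (uniqueDiffOn_Iic t t self_mem_Iic)]
  rw [derivWithin_congr (f := fun _ => u) (fun s hs => h.of_nonpos s (hs.trans ht))
    (h.of_nonpos t ht)]
  simp

theorem IsRestingPath.deriv_of_one_le (h : IsRestingPath S u v γ) {t : ℝ} (ht : 1 ≤ t) :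
    deriv γ t = 0 := by
  rw [← (h.hasDerivAt t).differentiableAt.derivWithin (uniqueDiffOn_Ici t t self_mem_Ici)]
  rw [derivWithin_congr (s := Ici t) (f := fun _ => v) (fun s hs => h.of_one_le s (ht.trans hs))
    (h.of_one_le t ht)]
  simp

theorem isRestingPath_const (hu : u ∈ S) : IsRestingPath S u u fun _ => u :=
  ⟨contDiff_const, fun _ => hu, fun _ _ => rfl, fun _ _ => rfl⟩

theorem pathDist_self (hu : u ∈ S) : pathDist B S u u = 0 := by
  have := (isRestingPath_const hu).pathDist_le (B := B)
  simpa [arcLength, normAt_zero] using this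

theorem IsRestingPath.reverse (h : IsRestingPath S u v γ) :
    IsRestingPath S v u fun t => γ (1 - t) :=
  ⟨h.contDiff.comp (contDiff_const.sub contDiff_id), fun _ => h.mem _,
    fun t ht => h.of_one_le _ (by linarith), fun t ht => h.of_nonpos _ (by linarith)⟩

theorem arcLength_reverse (γ : ℝ → X) :
    arcLength B (fun t => γ (1 - t)) = arcLength B γ := by
  have : ∀ t, deriv (fun t => γ (1 - t)) t = -deriv γ (1 - t) := fun t =>
    deriv_comp_const_sub γ 1 t
  simp only [arcLength, this, normAt_neg]
  rw [intervalIntegral.integral_comp_sub_left (fun s => normAt B (γ s) (deriv γ s))]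
  simp

variable (hB : IsMetricFamily B) (h0 : (0 : X) ∉ S)
include hB h0

theorem IsRestingPath.continuous_normAt (h : IsRestingPath S u v γ) :
    Continuous fun s => normAt B (γ s) (deriv γ s) := by
  rw [continuous_iff_continuousAt]
  intro s
  have hne : γ s ≠ 0 := fun hs => h0 (hs ▸ h.mem s)
  exact (hB.continuousAt_normAt hne (deriv γ s)).comp (f := fun s => (γ s, deriv γ s))
    (h.contDiff.continuous.prodMk h.continuous_deriv).continuousAt

/-- Reparametrize with a smooth monotone function that is constant outside `[0,1]`. -/
theorem exists_restingPath_of_curve (hγ : ContDiffOn ℝ 1 γ (Icc 0 1))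
    (hS : ∀ s ∈ Icc (0 : ℝ) 1, γ s ∈ S) (hu : γ 0 = u) (hv : γ 1 = v) :
    ∃ δ, IsRestingPath S u v δ ∧ arcLength B δ = curveLength B γ := by
  have hmem : ∀ t, Real.smoothTransition t ∈ Icc (0 : ℝ) 1 := fun t =>
    ⟨Real.smoothTransition.nonneg t, Real.smoothTransition.le_one t⟩
  have hσ : ContDiff ℝ 1 Real.smoothTransition := Real.smoothTransition.contDiff (n := 1)
  have hσd : ∀ t, HasDerivAt Real.smoothTransition (deriv Real.smoothTransition t) t :=
    fun t => (hσ.differentiable (by norm_num) t).hasDerivAt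
  have hd : ∀ t, HasDerivAt (γ ∘ Real.smoothTransition) (deriv Real.smoothTransition t •
      derivWithin γ (Icc 0 1) (Real.smoothTransition t)) t := fun t =>
    HasDerivWithinAt.scomp_hasDerivAt t
      ((hγ.differentiableOn (by norm_num) _ (hmem t)).hasDerivWithinAt) (hσd t) hmem
  refine ⟨γ ∘ Real.smoothTransition, ⟨hγ.comp_contDiff hσ hmem, fun t => hS _ (hmem t), ?_, ?_⟩,
    ?_⟩
  · intro t ht
    simp [Real.smoothTransition.zero_of_nonpos ht, hu]
  · intro t ht
    simp [Real.smoothTransition.one_of_one_le ht, hv]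
  · have hcont : ContinuousOn (fun s => normAt B (γ s) (derivWithin γ (Icc 0 1) s))
        (Icc 0 1) := by
      intro s hs
      have hne : γ s ≠ 0 := fun h => h0 (h ▸ hS s hs)
      exact (hB.continuousAt_normAt hne _).comp_continuousWithinAt
        (f := fun s => (γ s, derivWithin γ (Icc 0 1) s))
        ((hγ.continuousOn s hs).prodMk (hγ.continuousOn_derivWithin
          (uniqueDiffOn_Icc zero_lt_one) le_rfl s hs))
    have hcv := intervalIntegral.integral_comp_mul_deriv' (a := 0) (b := 1)
      (f := Real.smoothTransition) (f' := deriv Real.smoothTransition)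
      (g := fun s => normAt B (γ s) (derivWithin γ (Icc 0 1) s)) (fun t _ => hσd t)
      (hσ.continuous_deriv le_rfl).continuousOn
      (hcont.mono (by rintro _ ⟨t, -, rfl⟩; exact hmem t))
    rw [Real.smoothTransition.zero, Real.smoothTransition.one] at hcv
    rw [curveLength, ← hcv, arcLength]
    refine intervalIntegral.integral_congr fun t _ => ?_
    have hnn : 0 ≤ deriv Real.smoothTransition t := Real.smoothTransition.monotone.deriv_nonneg
    simp only [(hd t).deriv, normAt_smul, Function.comp, abs_of_nonneg hnn]
    ring

/-- The path metric may be computed with resting paths. -/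
theorem pathDist_lt_iff {ℓ : ℝ≥0∞} : pathDist B S u v < ℓ ↔
    ∃ γ, IsRestingPath S u v γ ∧ ENNReal.ofReal (arcLength B γ) < ℓ := by
  refine ⟨fun h => ?_, fun ⟨γ, hγ, h⟩ => hγ.pathDist_le.trans_lt h⟩
  simp only [pathDist, iInf_lt_iff] at h
  obtain ⟨γ, hγ, hS, hu, hv, hℓ⟩ := h
  obtain ⟨δ, hδ, he⟩ := exists_restingPath_of_curve hB h0 hγ hS hu hv
  exact ⟨δ, hδ, by rwa [he]⟩

theorem pathDist_comm : pathDist B S u v = pathDist B S v u := by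
  have key : ∀ u v : X, pathDist B S v u ≤ pathDist B S u v := fun u v => by
    refine le_of_forall_gt fun ℓ hℓ => ?_
    obtain ⟨γ, hγ, h⟩ := (pathDist_lt_iff hB h0).1 hℓ
    exact (pathDist_lt_iff hB h0).2 ⟨_, hγ.reverse, by rwa [arcLength_reverse]⟩
  exact le_antisymm (key _ _) (key _ _)

theorem IsRestingPath.trans {γ' : ℝ → X} (h : IsRestingPath S u v γ)
    (h' : IsRestingPath S v w γ') : ∃ δ, IsRestingPath S u w δ ∧
      arcLength B δ = arcLength B γ + arcLength B γ' := by
  -- at any time one of the two curves rests at `v`, so that `δ` follows the other one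
  let δ : ℝ → X := fun t => γ (2 * t) + γ' (2 * t - 1) - v
  have h1 : ∀ t ≤ 1 / 2, δ t = γ (2 * t) := fun t ht => by
    simp only [δ, h'.of_nonpos (2 * t - 1) (by linarith), add_sub_cancel_right]
  have h2 : ∀ t, 1 / 2 ≤ t → δ t = γ' (2 * t - 1) := fun t ht => by
    simp only [δ, h.of_one_le (2 * t) (by linarith), add_sub_cancel_left]
  have hδ : IsRestingPath S u w δ := by
    refine ⟨?_, fun t => ?_, fun t ht => ?_, fun t ht => ?_⟩
    · have h3 := h.contDiff
      have h4 := h'.contDiff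
      fun_prop
    · rcases le_total t (1 / 2) with ht | ht
      · rw [h1 t ht]; exact h.mem _
      · rw [h2 t ht]; exact h'.mem _
    · rw [h1 t (by linarith)]; exact h.of_nonpos _ (by linarith)
    · rw [h2 t (by linarith)]; exact h'.of_one_le _ (by linarith)
  have hd : ∀ t, deriv δ t = (2 : ℝ) • deriv γ (2 * t) + (2 : ℝ) • deriv γ' (2 * t - 1) := by
    intro t
    have e1 : HasDerivAt (fun t : ℝ => 2 * t) 2 t := by
      simpa using (hasDerivAt_id t).const_mul (2 : ℝ)
    have e2 : HasDerivAt (fun t : ℝ => 2 * t - 1) 2 t := e1.sub_const 1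
    exact (((h.hasDerivAt (2 * t)).scomp t e1).add
      ((h'.hasDerivAt (2 * t - 1)).scomp t e2)).sub_const v |>.deriv
  refine ⟨δ, hδ, ?_⟩
  have hc := hδ.continuous_normAt hB h0
  have hI1 : ∫ t in (0 : ℝ)..(1 / 2), normAt B (δ t) (deriv δ t) = arcLength B γ := by
    have : ∀ t ∈ uIcc (0 : ℝ) (1 / 2), normAt B (δ t) (deriv δ t) =
        2 * normAt B (γ (2 * t)) (deriv γ (2 * t)) := by
      intro t ht
      rw [uIcc_of_le (by norm_num)] at ht
      rw [h1 t ht.2, hd, h'.deriv_of_nonpos (by linarith [ht.2]), smul_zero, add_zero,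
        normAt_smul]
      norm_num
    rw [intervalIntegral.integral_congr this, intervalIntegral.integral_const_mul,
      intervalIntegral.integral_comp_mul_left (fun s => normAt B (γ s) (deriv γ s)) two_ne_zero,
      arcLength]
    norm_num
    ring
  have hI2 : ∫ t in (1 / 2 : ℝ)..1, normAt B (δ t) (deriv δ t) = arcLength B γ' := by
    have : ∀ t ∈ uIcc (1 / 2 : ℝ) 1, normAt B (δ t) (deriv δ t) =
        2 * normAt B (γ' (2 * t - 1)) (deriv γ' (2 * t - 1)) := by
      intro t ht
      rw [uIcc_of_le (by norm_num)] at ht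
      rw [h2 t ht.1, hd, h.deriv_of_one_le (by linarith [ht.1]), smul_zero, zero_add,
        normAt_smul]
      norm_num
    rw [intervalIntegral.integral_congr this, intervalIntegral.integral_const_mul,
      intervalIntegral.integral_comp_mul_sub (fun s => normAt B (γ' s) (deriv γ' s)) two_ne_zero,
      arcLength]
    norm_num
    ring
  rw [← hI1, ← hI2, arcLength, intervalIntegral.integral_add_adjacent_intervals
    (hc.intervalIntegrable _ _) (hc.intervalIntegrable _ _)]

theorem pathDist_triangle : pathDist B S u w ≤ pathDist B S u v + pathDist B S v w := by
  refine le_of_forall_gt fun ℓ hℓ => ?_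
  obtain ⟨a, ha, b, hb, hab⟩ := ENNReal.exists_add_lt_of_add_lt hℓ
  obtain ⟨γ, hγ, h⟩ := (pathDist_lt_iff hB h0).1 ha
  obtain ⟨γ', hγ', h'⟩ := (pathDist_lt_iff hB h0).1 hb
  obtain ⟨δ, hδ, he⟩ := hγ.trans hB h0 hγ'
  refine (pathDist_lt_iff hB h0).2 ⟨δ, hδ, ?_⟩
  rw [he, ENNReal.ofReal_add (arcLength_nonneg _) (arcLength_nonneg _)]
  exact (ENNReal.add_lt_add h h').trans hab

/-- A curve that starts in a ball on which the norms `‖·‖_y` control the norm of `X`, and which is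
short enough not to leave that ball, has its end point close to its starting point. -/
theorem IsRestingPath.norm_sub_le (h : IsRestingPath S u v γ) {p : X} {R C ℓ : ℝ} (hC : 0 < C)
    (hR : ∀ y ∈ Metric.ball p R, ∀ v, ‖v‖ ≤ C * normAt B y v)
    (hℓ : arcLength B γ < ℓ) (hp : ‖u - p‖ + C * ℓ ≤ R) : ‖v - u‖ ≤ C * ℓ := by
  set n : ℝ → ℝ := fun s => normAt B (γ s) (deriv γ s) with hn
  have hc : Continuous n := h.continuous_normAt hB h0
  set L := arcLength B γ with hL
  -- the bound for `‖γ t - u‖`; the linear term makes the comparison of derivatives strict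
  let b : ℝ → ℝ := fun t => C * ((∫ s in (0 : ℝ)..t, n s) + (ℓ - L) * t)
  have hb : ∀ t, HasDerivAt b (C * (n t + (ℓ - L))) t := by
    intro t
    have h1 : HasDerivAt (fun t => ∫ s in (0 : ℝ)..t, n s) (n t) t :=
      intervalIntegral.integral_hasDerivAt_right (hc.intervalIntegrable _ _)
        hc.aestronglyMeasurable.stronglyMeasurableAtFilter hc.continuousAt
    have h2 : HasDerivAt (fun t : ℝ => (ℓ - L) * t) (ℓ - L) t := by
      simpa using (hasDerivAt_id t).const_mul (ℓ - L)
    exact (h1.add h2).const_mul C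
  have key := image_norm_le_of_norm_deriv_right_lt_deriv_boundary (f := fun t => γ t - u)
    (f' := deriv γ) (a := 0) (b := 1) (B := b) (B' := fun t => C * (n t + (ℓ - L)))
    (by have := h.contDiff.continuous; fun_prop)
    (fun t _ => ((h.hasDerivAt t).sub_const u).hasDerivWithinAt)
    (by simp [b, h.of_nonpos 0 le_rfl]) hb (by
      intro t ht heq
      have hle : (∫ s in (0 : ℝ)..t, n s) ≤ L := by
        rw [hL, arcLength, ← intervalIntegral.integral_add_adjacent_intervals
          (hc.intervalIntegrable 0 t) (hc.intervalIntegrable t 1)]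
        have : 0 ≤ ∫ s in t..1, n s :=
          intervalIntegral.integral_nonneg ht.2.le fun _ _ => normAt_nonneg _ _
        linarith
      have hlt : b t < C * ℓ := by
        refine mul_lt_mul_of_pos_left ?_ hC
        nlinarith [ht.2]
      have hmem : γ t ∈ Metric.ball p R := by
        rw [mem_ball_iff_norm]
        have : γ t - p = (γ t - u) + (u - p) := by abel
        rw [this]
        refine (norm_add_le _ _).trans_lt ?_
        rw [heq]
        linarith
      refine (hR _ hmem _).trans_lt (mul_lt_mul_of_pos_left ?_ hC)
      have : n t = normAt B (γ t) (deriv γ t) := rfl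
      linarith)
  have h1 := key (right_mem_Icc.2 zero_le_one)
  simp only [h.of_one_le 1 le_rfl] at h1
  refine h1.trans (le_of_eq ?_)
  have : (∫ s in (0 : ℝ)..1, n s) = L := rfl
  simp only [b, this]
  ring

theorem norm_sub_le_of_pathDist_lt {p : X} {R C ℓ : ℝ} (hC : 0 < C)
    (hR : ∀ y ∈ Metric.ball p R, ∀ v, ‖v‖ ≤ C * normAt B y v)
    (hℓ : pathDist B S u v < ENNReal.ofReal ℓ) (hp : ‖u - p‖ + C * ℓ ≤ R) :
    ‖v - u‖ ≤ C * ℓ := by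
  obtain ⟨γ, hγ, h⟩ := (pathDist_lt_iff hB h0).1 hℓ
  exact hγ.norm_sub_le hB h0 hC hR (ENNReal.ofReal_lt_ofReal_iff'.1 h).1 hp

/-- The path metric controls the norm of `X` near each point of `S`. -/
theorem exists_pathDist_lt_imp_norm_lt (hu : u ∈ S) {ε : ℝ} (hε : 0 < ε) :
    ∃ η > 0, ∀ x, pathDist B S u x < ENNReal.ofReal η → ‖x - u‖ < ε := by
  obtain ⟨R, hR, C, hC, h⟩ := hB.exists_ball (u := u) (fun hu0 => h0 (hu0 ▸ hu))
  refine ⟨min R (ε / 2) / C, by positivity, fun x hx => ?_⟩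
  have h1 : C * (min R (ε / 2) / C) = min R (ε / 2) := by field_simp
  have := norm_sub_le_of_pathDist_lt hB h0 hC (fun y hy v => ((h y hy).2 v).1) hx (by
    rw [h1, sub_self, norm_zero, zero_add]; exact min_le_left _ _)
  rw [h1] at this
  have := min_le_right R (ε / 2)
  linarith

theorem tendsto_of_tendsto_pathDist {ι : Type*} {l : Filter ι} {x : ι → X} (hu : u ∈ S)
    (hx : Tendsto (fun n => pathDist B S (x n) u) l (𝓝 0)) : Tendsto x l (𝓝 u) := by
  rw [Metric.tendsto_nhds]
  intro ε hε
  obtain ⟨η, hη, h⟩ := exists_pathDist_lt_imp_norm_lt hB h0 hu hε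
  filter_upwards [hx.eventually_lt_const (ENNReal.ofReal_pos.2 hη)] with n hn
  rw [dist_eq_norm]
  exact h _ (by rwa [pathDist_comm hB h0])

/-! ### The functional `N` -/

omit hB h0 in
theorem NFun_le_normAt (hu : u ∈ S) : NFun B S u ≤ ENNReal.ofReal (normAt B u u) := by
  refine iInf₂_le_of_le u hu ?_
  rw [pathDist_self hu, add_zero]

omit hB h0 in
theorem NFun_ne_top (hu : u ∈ S) : NFun B S u ≠ ⊤ :=
  ((NFun_le_normAt hu).trans_lt ENNReal.ofReal_lt_top).ne

/-- `N` is Lipschitz with constant `1` with respect to the path metric. -/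
theorem NFun_le_add : NFun B S v ≤ NFun B S u + pathDist B S u v := by
  simp only [NFun]
  rw [ENNReal.iInf₂_add]
  refine le_iInf₂ fun p hp => iInf₂_le_of_le p hp ?_
  rw [add_assoc]
  gcongr
  exact pathDist_triangle hB h0

end PathDist

/-! ### Gradients and projections for one scalar product -/

section Riesz

variable {X : Type*} [NormedAddCommGroup X] [InnerProductSpace ℝ X] [CompleteSpace X]
  {B : X → X →ₗ[ℝ] X →ₗ[ℝ] ℝ} (hB : IsMetricFamily B) {u : X} (hu : u ≠ 0)
  (E : Submodule ℝ X) (hE : IsClosed (E : Set X))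
include hB hu

/-- Riesz representation on a closed subspace, for the scalar product `⟨·,·⟩_u`. -/
theorem IsMetricFamily.exists_gradient (hE : IsClosed (E : Set X)) (l : X →L[ℝ] ℝ) :
    ∃ w ∈ E, ∀ v ∈ E, B u w v = l v := by
  obtain ⟨b, hb, C, hC, hcoer⟩ := hB.exists_bilin hu
  have : CompleteSpace E := hE.completeSpace_coe
  let bE : E →L[ℝ] E →L[ℝ] ℝ := b.bilinearComp E.subtypeL E.subtypeL
  have hbE : IsCoercive bE := ⟨C, hC, fun v => hcoer v⟩
  let y : E := (InnerProductSpace.toDual ℝ E).symm (l.comp E.subtypeL)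
  let w : E := hbE.continuousLinearEquivOfBilin.symm y
  refine ⟨w, w.2, fun v hv => ?_⟩
  have h1 := hbE.continuousLinearEquivOfBilin_apply w ⟨v, hv⟩
  have h2 : bE w ⟨v, hv⟩ = B u w v := hb w v
  rw [← h2, ← h1, ContinuousLinearEquiv.apply_symm_apply, InnerProductSpace.toDual_symm_apply]
  rfl

omit [CompleteSpace X] in
theorem IsMetricFamily.eq_zero_of_apply_self {v : X} (h : B u v v = 0) : v = 0 := by
  by_contra hv
  exact ((hB.scalar u hu).2 v hv).ne' h

/-- The projection onto a closed subspace that is orthogonal with respect to `⟨·,·⟩_u`. -/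
theorem IsMetricFamily.exists_projection (hE : IsClosed (E : Set X)) :
    ∃ P : X →L[ℝ] X, ∀ x, P x ∈ E ∧ ∀ v ∈ E, B u (x - P x) v = 0 := by
  obtain ⟨b, hb, C, hC, hcoer⟩ := hB.exists_bilin hu
  choose P hPE hP using fun x : X => hB.exists_gradient hu E hE (b x)
  simp only [hb] at hP
  have huniq : ∀ {x y : X}, x ∈ E → y ∈ E → (∀ v ∈ E, B u x v = B u y v) → x = y := by
    intro x y hx hy h
    refine sub_eq_zero.1 (hB.eq_zero_of_apply_self hu ?_)
    rw [LinearMap.map_sub₂, h _ (E.sub_mem hx hy), sub_self]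
  let L : X →ₗ[ℝ] X :=
    { toFun := P
      map_add' := fun x y => huniq (hPE _) (E.add_mem (hPE _) (hPE _)) fun v hv => by
        simp only [map_add, LinearMap.add_apply, hP _ v hv]
      map_smul' := fun c x => huniq (hPE _) (E.smul_mem _ (hPE _)) fun v hv => by
        simp only [map_smul, LinearMap.smul_apply, hP _ v hv, RingHom.id_apply] }
  refine ⟨L.mkContinuous (C⁻¹ * ‖b‖) fun x => ?_, fun x => ⟨hPE x, fun v hv => ?_⟩⟩
  · change ‖P x‖ ≤ _
    by_cases h0 : ‖P x‖ = 0
    · rw [h0]; positivity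
    have h1 := hcoer (P x)
    rw [hb, hP x _ (hPE x), ← hb] at h1
    have h2 := (le_abs_self _).trans (b.le_opNorm₂ x (P x))
    have h3 : C * ‖P x‖ ≤ ‖b‖ * ‖x‖ := by
      have hpos : 0 < ‖P x‖ := lt_of_le_of_ne (norm_nonneg _) (Ne.symm h0)
      exact le_of_mul_le_mul_right (h1.trans h2) hpos
    rw [mul_assoc, le_inv_mul_iff₀ hC]
    exact h3
  · change B u (x - P x) v = 0
    rw [map_sub, LinearMap.sub_apply, hP x v hv, sub_self]

end Riesz

/-! ### Charts of a submanifold and tangent spaces -/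

section Charts

variable {X : Type*} [NormedAddCommGroup X] [InnerProductSpace ℝ X] {M : Set X} {Φ : X → ℝ}

/-- Near `z`, the manifold is straightened by a map that vanishes at `z` and whose derivative there is
the identity. -/
theorem exists_straightening (hM : IsC11Submanifold M) {z : X} (hz : z ∈ M) :
    ∃ (E : Submodule ℝ X) (κ : X → X), IsClosed (E : Set X) ∧ ContDiffAt ℝ 1 κ z ∧
      HasFDerivAt κ (ContinuousLinearMap.id ℝ X) z ∧ κ z = 0 ∧ ∀ᶠ x in 𝓝 z, x ∈ M ↔ κ x ∈ E := by
  obtain ⟨ψ, F, hzs, hF, hψ, hψ', hMF⟩ := hM z hz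
  have hs : ψ.source ∈ 𝓝 z := ψ.open_source.mem_nhds hzs
  have ht : ψ.target ∈ 𝓝 (ψ z) := ψ.open_target.mem_nhds (ψ.map_source hzs)
  have hψz : ContDiffAt ℝ 1 ψ z := hψ.1.contDiffAt hs
  have hψz' : ContDiffAt ℝ 1 ψ.symm (ψ z) := hψ'.1.contDiffAt ht
  set A := fderiv ℝ ψ z
  set A' := fderiv ℝ ψ.symm (ψ z)
  have hA : HasFDerivAt ψ A z := (hψz.differentiableAt (by norm_num)).hasFDerivAt
  have hA' : HasFDerivAt ψ.symm A' (ψ z) := (hψz'.differentiableAt (by norm_num)).hasFDerivAt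
  have h1 : A'.comp A = ContinuousLinearMap.id ℝ X := by
    refine (hA'.comp z hA).unique ((hasFDerivAt_id z).congr_of_eventuallyEq ?_)
    filter_upwards [hs] with x hx using ψ.left_inv hx
  have h2 : A.comp A' = ContinuousLinearMap.id ℝ X := by
    have hA2 : HasFDerivAt ψ A (ψ.symm (ψ z)) := by rwa [ψ.left_inv hzs]
    refine (hA2.comp (ψ z) hA').unique ((hasFDerivAt_id _).congr_of_eventuallyEq ?_)
    filter_upwards [ht] with x hx using ψ.right_inv hx
  have hFz : ψ z ∈ F := (hMF z hzs).1 hz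
  refine ⟨F.comap (A : X →ₗ[ℝ] X), fun x => A' (ψ x - ψ z), hF.preimage A.continuous, ?_, ?_,
    by simp, ?_⟩
  · exact A'.contDiff.contDiffAt.comp z (hψz.sub contDiffAt_const)
  · rw [← h1]
    exact A'.hasFDerivAt.comp z (hA.sub_const (ψ z))
  · filter_upwards [hs] with x hx
    rw [hMF x hx]
    have h3 : A (A' (ψ x - ψ z)) = ψ x - ψ z := congrArg (fun f => f (ψ x - ψ z)) h2
    rw [Submodule.mem_comap]
    change _ ↔ A (A' (ψ x - ψ z)) ∈ F
    rw [h3]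
    exact (F.sub_mem_iff_left hFz).symm

theorem exists_local_inverse [CompleteSpace X] {κ : X → X} {z : X} (hκ : ContDiffAt ℝ 1 κ z)
    (hd : HasFDerivAt κ (ContinuousLinearMap.id ℝ X) z) (h0 : κ z = 0) :
    ∃ θ : X → X, ContDiffAt ℝ 1 θ 0 ∧ HasFDerivAt θ (ContinuousLinearMap.id ℝ X) 0 ∧ θ 0 = z ∧
      (∀ᶠ x in 𝓝 z, θ (κ x) = x) ∧ ∀ᶠ y in 𝓝 0, κ (θ y) = y := by
  have hd' : HasFDerivAt κ ((ContinuousLinearEquiv.refl ℝ X : X ≃L[ℝ] X) : X →L[ℝ] X) z := hd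
  have hst : HasStrictFDerivAt κ ((ContinuousLinearEquiv.refl ℝ X : X ≃L[ℝ] X) : X →L[ℝ] X) z :=
    hκ.hasStrictFDerivAt' hd' (by norm_num)
  refine ⟨hst.localInverse κ _ z, ?_, ?_, ?_, hst.eventually_left_inverse, ?_⟩
  · have := hκ.to_localInverse hd' (by norm_num)
    rwa [h0] at this
  · have := hst.to_localInverse.hasFDerivAt
    rwa [h0] at this
  · have := hst.localInverse_apply_image
    rwa [h0] at this
  · have := hst.eventually_right_inverse
    rwa [h0] at this

theorem smul_mem_tangentSpace {u v : X} (hv : v ∈ tangentSpace M u) (c : ℝ) :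
    c • v ∈ tangentSpace M u := by
  obtain ⟨γ, hγ, hM, h0, hd⟩ := hv
  have hc : Tendsto (fun t : ℝ => c * t) (𝓝 0) (𝓝 0) := by
    have : Continuous fun t : ℝ => c * t := by fun_prop
    simpa using this.tendsto 0
  have hd' : HasDerivAt γ v (c * 0) := by
    rw [mul_zero, ← hd]
    exact (hγ.differentiableAt (by norm_num)).hasDerivAt
  have hmul : HasDerivAt (fun t : ℝ => c * t) c 0 := by
    simpa using (hasDerivAt_id (0 : ℝ)).const_mul c
  refine ⟨fun t => γ (c * t), ?_, hc.eventually hM, by simpa using h0, ?_⟩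
  · refine ContDiffAt.comp (g := γ) 0 ?_ (by fun_prop)
    simpa using hγ
  · exact (hd'.scomp 0 hmul).deriv

theorem mem_tangentSpace_of_curve {γ : ℝ → X} {t : ℝ} (hγ : ContDiffAt ℝ 1 γ t)
    (hM : ∀ᶠ s in 𝓝 t, γ s ∈ M) : deriv γ t ∈ tangentSpace M (γ t) := by
  have hc : Tendsto (fun s : ℝ => t + s) (𝓝 0) (𝓝 t) := by
    have : Continuous fun s : ℝ => t + s := by fun_prop
    simpa using this.tendsto 0
  refine ⟨fun s => γ (t + s), ?_, hc.eventually hM, by simp, ?_⟩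
  · refine ContDiffAt.comp (g := γ) 0 ?_ (by fun_prop)
    simpa using hγ
  · rw [deriv_comp_const_add, add_zero]

theorem hasDerivAt_comp_curve_at (hΦ : IsC11OnManifold M Φ) {γ : ℝ → X} {t : ℝ}
    (hγ : ContDiffAt ℝ 1 γ t) (hM : ∀ᶠ s in 𝓝 t, γ s ∈ M) :
    HasDerivAt (fun s => Φ (γ s)) (dPhi M Φ (γ t) (deriv γ t)) t := by
  have hc : Tendsto (fun s : ℝ => s + t) (𝓝 0) (𝓝 t) := by
    have : Continuous fun s : ℝ => s + t := by fun_prop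
    simpa using this.tendsto 0
  have hd : HasDerivAt (fun s => γ (s + t)) (deriv γ t) 0 := by
    refine HasDerivAt.comp_add_const 0 t ?_
    rw [zero_add]
    exact (hγ.differentiableAt (by norm_num)).hasDerivAt
  have := hasDerivAt_comp_curve hΦ (u := γ t) hM.self_of_nhds hd (hc.eventually hM) (by simp)
  rw [← sub_self t] at this
  simpa using HasDerivAt.comp_sub_const t t this

/-- The tangent space at `z` is the subspace that occurs in a straightening of `M` near `z`. -/
theorem mem_tangentSpace_iff [CompleteSpace X] {E : Submodule ℝ X} (hE : IsClosed (E : Set X))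
    {κ : X → X} {z : X} (hκ : ContDiffAt ℝ 1 κ z)
    (hd : HasFDerivAt κ (ContinuousLinearMap.id ℝ X) z) (h0 : κ z = 0)
    (hM : ∀ᶠ x in 𝓝 z, x ∈ M ↔ κ x ∈ E) (v : X) : v ∈ tangentSpace M z ↔ v ∈ E := by
  constructor
  · rintro ⟨γ, hγ, hγM, hγ0, rfl⟩
    have hder : HasDerivAt γ (deriv γ 0) 0 := (hγ.differentiableAt (by norm_num)).hasDerivAt
    have hcomp : HasDerivAt (κ ∘ γ) (deriv γ 0) 0 := by
      have hd' : HasFDerivAt κ (ContinuousLinearMap.id ℝ X) (γ 0) := by rwa [hγ0]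
      exact hd'.comp_hasDerivAt 0 hder
    have hcont : Tendsto γ (𝓝 0) (𝓝 z) := hγ0 ▸ hγ.continuousAt
    refine hE.mem_of_tendsto hcomp.tendsto_slope_zero_right ?_
    have : ∀ᶠ t in 𝓝 (0 : ℝ), κ (γ t) ∈ E := by
      filter_upwards [hγM, hcont.eventually hM] with t h1 h2 using h2.1 h1
    filter_upwards [mem_nhdsWithin_of_mem_nhds this] with t ht
    simp only [zero_add, Function.comp, hγ0, h0, sub_zero]
    exact E.smul_mem _ ht
  · intro hv
    obtain ⟨θ, hθ, hθd, hθ0, -, hκθ⟩ := exists_local_inverse hκ hd h0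
    have hc : Tendsto (fun t : ℝ => t • v) (𝓝 0) (𝓝 0) := by
      have : Continuous fun t : ℝ => t • v := by fun_prop
      simpa using this.tendsto 0
    have hθc : Tendsto θ (𝓝 0) (𝓝 z) := hθ0 ▸ hθ.continuousAt
    refine ⟨fun t => θ (t • v), ?_, ?_, by simpa using hθ0, ?_⟩
    · refine ContDiffAt.comp (g := θ) 0 ?_ (by fun_prop)
      simpa using hθ
    · filter_upwards [hc.eventually hκθ, (hθc.comp hc).eventually hM] with t h1 h2
      exact h2.2 (by simpa only [Function.comp, h1] using E.smul_mem t hv)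
    · have h1 : HasDerivAt (fun t : ℝ => t • v) v 0 := by
        simpa using (hasDerivAt_id (0 : ℝ)).smul_const v
      have h2 : HasFDerivAt θ (ContinuousLinearMap.id ℝ X) ((0 : ℝ) • v) := by simpa using hθd
      exact (h2.comp_hasDerivAt 0 h1).deriv

/-- Near `u`, the derivative of `Φ` on `M` is the derivative of a `C^1`-function on `X`. -/
theorem exists_extension (hΦ : IsC11OnManifold M Φ) {u : X} (hu : u ∈ M) :
    ∃ F : X → ℝ, ContDiffAt ℝ 1 F u ∧ ∀ᶠ x in 𝓝 u, x ∈ M → F x = Φ x ∧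
      ∀ v ∈ tangentSpace M x, dPhi M Φ x v = fderiv ℝ F x v := by
  obtain ⟨U, hU, huU, F, hF, hFΦ⟩ := hΦ u hu
  refine ⟨F, hF.1.contDiffAt (hU.mem_nhds huU), ?_⟩
  filter_upwards [hU.mem_nhds huU] with x hx hxM
  refine ⟨hFΦ x ⟨hx, hxM⟩, fun v hv => ?_⟩
  obtain ⟨γ, hγ, hγM, hγ0, rfl⟩ := hv
  have hder : HasDerivAt γ (deriv γ 0) 0 := (hγ.differentiableAt (by norm_num)).hasDerivAt
  have h1 := hasDerivAt_comp_curve hΦ hxM hder hγM hγ0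
  have hFx : HasFDerivAt F (fderiv ℝ F x) (γ 0) := by
    rw [hγ0]
    exact ((hF.1.contDiffAt (hU.mem_nhds hx)).differentiableAt (by norm_num)).hasFDerivAt
  have h2 := hFx.comp_hasDerivAt 0 hder
  refine h1.unique (h2.congr_of_eventuallyEq ?_)
  have hcont : Tendsto γ (𝓝 0) (𝓝 x) := hγ0 ▸ hγ.continuousAt
  filter_upwards [hγM, hcont.eventually (hU.mem_nhds hx)] with t h3 h4
  exact (hFΦ _ ⟨h4, h3⟩).symm

theorem continuousOn_of_isC11OnManifold (hΦ : IsC11OnManifold M Φ) : ContinuousOn Φ M := by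
  intro u hu
  obtain ⟨F, hF, h⟩ := exists_extension hΦ hu
  refine hF.continuousAt.continuousWithinAt.congr_of_eventuallyEq ?_
    (h.self_of_nhds hu).1.symm
  filter_upwards [mem_nhdsWithin_of_mem_nhds h, self_mem_nhdsWithin] with x hx hxM
  exact (hx hxM).1.symm

/-- Tangent vectors and the derivative of `Φ` are transported by linear symmetries. -/
theorem map_tangentSpace (hΦ : IsC11OnManifold M Φ) (L : X →L[ℝ] X) (hL : ∀ u ∈ M, L u ∈ M)
    (hLΦ : ∀ u ∈ M, Φ (L u) = Φ u) {u v : X} (hu : u ∈ M) (hv : v ∈ tangentSpace M u) :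
    L v ∈ tangentSpace M (L u) ∧ dPhi M Φ (L u) (L v) = dPhi M Φ u v := by
  obtain ⟨γ, hγ, hγM, hγ0, rfl⟩ := hv
  have hder : HasDerivAt γ (deriv γ 0) 0 := (hγ.differentiableAt (by norm_num)).hasDerivAt
  have hL1 : HasDerivAt (L ∘ γ) (L (deriv γ 0)) 0 := L.hasFDerivAt.comp_hasDerivAt 0 hder
  have hL2 : ∀ᶠ t in 𝓝 0, (L ∘ γ) t ∈ M := hγM.mono fun t ht => hL _ ht
  refine ⟨⟨L ∘ γ, L.contDiff.contDiffAt.comp 0 hγ, hL2, by simp [hγ0], hL1.deriv⟩, ?_⟩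
  have h1 := hasDerivAt_comp_curve hΦ (hL u hu) hL1 hL2 (by simp [hγ0])
  have h2 := hasDerivAt_comp_curve hΦ hu hder hγM hγ0
  refine h1.unique (h2.congr_of_eventuallyEq ?_)
  exact hγM.mono fun t ht => hLΦ _ ht

end Charts

/-! ### The invariant part of the manifold -/

/-- The standing assumptions on the scalar products, the manifold, the functional and the group
action. -/
structure IsSymmetricSetting {X G : Type*} [NormedAddCommGroup X] [InnerProductSpace ℝ X] [Group G]
    [DistribMulAction G X] (B : X → X →ₗ[ℝ] X →ₗ[ℝ] ℝ) (M : Set X) (Φ : X → ℝ)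
    (G₀ : Subgroup G) : Prop where
  metric : IsMetricFamily B
  invariant : InvariantFamily G B
  submanifold : IsC11Submanifold M
  zero_notMem : (0 : X) ∉ M
  neg_mem : ∀ u ∈ M, -u ∈ M
  smul_mem : ∀ u ∈ M, ∀ g : G, g • u ∈ M
  regular : IsC11OnManifold M Φ
  even : ∀ u ∈ M, Φ (-u) = Φ u
  smul_eq : ∀ u ∈ M, ∀ g : G, Φ (g • u) = Φ u
  normal : G₀.Normal
  closed_orbits : GStar G X

namespace IsSymmetricSetting

variable {X G : Type*} [NormedAddCommGroup X] [InnerProductSpace ℝ X]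
  [Group G] [DistribMulAction G X] [SMulCommClass G ℝ X]
  {B : X → X →ₗ[ℝ] X →ₗ[ℝ] ℝ} {M : Set X} {Φ : X → ℝ} {G₀ : Subgroup G}
  (h : IsSymmetricSetting B M Φ G₀)
include h

omit [SMulCommClass G ℝ X] in
/-- The invariance of the scalar products also holds for the arguments `0`. -/
theorem apply_smul {u : X} (hu : u ≠ 0) (g : G) (v w : X) :
    B (g • u) (g • v) (g • w) = B u v w := by
  by_cases hv : v = 0
  · simp [hv]
  by_cases hw : w = 0
  · simp [hw]
  exact h.invariant u v w hu hv hw g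

omit [SMulCommClass G ℝ X] in
theorem normAt_smul_smul {u : X} (hu : u ≠ 0) (g : G) (v : X) :
    normAt B (g • u) (g • v) = normAt B u v := by
  simp only [normAt, h.apply_smul hu]

/-- Each group element acts as a bounded operator, since it maps `‖·‖_u` to `‖·‖_{g ∗ u}`. -/
theorem exists_clm (g : G) : ∃ L : X →L[ℝ] X, ∀ x, L x = g • x := by
  let L : X →ₗ[ℝ] X := DistribSMul.toLinearMap ℝ X g
  rcases subsingleton_or_nontrivial X with hX | hX
  · exact ⟨0, fun x => Subsingleton.elim _ _⟩
  · obtain ⟨u, hu⟩ := exists_ne (0 : X)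
    obtain ⟨C, hC, h1⟩ := h.metric.exists_equiv hu
    obtain ⟨C', hC', h2⟩ := h.metric.exists_equiv ((smul_ne_zero_iff_ne g).2 hu)
    refine ⟨L.mkContinuous (C' * C) fun x => ?_, fun x => rfl⟩
    calc ‖g • x‖ ≤ C' * normAt B (g • u) (g • x) := (h2 _).1
      _ = C' * normAt B u x := by rw [h.normAt_smul_smul hu]
      _ ≤ C' * (C * ‖x‖) := by gcongr; exact (h1 x).2
      _ = C' * C * ‖x‖ := by ring

theorem continuous_smul (g : G) : Continuous fun x : X => g • x := by
  obtain ⟨L, hL⟩ := h.exists_clm g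
  exact L.continuous.congr hL

omit [SMulCommClass G ℝ X] in
theorem ne_zero {u : X} (hu : u ∈ M) : u ≠ 0 := fun h0 => h.zero_notMem (h0 ▸ hu)

omit [SMulCommClass G ℝ X] in
theorem zero_notMem_invariantPart : (0 : X) ∉ invariantPart G₀ M :=
  fun h0 => h.zero_notMem h0.1

omit [SMulCommClass G ℝ X] in
theorem smul_mem_invariantPart {u : X} (hu : u ∈ invariantPart G₀ M) (g : G) :
    g • u ∈ invariantPart G₀ M := by
  refine ⟨h.smul_mem u hu.1 g, fun k hk => ?_⟩
  have := hu.2 _ (h.normal.conj_mem' k hk g)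
  rw [smul_smul, show k * g = g * (g⁻¹ * k * g) by group, mul_smul, this]

omit [SMulCommClass G ℝ X] in
theorem neg_mem_invariantPart {u : X} (hu : u ∈ invariantPart G₀ M) :
    -u ∈ invariantPart G₀ M :=
  ⟨h.neg_mem u hu.1, fun k hk => by rw [smul_neg, hu.2 k hk]⟩

theorem smul_mem_tangentSpace {u v : X} (hu : u ∈ M) (hv : v ∈ tangentSpace M u) (g : G) :
    g • v ∈ tangentSpace M (g • u) ∧ dPhi M Φ (g • u) (g • v) = dPhi M Φ u v := by
  obtain ⟨L, hL⟩ := h.exists_clm g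
  simpa only [hL] using map_tangentSpace h.regular L
    (fun u hu => by rw [hL]; exact h.smul_mem u hu g)
    (fun u hu => by rw [hL]; exact h.smul_eq u hu g) hu hv

omit [SMulCommClass G ℝ X] in
theorem neg_mem_tangentSpace {u v : X} (hu : u ∈ M) (hv : v ∈ tangentSpace M u) :
    -v ∈ tangentSpace M (-u) ∧ dPhi M Φ (-u) (-v) = dPhi M Φ u v :=
  map_tangentSpace h.regular (-ContinuousLinearMap.id ℝ X) (fun u hu => h.neg_mem u hu)
    (fun u hu => h.even u hu) hu hv

omit [SMulCommClass G ℝ X] in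
theorem isCritical_neg {u : X} (hu : u ∈ M) (hc : IsCritical M Φ u) : IsCritical M Φ (-u) := by
  intro v hv
  have h1 := h.neg_mem_tangentSpace (h.neg_mem u hu) hv
  rw [neg_neg] at h1
  rw [← h1.2]
  exact hc _ h1.1

theorem dualNormAt_smul {u : X} (hu : u ∈ M) (g : G) :
    dualNormAt B M Φ (g • u) = dualNormAt B M Φ u := by
  have key : ∀ u ∈ M, ∀ g : G, dualNormAt B M Φ u ≤ dualNormAt B M Φ (g • u) := by
    intro u hu g
    refine iSup₂_le fun v hv => iSup_le fun hn => ?_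
    have h1 := h.smul_mem_tangentSpace hu hv g
    refine le_iSup₂_of_le (g • v) h1.1 (le_iSup_of_le ?_ (by rw [h1.2]))
    rwa [h.normAt_smul_smul (h.ne_zero hu)]
  refine le_antisymm ?_ (key u hu g)
  have := key _ (h.smul_mem u hu g) g⁻¹
  rwa [inv_smul_smul] at this

omit [SMulCommClass G ℝ X] in
theorem isCritical_iff {u : X} (hu : u ∈ M) : IsCritical M Φ u ↔ dualNormAt B M Φ u = 0 := by
  constructor
  · intro hc
    simp only [dualNormAt, ENNReal.iSup_eq_zero]
    intro v hv _
    simp [hc v hv]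
  · intro h0 v hv
    simp only [dualNormAt, ENNReal.iSup_eq_zero] at h0
    by_cases hn : normAt B u v = 0
    · have : v = 0 := h.metric.eq_zero_of_apply_self (h.ne_zero hu) (by
        rw [← h.metric.normAt_sq (h.ne_zero hu), hn]; ring)
      rw [this]
      exact map_zero (fderivWithin ℝ Φ M u)
    · have h1 := h0 ((normAt B u v)⁻¹ • v) (LSTheory.smul_mem_tangentSpace hv _) (by
        rw [normAt_smul, abs_of_nonneg (inv_nonneg.2 (normAt_nonneg _ _)), inv_mul_cancel₀ hn])
      rw [ENNReal.ofReal_eq_zero] at h1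
      have h2 : dPhi M Φ u ((normAt B u v)⁻¹ • v) = 0 :=
        abs_eq_zero.1 (le_antisymm h1 (abs_nonneg _))
      have h3 : dPhi M Φ u ((normAt B u v)⁻¹ • v) = (normAt B u v)⁻¹ * dPhi M Φ u v :=
        map_smul (fderivWithin ℝ Φ M u) _ _
      rw [h3] at h2
      exact (mul_eq_zero.1 h2).resolve_left (inv_ne_zero hn)

/-- The path metric of `M₀` is `G`-invariant. -/
theorem pathDist_smul (g : G) (u v : X) :
    pathDist B (invariantPart G₀ M) (g • u) (g • v) = pathDist B (invariantPart G₀ M) u v := by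
  have h0 := h.zero_notMem_invariantPart
  have key : ∀ (g : G) (u v : X), pathDist B (invariantPart G₀ M) (g • u) (g • v) ≤
      pathDist B (invariantPart G₀ M) u v := by
    intro g u v
    refine le_of_forall_gt fun ℓ hℓ => ?_
    obtain ⟨γ, hγ, hlt⟩ := (pathDist_lt_iff h.metric h0).1 hℓ
    obtain ⟨L, hL⟩ := h.exists_clm g
    have hγ' : IsRestingPath (invariantPart G₀ M) (g • u) (g • v) fun t => L (γ t) :=
      ⟨L.contDiff.comp hγ.contDiff, fun t => by
        rw [hL]; exact h.smul_mem_invariantPart (hγ.mem t) g,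
        fun t ht => by rw [hγ.of_nonpos t ht, hL], fun t ht => by rw [hγ.of_one_le t ht, hL]⟩
    refine (pathDist_lt_iff h.metric h0).2 ⟨_, hγ', ?_⟩
    have : arcLength B (fun t => L (γ t)) = arcLength B γ := by
      refine intervalIntegral.integral_congr fun t _ => ?_
      have hd : deriv (fun t => L (γ t)) t = L (deriv γ t) :=
        (L.hasFDerivAt.comp_hasDerivAt t (hγ.hasDerivAt t)).deriv
      change normAt B (L (γ t)) (deriv (fun t => L (γ t)) t) = _
      rw [hd, hL, hL, h.normAt_smul_smul (h.ne_zero (hγ.mem t).1)]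
    rwa [this]
  refine le_antisymm (key g u v) ?_
  have := key g⁻¹ (g • u) (g • v)
  rwa [inv_smul_smul, inv_smul_smul] at this

theorem NFun_smul (g : G) (u : X) :
    NFun B (invariantPart G₀ M) (g • u) = NFun B (invariantPart G₀ M) u := by
  have key : ∀ (g : G) (u : X), NFun B (invariantPart G₀ M) (g • u) ≤
      NFun B (invariantPart G₀ M) u := by
    intro g u
    refine le_iInf₂ fun p hp => iInf₂_le_of_le (g • p) (h.smul_mem_invariantPart hp g) ?_
    rw [h.pathDist_smul, h.normAt_smul_smul (h.ne_zero hp.1)]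
  refine le_antisymm (key g u) ?_
  have := key g⁻¹ (g • u)
  rwa [inv_smul_smul] at this

variable [CompleteSpace X]

/-- Near a point `z` of `M₀`, orthogonal projection with respect to `⟨·,·⟩_z` maps `M` to the
tangent space. As it commutes with the action of `G₀`, it gives rise to a
chart that straightens `M₀` to the invariant part of the tangent space. -/
theorem exists_chart {z : X} (hz : z ∈ invariantPart G₀ M) :
    ∃ (T : Submodule ℝ X) (χ θ : X → X),
      (∀ v, v ∈ T ↔ v ∈ tangentSpace M z ∧ ∀ g ∈ G₀, g • v = v) ∧
      ContDiffAt ℝ 1 χ z ∧ χ z = 0 ∧ ContDiffAt ℝ 1 θ 0 ∧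
      HasFDerivAt θ (ContinuousLinearMap.id ℝ X) 0 ∧ θ 0 = z ∧
      (∀ᶠ x in 𝓝 z, x ∈ invariantPart G₀ M → χ x ∈ T ∧ θ (χ x) = x) ∧
      ∀ᶠ y in 𝓝 0, y ∈ T → θ y ∈ invariantPart G₀ M := by
  have hz0 : z ≠ 0 := h.ne_zero hz.1
  obtain ⟨E, κ, hE, hκ, hκd, hκ0, hκM⟩ := exists_straightening h.submanifold hz.1
  have hET : ∀ v, v ∈ tangentSpace M z ↔ v ∈ E := mem_tangentSpace_iff hE hκ hκd hκ0 hκM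
  obtain ⟨P, hP⟩ := h.metric.exists_projection hz0 E hE
  have huniq : ∀ x y, y ∈ E → (∀ v ∈ E, B z (x - y) v = 0) → P x = y := by
    intro x y hy hv
    refine sub_eq_zero.1 (h.metric.eq_zero_of_apply_self hz0 ?_)
    have hm : P x - y ∈ E := E.sub_mem (hP x).1 hy
    have : P x - y = (x - y) - (x - P x) := by abel
    conv_lhs => rw [this, LinearMap.map_sub₂]
    rw [← this, hv _ hm, (hP x).2 _ hm, sub_zero]
  have hPE : ∀ x ∈ E, P x = x := fun x hx => huniq x x hx fun v _ => by simp
  have hgE : ∀ g ∈ G₀, ∀ v ∈ E, g • v ∈ E := by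
    intro g hg v hv
    have := (h.smul_mem_tangentSpace hz.1 ((hET v).2 hv) g).1
    rw [hz.2 g hg] at this
    exact (hET _).1 this
  have hPg : ∀ g ∈ G₀, ∀ x, P (g • x) = g • P x := by
    intro g hg x
    refine huniq _ _ (hgE g hg _ (hP x).1) fun v hv => ?_
    have h1 := h.apply_smul hz0 g (x - P x) (g⁻¹ • v)
    rw [hz.2 g hg, smul_inv_smul, smul_sub] at h1
    rw [h1]
    exact (hP x).2 _ (hgE _ (G₀.inv_mem hg) v hv)
  let T : Submodule ℝ X :=
    { carrier := {v | v ∈ E ∧ ∀ g ∈ G₀, g • v = v}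
      add_mem' := fun {a b} ha hb =>
        ⟨E.add_mem ha.1 hb.1, fun g hg => by rw [smul_add, ha.2 g hg, hb.2 g hg]⟩
      zero_mem' := ⟨E.zero_mem, fun g _ => smul_zero g⟩
      smul_mem' := fun c v hv =>
        ⟨E.smul_mem c hv.1, fun g hg => by rw [smul_comm, hv.2 g hg]⟩ }
  -- on `M` this is the projection of `x - z`; the second summand makes it a local diffeomorphism
  let χ : X → X := fun x => P (x - z) + (κ x - P (κ x))
  have hχ : ContDiffAt ℝ 1 χ z := by
    have h1 : ContDiffAt ℝ 1 (fun x => P (κ x)) z := P.contDiff.contDiffAt.comp z hκ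
    have h2 : ContDiffAt ℝ 1 (fun x => P (x - z)) z := by fun_prop
    exact h2.add (hκ.sub h1)
  have hχd : HasFDerivAt χ (ContinuousLinearMap.id ℝ X) z := by
    have h1 : HasFDerivAt (fun x => P (κ x)) (P.comp (ContinuousLinearMap.id ℝ X)) z :=
      P.hasFDerivAt.comp z hκd
    have h2 : HasFDerivAt (fun x => P (x - z)) (P.comp (ContinuousLinearMap.id ℝ X)) z :=
      P.hasFDerivAt.comp z ((hasFDerivAt_id z).sub_const z)
    have h3 := h2.add (hκd.sub h1)
    rwa [add_sub_cancel] at h3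
  have hχ0 : χ z = 0 := by simp [χ, hκ0]
  obtain ⟨θ, hθ, hθd, hθ0, hθχ, hχθ⟩ := exists_local_inverse hχ hχd hχ0
  have hχE : ∀ x, κ x ∈ E → χ x = P (x - z) := fun x hx => by
    simp only [χ, hPE _ hx, sub_self, add_zero]
  refine ⟨T, χ, θ, fun v => ?_, hχ, hχ0, hθ, hθd, hθ0, ?_, ?_⟩
  · rw [hET]; rfl
  · filter_upwards [hκM, hθχ] with x hx1 hx2 hx
    refine ⟨?_, hx2⟩
    rw [hχE x (hx1.1 hx.1)]
    refine ⟨(hP _).1, fun g hg => ?_⟩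
    rw [← hPg g hg, smul_sub, hx.2 g hg, hz.2 g hg]
  · obtain ⟨r, hr, hball⟩ := Metric.eventually_nhds_iff_ball.1 (hκM.and hθχ)
    obtain ⟨C, hC, hCn⟩ := h.metric.exists_equiv hz0
    have hθc : Tendsto θ (𝓝 0) (𝓝 z) := hθ0 ▸ hθ.continuousAt
    have hr' : 0 < min r (r / (C * C)) := by positivity
    filter_upwards [hχθ, hθc.eventually (Metric.ball_mem_nhds z hr')] with y hy1 hy2 hyT
    set x := θ y
    have hxr : x ∈ Metric.ball z r := Metric.ball_subset_ball (min_le_left _ _) hy2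
    have hxM : x ∈ M := by
      refine (hball x hxr).1.2 ?_
      have h1 : κ x - P (κ x) = y - P (x - z) := by
        rw [← hy1]; simp only [χ]; abel
      have h2 : κ x - P (κ x) ∈ E := by
        rw [h1]; exact E.sub_mem hyT.1 (hP _).1
      have h3 := E.add_mem h2 (hP (κ x)).1
      rwa [sub_add_cancel] at h3
    refine ⟨hxM, fun g hg => ?_⟩
    have hgr : g • x ∈ Metric.ball z r := by
      rw [mem_ball_iff_norm]
      rw [dist_eq_norm] at hy2
      have e1 : g • x - z = g • (x - z) := by rw [smul_sub, hz.2 g hg]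
      have e2 := h.normAt_smul_smul hz0 g (x - z)
      rw [hz.2 g hg] at e2
      calc ‖g • x - z‖ ≤ C * normAt B z (x - z) := by rw [e1, ← e2]; exact (hCn _).1
        _ ≤ C * (C * ‖x - z‖) := by gcongr; exact (hCn _).2
        _ < C * (C * (r / (C * C))) := by
            gcongr
            exact hy2.trans_le (min_le_right _ _)
        _ = r := by field_simp
    have hgM : g • x ∈ M := h.smul_mem x hxM g
    -- `x` and `g • x` are points of `M` near `z` with the same coordinates, and hence agree
    have hχg : χ (g • x) = χ x := by
      rw [hχE _ ((hball _ hgr).1.1 hgM), hy1]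
      have e1 : g • x - z = g • (x - z) := by rw [smul_sub, hz.2 g hg]
      rw [e1, hPg g hg, ← hχE _ ((hball _ hxr).1.1 hxM), hy1, hyT.2 g hg]
    have e3 := (hball _ hgr).2
    rw [hχg, (hball _ hxr).2] at e3
    exact e3.symm

/-- The direction of steepest descent at a point of `M₀` is invariant under `G₀`. -/
theorem exists_descent_direction {z : X} (hz : z ∈ invariantPart G₀ M) {σ : ℝ} (hσ : 0 ≤ σ)
    (hd : ENNReal.ofReal σ < dualNormAt B M Φ z) :
    ∃ v ∈ tangentSpace M z, (∀ g ∈ G₀, g • v = v) ∧ normAt B z v < 1 ∧ dPhi M Φ z v < -σ := by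
  have hz0 : z ≠ 0 := h.ne_zero hz.1
  obtain ⟨E, κ, hE, hκ, hκd, hκ0, hκM⟩ := exists_straightening h.submanifold hz.1
  have hET : ∀ v, v ∈ tangentSpace M z ↔ v ∈ E := mem_tangentSpace_iff hE hκ hκd hκ0 hκM
  have hgE : ∀ g ∈ G₀, ∀ v ∈ E, g • v ∈ E ∧ dPhi M Φ z (g • v) = dPhi M Φ z v := by
    intro g hg v hv
    have := h.smul_mem_tangentSpace hz.1 ((hET v).2 hv) g
    rw [hz.2 g hg] at this
    exact ⟨(hET _).1 this.1, this.2⟩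
  obtain ⟨w, hwE, hw⟩ := h.metric.exists_gradient hz0 E hE (fderivWithin ℝ Φ M z)
  have hw' : ∀ v ∈ E, B z w v = dPhi M Φ z v := hw
  simp only [dualNormAt, lt_iSup_iff] at hd
  obtain ⟨v, hv, hv1, hvσ⟩ := hd
  have hσv : σ < |dPhi M Φ z v| := (ENNReal.ofReal_lt_ofReal_iff'.1 hvσ).1
  have hnw : σ < normAt B z w := by
    rw [← hw' v ((hET v).1 hv)] at hσv
    refine hσv.trans_le ((h.metric.abs_apply_le hz0 w v).trans ?_)
    exact mul_le_of_le_one_right (normAt_nonneg _ _) hv1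
  -- the gradient is unique, and `Φ` and the scalar product at `z` are invariant under `G₀`
  have hwg : ∀ g ∈ G₀, g • w = w := by
    intro g hg
    refine sub_eq_zero.1 (h.metric.eq_zero_of_apply_self hz0 ?_)
    have key : ∀ q ∈ E, B z (g • w - w) q = 0 := by
      intro q hq
      have h1 := h.apply_smul hz0 g w (g⁻¹ • q)
      have h2 := hgE _ (G₀.inv_mem hg) q hq
      rw [hz.2 g hg, smul_inv_smul, hw' _ h2.1, h2.2, ← hw' q hq] at h1
      rw [LinearMap.map_sub₂, h1, sub_self]
    exact key _ (E.sub_mem (hgE g hg w hwE).1 hwE)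
  have hpos : 0 < normAt B z w := hσ.trans_lt hnw
  obtain ⟨s, hs1, hs2⟩ := exists_between ((div_lt_one hpos).2 hnw)
  rw [div_lt_iff₀ hpos] at hs1
  have hs0 : 0 < s := by
    by_contra hcon
    nlinarith
  refine ⟨(-(s / normAt B z w)) • w, LSTheory.smul_mem_tangentSpace ((hET w).2 hwE) _,
    fun g hg => by rw [smul_comm, hwg g hg], ?_, ?_⟩
  · rw [normAt_smul, abs_neg, abs_of_pos (by positivity), div_mul_cancel₀ _ hpos.ne']
    exact hs2
  · have e1 : dPhi M Φ z ((-(s / normAt B z w)) • w) = -(s / normAt B z w) * dPhi M Φ z w :=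
      map_smul (fderivWithin ℝ Φ M z) _ _
    rw [e1, ← hw' w hwE, ← h.metric.normAt_sq hz0]
    have : -(s / normAt B z w) * normAt B z w ^ 2 = -(s * normAt B z w) := by
      field_simp
    rw [this]
    linarith

end IsSymmetricSetting

/-! ### Curves of descent -/

namespace IsSymmetricSetting

variable {X G : Type*} [NormedAddCommGroup X] [InnerProductSpace ℝ X]
  [Group G] [DistribMulAction G X] [SMulCommClass G ℝ X]
  {B : X → X →ₗ[ℝ] X →ₗ[ℝ] ℝ} {M : Set X} {Φ : X → ℝ} {G₀ : Subgroup G}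
  (h : IsSymmetricSetting B M Φ G₀) [CompleteSpace X]
include h

/-- On `M₀`, convergence in `X` implies convergence in the path metric. -/
theorem tendsto_pathDist {z : X} (hz : z ∈ invariantPart G₀ M) :
    Tendsto (fun x => pathDist B (invariantPart G₀ M) z x) (𝓝[invariantPart G₀ M] z) (𝓝 0) := by
  have hz0 : z ≠ 0 := h.ne_zero hz.1
  obtain ⟨T, χ, θ, -, hχ, hχ0, hθ, hθd, hθ0, hχM, hθM⟩ := h.exists_chart hz
  obtain ⟨R, hR, C, hC, hRC⟩ := h.metric.exists_ball hz0
  have hθc : Tendsto θ (𝓝 0) (𝓝 z) := hθ0 ▸ hθ.continuousAt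
  have hfd : ContinuousAt (fun y => ‖fderiv ℝ θ y‖) 0 :=
    (hθ.fderiv_right (m := 0) (by norm_num)).continuousAt.norm
  set K := ‖fderiv ℝ θ 0‖ + 1
  have hev : ∀ᶠ y in 𝓝 0, (y ∈ T → θ y ∈ invariantPart G₀ M) ∧ ContDiffAt ℝ 1 θ y ∧
      θ y ∈ Metric.ball z R ∧ ‖fderiv ℝ θ y‖ < K :=
    hθM.and ((hθ.eventually (by simp)).and ((hθc.eventually (Metric.ball_mem_nhds z hR)).and
      (hfd.eventually_lt_const (lt_add_one _))))
  obtain ⟨ρ, hρ, hball⟩ := Metric.eventually_nhds_iff_ball.1 hev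
  have hχc : Tendsto χ (𝓝 z) (𝓝 0) := hχ0 ▸ hχ.continuousAt
  have hlim : Tendsto (fun x => ENNReal.ofReal (C * (K * ‖χ x‖))) (𝓝[invariantPart G₀ M] z)
      (𝓝 0) := by
    have : Tendsto (fun x => C * (K * ‖χ x‖)) (𝓝[invariantPart G₀ M] z) (𝓝 0) := by
      have := ((hχc.norm.const_mul K).const_mul C).mono_left
        (nhdsWithin_le_nhds (s := invariantPart G₀ M))
      simpa using this
    simpa using ENNReal.tendsto_ofReal this
  refine tendsto_of_tendsto_of_tendsto_of_le_of_le' tendsto_const_nhds hlim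
    (Eventually.of_forall fun _ => zero_le) ?_
  filter_upwards [mem_nhdsWithin_of_mem_nhds hχM, self_mem_nhdsWithin,
    mem_nhdsWithin_of_mem_nhds (hχc.eventually (Metric.ball_mem_nhds 0 hρ))] with x hx1 hxM hx2
  obtain ⟨hxT, hθx⟩ := hx1 hxM
  have hmem : ∀ s ∈ Icc (0 : ℝ) 1, s • χ x ∈ Metric.ball (0 : X) ρ := by
    intro s hs
    rw [mem_ball_zero_iff, norm_smul, Real.norm_eq_abs, abs_of_nonneg hs.1]
    refine (mul_le_of_le_one_left (norm_nonneg _) hs.2).trans_lt ?_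
    rw [← mem_ball_zero_iff]
    exact hx2
  have hsm : ∀ s : ℝ, HasDerivAt (fun s : ℝ => s • χ x) (χ x) s := fun s => by
    simpa using (hasDerivAt_id s).smul_const (χ x)
  have hle := pathDist_le_arcLength (B := B) (S := invariantPart G₀ M) (u := z) (v := x)
    (γ := fun s : ℝ => θ (s • χ x))
    (fun s hs => ((hball _ (hmem s hs)).2.1).comp s (by fun_prop))
    (fun s hs => (hball _ (hmem s hs)).1 (T.smul_mem s hxT)) (by simpa using hθ0)
    (by simpa using hθx)
  refine hle.trans (ENNReal.ofReal_le_ofReal ?_)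
  refine (le_abs_self _).trans ?_
  rw [← Real.norm_eq_abs]
  refine (intervalIntegral.norm_integral_le_of_norm_le_const (C := C * (K * ‖χ x‖)) ?_).trans
    (by simp)
  intro s hs
  rw [uIoc_of_le zero_le_one] at hs
  have hb := hball _ (hmem s ⟨hs.1.le, hs.2⟩)
  have hd : deriv (fun s : ℝ => θ (s • χ x)) s = fderiv ℝ θ (s • χ x) (χ x) :=
    ((hb.2.1.differentiableAt (by norm_num)).hasFDerivAt.comp_hasDerivAt s (hsm s)).deriv
  rw [hd, Real.norm_eq_abs, abs_of_nonneg (normAt_nonneg _ _)]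
  refine ((hRC _ hb.2.2.1).2 _).2.trans (mul_le_mul_of_nonneg_left ?_ hC.le)
  exact (ContinuousLinearMap.le_opNorm _ _).trans
    (mul_le_mul_of_nonneg_right hb.2.2.2.le (norm_nonneg _))

theorem tendsto_pathDist_of_tendsto {ι : Type*} {l : Filter ι} {x : ι → X} {z : X}
    (hz : z ∈ invariantPart G₀ M) (hx : ∀ i, x i ∈ invariantPart G₀ M)
    (hl : Tendsto x l (𝓝 z)) :
    Tendsto (fun i => pathDist B (invariantPart G₀ M) z (x i)) l (𝓝 0) :=
  (h.tendsto_pathDist hz).comp (tendsto_nhdsWithin_iff.2 ⟨hl, Eventually.of_forall hx⟩)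

/-- Curves of descent near a point `z` of `M₀`: straight lines in a chart. -/
theorem exists_descent_curves {z : X} (hz : z ∈ invariantPart G₀ M) {σ : ℝ} (hσ : 0 ≤ σ)
    (hd : ENNReal.ofReal σ < dualNormAt B M Φ z) :
    ∃ r > 0, ∃ τ > 0, ∃ C > 0, ∃ H : X → ℝ → X,
      ContinuousOn (Function.uncurry H) (Metric.ball z r ×ˢ Ioo (-τ) τ) ∧
      ∀ x ∈ Metric.ball z r, x ∈ invariantPart G₀ M → H x 0 = x ∧ ∀ t ∈ Ioo (-τ) τ,
        H x t ∈ invariantPart G₀ M ∧ ContDiffAt ℝ 1 (H x) t ∧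
        normAt B (H x t) (deriv (H x) t) ≤ 1 ∧ ‖deriv (H x) t‖ ≤ C ∧
        dPhi M Φ (H x t) (deriv (H x) t) ≤ -σ := by
  have hz0 : z ≠ 0 := h.ne_zero hz.1
  obtain ⟨v, hv, hvg, hv1, hvσ⟩ := h.exists_descent_direction hz hσ hd
  obtain ⟨T, χ, θ, hT, hχ, hχ0, hθ, hθd, hθ0, hχM, hθM⟩ := h.exists_chart hz
  have hvT : v ∈ T := (hT v).2 ⟨hv, hvg⟩
  obtain ⟨F, hF, hFΦ⟩ := exists_extension h.regular hz.1
  have hθc : Tendsto θ (𝓝 0) (𝓝 z) := hθ0 ▸ hθ.continuousAt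
  -- the velocity, as a function of the position in the chart
  let V : X → X := fun y => fderiv ℝ θ y v
  have hVc : ContinuousAt V 0 :=
    (hθ.fderiv_right (m := 0) (by norm_num)).continuousAt.clm_apply continuousAt_const
  have hV0 : V 0 = v := by simp [V, hθd.fderiv]
  have hN : Tendsto (fun y => normAt B (θ y) (V y)) (𝓝 0) (𝓝 (normAt B z v)) := by
    have h1 : Tendsto (fun y => (θ y, V y)) (𝓝 0) (𝓝 (z, v)) := by
      have := hθc.prodMk_nhds hVc
      rwa [hV0] at this
    exact (h.metric.continuousAt_normAt hz0 v).tendsto.comp h1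
  have hD : Tendsto (fun y => fderiv ℝ F (θ y) (V y)) (𝓝 0) (𝓝 (fderiv ℝ F z v)) := by
    have h1 : Tendsto (fun y => fderiv ℝ F (θ y)) (𝓝 0) (𝓝 (fderiv ℝ F z)) :=
      (hF.fderiv_right (m := 0) (by norm_num)).continuousAt.tendsto.comp hθc
    have h2 : Tendsto V (𝓝 0) (𝓝 v) := by
      have := hVc.tendsto
      rwa [hV0] at this
    exact (isBoundedBilinearMap_apply.continuous.tendsto (fderiv ℝ F z, v)).comp
      (h1.prodMk_nhds h2)
  have hFv : fderiv ℝ F z v < -σ := by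
    rw [← (hFΦ.self_of_nhds hz.1).2 v hv]
    exact hvσ
  have hev : ∀ᶠ y in 𝓝 0, (y ∈ T → θ y ∈ invariantPart G₀ M) ∧ ContDiffAt ℝ 1 θ y ∧
      normAt B (θ y) (V y) < 1 ∧ ‖V y‖ < ‖v‖ + 1 ∧ fderiv ℝ F (θ y) (V y) < -σ ∧
      (θ y ∈ M → F (θ y) = Φ (θ y) ∧
        ∀ w ∈ tangentSpace M (θ y), dPhi M Φ (θ y) w = fderiv ℝ F (θ y) w) := by
    have hVn := hVc.norm.tendsto
    rw [hV0] at hVn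
    exact hθM.and ((hθ.eventually (by simp)).and ((hN.eventually_lt_const hv1).and
      ((hVn.eventually_lt_const (lt_add_one _)).and
        ((hD.eventually_lt_const hFv).and (hθc.eventually hFΦ)))))
  obtain ⟨ρ, hρ, hball⟩ := Metric.eventually_nhds_iff_ball.1 hev
  have hχc : Tendsto χ (𝓝 z) (𝓝 0) := hχ0 ▸ hχ.continuousAt
  have hevx : ∀ᶠ x in 𝓝 z, (x ∈ invariantPart G₀ M → χ x ∈ T ∧ θ (χ x) = x) ∧
      χ x ∈ Metric.ball (0 : X) (ρ / 2) ∧ ContDiffAt ℝ 1 χ x :=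
    hχM.and ((hχc.eventually (Metric.ball_mem_nhds 0 (by positivity))).and
      (hχ.eventually (by simp)))
  obtain ⟨r, hr, hballx⟩ := Metric.eventually_nhds_iff_ball.1 hevx
  set τ := ρ / (2 * (‖v‖ + 1))
  have hτ : 0 < τ := by positivity
  have hmem : ∀ x ∈ Metric.ball z r, ∀ t ∈ Ioo (-τ) τ, χ x + t • v ∈ Metric.ball (0 : X) ρ := by
    intro x hx t ht
    have h1 := (hballx x hx).2.1
    rw [mem_ball_zero_iff] at h1 ⊢
    have h2 : ‖t • v‖ ≤ ρ / 2 := by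
      rw [norm_smul, Real.norm_eq_abs]
      calc |t| * ‖v‖ ≤ τ * (‖v‖ + 1) := by
            gcongr
            · exact (abs_lt.2 ht).le
            · linarith
        _ = ρ / 2 := by simp only [τ]; field_simp
    linarith [norm_add_le (χ x) (t • v)]
  have hline : ∀ (x : X) (t : ℝ), HasDerivAt (fun t : ℝ => χ x + t • v) v t := fun x t => by
    simpa using ((hasDerivAt_id t).smul_const v).const_add (χ x)
  refine ⟨r, hr, τ, hτ, ‖v‖ + 1, by positivity, fun x t => θ (χ x + t • v), ?_, ?_⟩
  · rintro ⟨x, t⟩ ⟨hx, ht⟩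
    have h1 : ContinuousAt θ (χ x + t • v) := (hball _ (hmem x hx t ht)).2.1.continuousAt
    have h2 : ContinuousAt χ x := (hballx x hx).2.2.continuousAt
    have h3 : ContinuousAt (fun p : X × ℝ => χ p.1 + p.2 • v) (x, t) :=
      (ContinuousAt.comp (f := Prod.fst) (g := χ) h2 continuousAt_fst).add
        (by fun_prop)
    exact (ContinuousAt.comp (f := fun p : X × ℝ => χ p.1 + p.2 • v) (g := θ) h1
      h3).continuousWithinAt
  · intro x hx hxM
    obtain ⟨hxT, hθx⟩ := (hballx x hx).1 hxM
    refine ⟨by simpa using hθx, fun t ht => ?_⟩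
    have hmem0 : ∀ s ∈ Ioo (-τ) τ, θ (χ x + s • v) ∈ invariantPart G₀ M := fun s hs =>
      (hball _ (hmem x hx s hs)).1 (T.add_mem hxT (T.smul_mem s hvT))
    obtain ⟨-, hθy, hn1, hn2, hn3, hn4⟩ := hball _ (hmem x hx t ht)
    have hderiv : deriv (fun t : ℝ => θ (χ x + t • v)) t = V (χ x + t • v) :=
      ((hθy.differentiableAt (by norm_num)).hasFDerivAt.comp_hasDerivAt t (hline x t)).deriv
    have hcd : ContDiffAt ℝ 1 (fun t : ℝ => θ (χ x + t • v)) t :=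
      ContDiffAt.comp (g := θ) t hθy (by fun_prop)
    refine ⟨hmem0 t ht, hcd, by rw [hderiv]; exact hn1.le, by rw [hderiv]; exact hn2.le, ?_⟩
    have htan := mem_tangentSpace_of_curve (M := M) hcd (by
      filter_upwards [Ioo_mem_nhds ht.1 ht.2] with s hs using (hmem0 s hs).1)
    rw [(hn4 (hmem0 t ht).1).2 _ htan, hderiv]
    exact hn3.le

/-- On `M₀`, the norm of `Φ'` is lower semicontinuous. -/
theorem eventually_le_dualNormAt {z : X} (hz : z ∈ invariantPart G₀ M) {σ : ℝ} (hσ : 0 ≤ σ)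
    (hd : ENNReal.ofReal σ < dualNormAt B M Φ z) :
    ∀ᶠ x in 𝓝 z, x ∈ invariantPart G₀ M → ENNReal.ofReal σ ≤ dualNormAt B M Φ x := by
  obtain ⟨r, hr, τ, hτ, C, hC, H, -, hH⟩ := h.exists_descent_curves hz hσ hd
  filter_upwards [Metric.ball_mem_nhds z hr] with x hx hxM
  obtain ⟨hx0, hxH⟩ := hH x hx hxM
  have h0 : (0 : ℝ) ∈ Ioo (-τ) τ := ⟨by linarith, hτ⟩
  obtain ⟨-, hcd, hn, -, hs⟩ := hxH 0 h0
  have htan := mem_tangentSpace_of_curve (M := M) hcd (by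
    filter_upwards [Ioo_mem_nhds h0.1 h0.2] with s hs using (hxH s hs).1.1)
  rw [hx0] at hn hs htan
  refine le_iSup₂_of_le _ htan (le_iSup_of_le hn (ENNReal.ofReal_le_ofReal ?_))
  rw [← abs_neg]
  exact (by linarith : σ ≤ -dPhi M Φ x (deriv (H x) 0)).trans (le_abs_self _)

theorem isCritical_of_tendsto {x : ℕ → X} (hx : ∀ n, x n ∈ invariantPart G₀ M) {z : X}
    (hz : z ∈ invariantPart G₀ M) (hxz : Tendsto x atTop (𝓝 z))
    (hd : Tendsto (fun n => dualNormAt B M Φ (x n)) atTop (𝓝 0)) : IsCritical M Φ z := by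
  rw [h.isCritical_iff hz.1]
  by_contra hne
  obtain ⟨σ, hσ0, hσ⟩ := ENNReal.lt_iff_exists_nnreal_btwn.1 (pos_iff_ne_zero.2 hne)
  rw [← ENNReal.ofReal_coe_nnreal] at hσ hσ0
  have h1 := hxz.eventually (h.eventually_le_dualNormAt hz σ.2 hσ)
  obtain ⟨n, hn1, hn2⟩ := (h1.and (hd.eventually_lt_const hσ0)).exists
  exact absurd hn2 (not_lt.2 (hn1 (hx n)))

/-- Homotopies of descent near a point `z` of `M₀` with `‖Φ'(z)‖_z > σ`. The distance travelled is
at most `1/σ` times the decrease of `Φ`. -/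
theorem exists_descent_homotopy {z : X} (hz : z ∈ invariantPart G₀ M) {σ : ℝ} (hσ : 0 < σ)
    (hd : ENNReal.ofReal σ < dualNormAt B M Φ z) :
    ∃ r > 0, ∃ H : X → ℝ → X,
      ContinuousOn (Function.uncurry H) (Metric.ball z r ×ˢ Icc 0 1) ∧
      ∀ x ∈ Metric.ball z r, x ∈ invariantPart G₀ M → H x 0 = x ∧ ∀ t ∈ Icc (0 : ℝ) 1,
        H x t ∈ invariantPart G₀ M ∧ ‖H x t - x‖ ≤ t ∧
        pathDist B (invariantPart G₀ M) x (H x t) ≤ ENNReal.ofReal ((Φ x - Φ (H x t)) / σ) ∧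
        pathDist B (invariantPart G₀ M) x (H x t) ≤ ENNReal.ofReal 1 ∧
        Φ (H x t) ≤ Φ x ∧ (0 < t → Φ (H x t) < Φ x) := by
  obtain ⟨r, hr, τ, hτ, C, hC, H, hHc, hH⟩ := h.exists_descent_curves hz hσ.le hd
  -- the total time: short enough that the curves move by at most `1`, in `X` and for `d`
  set s₀ := min (τ / 2) (min 1 (1 / C))
  have hs0 : 0 < s₀ := by positivity
  have hs1 : s₀ ≤ 1 := (min_le_right _ _).trans (min_le_left _ _)
  have hsC : C * s₀ ≤ 1 := by
    have : s₀ ≤ 1 / C := (min_le_right _ _).trans (min_le_right _ _)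
    calc C * s₀ ≤ C * (1 / C) := by gcongr
      _ = 1 := by field_simp
  have hsτ : s₀ < τ := (min_le_left _ _).trans_lt (by linarith)
  refine ⟨r, hr, fun x t => H x (s₀ * t), ?_, ?_⟩
  · refine ContinuousOn.comp (g := Function.uncurry H) (f := fun p : X × ℝ => (p.1, s₀ * p.2))
      hHc (by fun_prop) ?_
    rintro ⟨x, t⟩ ⟨hx, ht⟩
    exact ⟨hx, by nlinarith [ht.1], by nlinarith [ht.2]⟩
  · intro x hx hxM
    obtain ⟨hx0, hxH⟩ := hH x hx hxM
    refine ⟨by simpa using hx0, fun t ht => ?_⟩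
    set a := s₀ * t
    have ha0 : 0 ≤ a := mul_nonneg hs0.le ht.1
    have has : a ≤ s₀ := mul_le_of_le_one_right hs0.le ht.2
    have hsub : ∀ s ∈ Icc 0 a, s ∈ Ioo (-τ) τ := fun s hs =>
      ⟨by linarith [hs.1], by linarith [hs.2]⟩
    have haτ : a ∈ Ioo (-τ) τ := hsub a ⟨ha0, le_rfl⟩
    have hdΦ : ∀ s ∈ Icc 0 a, HasDerivAt (fun s => Φ (H x s))
        (dPhi M Φ (H x s) (deriv (H x) s)) s := by
      intro s hs
      refine hasDerivAt_comp_curve_at h.regular (hxH s (hsub s hs)).2.1 ?_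
      filter_upwards [Ioo_mem_nhds (hsub s hs).1 (hsub s hs).2] with s' hs'
      exact (hxH s' hs').1.1
    have hΦ : Φ (H x a) - Φ x ≤ -σ * a := by
      have := Convex.image_sub_le_mul_sub_of_deriv_le (convex_Icc 0 a) (f := fun s => Φ (H x s))
        (fun s hs => (hdΦ s hs).continuousAt.continuousWithinAt)
        (fun s hs => (hdΦ s (interior_subset hs)).differentiableAt.differentiableWithinAt)
        (C := -σ) (fun s hs => by
          rw [(hdΦ s (interior_subset hs)).deriv]
          exact (hxH s (hsub s (interior_subset hs))).2.2.2.2) 0 ⟨le_rfl, ha0⟩ a ⟨ha0, le_rfl⟩ ha0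
      simpa [hx0] using this
    have hdist : pathDist B (invariantPart G₀ M) x (H x a) ≤ ENNReal.ofReal a := by
      have hmem : ∀ s ∈ Icc (0 : ℝ) 1, a * s ∈ Ioo (-τ) τ := fun s hs =>
        hsub _ ⟨mul_nonneg ha0 hs.1, mul_le_of_le_one_right ha0 hs.2⟩
      have hle := pathDist_le_arcLength (B := B) (S := invariantPart G₀ M) (u := x) (v := H x a)
        (γ := fun s => H x (a * s))
        (fun s hs => ((hxH _ (hmem s hs)).2.1).comp s (by fun_prop))
        (fun s hs => (hxH _ (hmem s hs)).1) (by simpa using hx0) (by simp)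
      refine hle.trans (ENNReal.ofReal_le_ofReal ?_)
      refine (le_abs_self _).trans ?_
      rw [← Real.norm_eq_abs]
      refine (intervalIntegral.norm_integral_le_of_norm_le_const (C := a) ?_).trans (by simp)
      intro s hs
      rw [uIoc_of_le zero_le_one] at hs
      have hs' := hmem s ⟨hs.1.le, hs.2⟩
      have hmul : HasDerivAt (fun s : ℝ => a * s) a s := by
        simpa using (hasDerivAt_id s).const_mul a
      have hder : deriv (fun s => H x (a * s)) s = a • deriv (H x) (a * s) :=
        ((((hxH _ hs').2.1.differentiableAt (by norm_num)).hasDerivAt).scomp s hmul).deriv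
      rw [hder, normAt_smul, Real.norm_eq_abs, abs_of_nonneg (mul_nonneg (abs_nonneg _)
        (normAt_nonneg _ _)), abs_of_nonneg ha0]
      exact mul_le_of_le_one_right ha0 (hxH _ hs').2.2.1
    refine ⟨(hxH a haτ).1, ?_, hdist.trans (ENNReal.ofReal_le_ofReal ?_),
      hdist.trans (ENNReal.ofReal_le_ofReal (has.trans hs1)), by nlinarith, fun ht0 => ?_⟩
    · have := Convex.norm_image_sub_le_of_norm_hasDerivWithin_le (f := H x) (f' := deriv (H x))
        (s := Icc 0 a) (x := 0) (y := a) (C := C)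
        (fun s hs => ((hxH s (hsub s hs)).2.1.differentiableAt
          (by norm_num)).hasDerivAt.hasDerivWithinAt)
        (fun s hs => (hxH s (hsub s hs)).2.2.2.1) (convex_Icc 0 a) ⟨le_rfl, ha0⟩ ⟨ha0, le_rfl⟩
      rw [hx0, sub_zero, Real.norm_eq_abs, abs_of_nonneg ha0] at this
      refine this.trans ?_
      calc C * a = (C * s₀) * t := by simp only [a]; ring
        _ ≤ t := mul_le_of_le_one_left ht.1 hsC
    · rw [le_div_iff₀ hσ]
      nlinarith
    · have : 0 < σ * a := mul_pos hσ (mul_pos hs0 ht0)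
      linarith

end IsSymmetricSetting

/-! ### Neighbourhoods of the critical orbits -/

section CapDist

variable {X : Type*} [NormedAddCommGroup X] (G : Type*) [Group G] [DistribMulAction G X]

/-- The distance of `u` from the orbit of `x` in the norm of `X`, in units of `r` and cut off
at `1`. -/
noncomputable def capDist (u : X) (r : ℝ) (x : X) : ℝ := ⨅ g : G, min 1 (‖g • x - u‖ / r)

/-- The union of the orbits that meet the ball of radius `r` around `u`. -/
def orbitBall (u : X) (r : ℝ) : Set X := {x | ∃ g : G, ‖g • x - u‖ < r}

variable {G} {u x : X} {r : ℝ}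

theorem capDist_bddBelow (hr : 0 < r) :
    BddBelow (range fun g : G => min 1 (‖g • x - u‖ / r)) :=
  ⟨0, by rintro _ ⟨g, rfl⟩; exact le_min zero_le_one (by positivity)⟩

theorem capDist_le (hr : 0 < r) (g : G) : capDist G u r x ≤ ‖g • x - u‖ / r :=
  (ciInf_le (capDist_bddBelow hr) g).trans (min_le_right _ _)

theorem capDist_le_one (hr : 0 < r) : capDist G u r x ≤ 1 :=
  (ciInf_le (capDist_bddBelow hr) 1).trans (min_le_left _ _)

theorem capDist_lt_iff (hr : 0 < r) {s : ℝ} (hs : s ≤ 1) :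
    capDist G u r x < s ↔ x ∈ orbitBall G u (s * r) := by
  rw [capDist, ciInf_lt_iff (capDist_bddBelow hr)]
  simp only [min_lt_iff, not_lt.2 hs, false_or, div_lt_iff₀ hr]
  rfl

theorem capDist_neg : capDist G u r (-x) = capDist G (-u) r x := by
  simp only [capDist, smul_neg, ← norm_neg (-(_ • x) - u), neg_sub, sub_neg_eq_add, add_comm]

theorem smul_mem_orbitBall_iff (g : G) : g • x ∈ orbitBall G u r ↔ x ∈ orbitBall G u r := by
  constructor
  · rintro ⟨k, hk⟩
    exact ⟨k * g, by rwa [mul_smul]⟩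
  · rintro ⟨k, hk⟩
    exact ⟨k * g⁻¹, by rwa [mul_smul, inv_smul_smul]⟩

end CapDist

/-- A sequentially compact set in a pseudometric space given by an explicit distance function has
the finite covering property. -/
theorem exists_finset_cover_of_seqCompact {Y : Type*} (δ : Y → Y → ℝ≥0∞)
    (hself : ∀ x, δ x x = 0) (hcomm : ∀ x y, δ x y ≤ δ y x)
    (htri : ∀ x y z, δ x z ≤ δ x y + δ y z) (K : Set Y)
    (hK : ∀ x : ℕ → Y, (∀ n, x n ∈ K) → ∃ u ∈ K, ∃ φ : ℕ → ℕ, StrictMono φ ∧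
      Tendsto (fun n => δ (x (φ n)) u) atTop (𝓝 0))
    (V : Y → Set Y) (hV : ∀ u ∈ K, ∃ ε > 0, ∀ x, δ x u < ε → x ∈ V u) :
    ∃ t : Finset Y, (t : Set Y) ⊆ K ∧ ∀ x ∈ K, ∃ u ∈ t, x ∈ V u := by
  let inst : PseudoEMetricSpace Y :=
    { edist := δ
      edist_self := hself
      edist_comm := fun x y => le_antisymm (hcomm x y) (hcomm y x)
      edist_triangle := htri }
  have hseq : IsSeqCompact K := by
    intro x hx
    obtain ⟨u, hu, φ, hφ, hlim⟩ := hK x hx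
    exact ⟨u, hu, φ, hφ, tendsto_iff_edist_tendsto_0.2 hlim⟩
  obtain ⟨t, ht, hcov⟩ := hseq.isCompact.elim_nhds_subcover V (fun u hu => by
    obtain ⟨ε, hε, h⟩ := hV u hu
    exact Filter.mem_of_superset (Metric.eball_mem_nhds u hε) fun x hx => h x hx)
  refine ⟨t, fun u hu => ht u hu, fun x hx => ?_⟩
  simpa using hcov hx

namespace IsSymmetricSetting

variable {X G : Type*} [NormedAddCommGroup X] [InnerProductSpace ℝ X]
  [Group G] [DistribMulAction G X] [SMulCommClass G ℝ X]
  {B : X → X →ₗ[ℝ] X →ₗ[ℝ] ℝ} {M : Set X} {Φ : X → ℝ} {G₀ : Subgroup G}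
  (h : IsSymmetricSetting B M Φ G₀)
include h

theorem isOpen_orbitBall (u : X) (r : ℝ) : IsOpen (orbitBall G u r) := by
  have : orbitBall G u r = ⋃ g : G, {x | ‖g • x - u‖ < r} := by
    ext x; simp [orbitBall]
  rw [this]
  refine isOpen_iUnion fun g => isOpen_lt ?_ continuous_const
  exact ((h.continuous_smul g).sub continuous_const).norm

omit [SMulCommClass G ℝ X] in
/-- A neighbourhood of an orbit that does not contain `-u` is disjoint from its mirror image. -/
theorem exists_orbitBall_disjoint_neg {u : X} (hu : u ≠ 0) (hneg : ∀ g : G, g • u ≠ -u) :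
    ∃ r > 0, ∀ x ∈ orbitBall G u r, -x ∉ orbitBall G u r := by
  by_contra! hcon
  choose x hx hx' using fun n : ℕ => hcon (1 / ((n : ℝ) + 1)) (by positivity)
  choose g hg using hx
  choose k hk using hx'
  have hlim : ∀ y : ℕ → X, (∀ n, ‖y n - u‖ < 1 / ((n : ℝ) + 1)) → Tendsto y atTop (𝓝 u) := by
    intro y hy
    rw [tendsto_iff_norm_sub_tendsto_zero]
    exact squeeze_zero (fun _ => norm_nonneg _) (fun n => (hy n).le)
      tendsto_one_div_add_atTop_nhds_zero_nat
  have hy : Tendsto (fun n => g n • x n) atTop (𝓝 u) := hlim _ hg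
  have hz : Tendsto (fun n => (k n * (g n)⁻¹) • g n • x n) atTop (𝓝 (-u)) := by
    have := (hlim _ hk).neg
    simpa only [smul_neg, neg_neg, mul_smul, inv_smul_smul] using this
  obtain ⟨R, hR, C, hC, h1⟩ := h.metric.exists_ball hu
  obtain ⟨R', hR', C', hC', h2⟩ := h.metric.exists_ball (neg_ne_zero.2 hu)
  -- group elements that move points near `u` to points near `-u` are uniformly bounded operators
  have hdiff : Tendsto (fun n => (k n * (g n)⁻¹) • u - (k n * (g n)⁻¹) • g n • x n) atTop
      (𝓝 0) := by
    have h3 : Tendsto (fun n => C' * (C * ‖u - g n • x n‖)) atTop (𝓝 0) := by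
      have := (((hy.const_sub u).norm).const_mul C).const_mul C'
      simpa using this
    refine squeeze_zero_norm' ?_ h3
    filter_upwards [hy.eventually (Metric.ball_mem_nhds u hR),
      hz.eventually (Metric.ball_mem_nhds (-u) hR')] with n hn1 hn2
    obtain ⟨hne, h1n⟩ := h1 _ hn1
    rw [← smul_sub]
    refine ((h2 _ hn2).2 _).1.trans ?_
    rw [h.normAt_smul_smul hne]
    exact mul_le_mul_of_nonneg_left (h1n _).2 hC'.le
  have hfin := hdiff.add hz
  simp only [sub_add_cancel, zero_add] at hfin
  obtain ⟨q, hq⟩ := h.closed_orbits u (-u) _ hfin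
  exact hneg q hq

omit [SMulCommClass G ℝ X] in
/-- Elements of `G₀` fix `u ≠ 0`; the others are the subject of `(I)'_c`. -/
theorem smul_ne_neg {c : ℝ} (hI : IPrime M Φ G₀ c) {u : X} (hu : u ∈ invariantPart G₀ M)
    (hc : IsCritical M Φ u) (huc : Φ u = c) (g : G) : g • u ≠ -u := by
  by_cases hg : g ∈ G₀
  · rw [hu.2 g hg]
    intro he
    have h2 : (2 : ℝ) • u = 0 := by rw [two_smul, ← sub_neg_eq_add, ← he, sub_self]
    exact h.ne_zero hu.1 ((smul_eq_zero.1 h2).resolve_left two_ne_zero)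
  · exact hI u hu hc huc g hg

/-- The cut-off distance from an orbit is Lipschitz with respect to the path metric. -/
theorem capDist_le_add {u : X} {r C ℓ : ℝ} (hr : 0 < r) (hC : 0 < C)
    (hR : ∀ y ∈ Metric.ball u r, ∀ v, ‖v‖ ≤ C * normAt B y v) {x y : X} (hℓ : 0 ≤ ℓ)
    (hxy : pathDist B (invariantPart G₀ M) x y ≤ ENNReal.ofReal ℓ) :
    capDist G u r y ≤ capDist G u r x + C / r * ℓ := by
  refine le_of_forall_pos_le_add fun η hη => ?_
  set ℓ' := ℓ + η * r / (2 * C)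
  have hlt : pathDist B (invariantPart G₀ M) x y < ENNReal.ofReal ℓ' :=
    hxy.trans_lt ((ENNReal.ofReal_lt_ofReal_iff (by positivity)).2
      (lt_add_of_pos_right _ (by positivity)))
  have e1 : C / r * ℓ' = C / r * ℓ + η / 2 := by
    simp only [ℓ']; field_simp
  set s := capDist G u r x + η / 2
  have e2 : capDist G u r x + C / r * ℓ + η = s + C / r * ℓ' := by
    rw [e1]; simp only [s]; ring
  rw [e2]
  by_cases hs : s + C / r * ℓ' ≤ 1
  · have hpos : 0 ≤ C / r * ℓ' := by positivity
    have hsx : capDist G u r x < s := by simp only [s]; linarith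
    obtain ⟨g, hg⟩ := (capDist_lt_iff hr (by linarith)).1 hsx
    have e3 : C * ℓ' = C / r * ℓ' * r := by field_simp
    have hn := norm_sub_le_of_pathDist_lt h.metric h.zero_notMem_invariantPart (u := g • x)
      (v := g • y) hC hR (by rwa [h.pathDist_smul]) (by rw [e3]; nlinarith)
    refine (capDist_le hr g).trans ?_
    rw [div_le_iff₀ hr]
    have : g • y - u = (g • y - g • x) + (g • x - u) := by abel
    rw [this]
    refine (norm_add_le _ _).trans ?_
    rw [e3] at hn
    nlinarith
  · exact (capDist_le_one hr).trans (not_le.1 hs).le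

/-- Near the orbit of `u`, the functional `N` is bounded. -/
theorem NFun_le_of_capDist_lt {u : X} {r C : ℝ} (hr : 0 < r) (hC : 0 < C)
    (hR : ∀ y ∈ Metric.ball u r, ∀ v, normAt B y v ≤ C * ‖v‖) {x : X}
    (hx : x ∈ invariantPart G₀ M) (hxu : capDist G u r x < 1) :
    NFun B (invariantPart G₀ M) x ≤ ENNReal.ofReal (C * (‖u‖ + r)) := by
  obtain ⟨g, hg⟩ := (capDist_lt_iff hr le_rfl).1 hxu
  rw [one_mul] at hg
  rw [← h.NFun_smul g x]
  refine (NFun_le_normAt (h.smul_mem_invariantPart hx g)).trans (ENNReal.ofReal_le_ofReal ?_)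
  refine (hR _ (mem_ball_iff_norm.2 hg) _).trans (mul_le_mul_of_nonneg_left ?_ hC.le)
  have : g • x = u + (g • x - u) := by abel
  rw [this]
  exact (norm_add_le _ _).trans (by linarith)

omit [SMulCommClass G ℝ X] in
theorem toReal_NFun_le_add {x y : X} (hx : x ∈ invariantPart G₀ M) {ℓ : ℝ} (hℓ : 0 ≤ ℓ)
    (hxy : pathDist B (invariantPart G₀ M) x y ≤ ENNReal.ofReal ℓ) :
    (NFun B (invariantPart G₀ M) y).toReal ≤ (NFun B (invariantPart G₀ M) x).toReal + ℓ := by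
  refine ENNReal.toReal_le_of_le_ofReal (by positivity) ?_
  rw [ENNReal.ofReal_add ENNReal.toReal_nonneg hℓ, ENNReal.ofReal_toReal (NFun_ne_top hx)]
  refine (NFun_le_add (u := x) h.metric h.zero_notMem_invariantPart).trans ?_
  gcongr

variable [CompleteSpace X]

theorem continuousOn_capDist {u : X} {r C : ℝ} (hr : 0 < r) (hC : 0 < C)
    (hR : ∀ y ∈ Metric.ball u r, ∀ v, ‖v‖ ≤ C * normAt B y v) :
    ContinuousOn (capDist G u r) (invariantPart G₀ M) := by
  intro z hz
  rw [ContinuousWithinAt, Metric.tendsto_nhds]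
  intro η hη
  have hpos : 0 < η / 2 * (r / C) := by positivity
  filter_upwards [(h.tendsto_pathDist hz).eventually_lt_const (ENNReal.ofReal_pos.2 hpos)]
    with x hx
  have h1 := h.capDist_le_add hr hC hR hpos.le hx.le
  rw [pathDist_comm h.metric h.zero_notMem_invariantPart] at hx
  have h2 := h.capDist_le_add hr hC hR hpos.le hx.le
  have e : C / r * (η / 2 * (r / C)) = η / 2 := by field_simp
  rw [e] at h1 h2
  rw [Real.dist_eq, abs_lt]
  constructor <;> linarith

/-- By `(NCG₀)_c`, the critical set at level `c` is compact up to the action of `G`: it is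
sequentially compact for the pseudometric `inf_g d(g ∗ x, y)`. -/
theorem exists_finite_cover {c : ℝ} (hNCG : NCG₀ B M Φ G₀ c) (r : X → ℝ)
    (hr : ∀ u ∈ invariantPart G₀ M, IsCritical M Φ u → Φ u = c → 0 < r u) :
    ∃ t : Finset X, (∀ u ∈ t, u ∈ invariantPart G₀ M ∧ IsCritical M Φ u ∧ Φ u = c) ∧
      ∀ x ∈ invariantPart G₀ M, IsCritical M Φ x → Φ x = c →
        ∃ u ∈ t, x ∈ orbitBall G u (r u) := by
  classical
  have h0 := h.zero_notMem_invariantPart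
  let S := invariantPart G₀ M
  have hlim : ∀ x : ℕ → S, (∀ n, x n ∈ {x : S | IsCritical M Φ x ∧ Φ x = c}) →
      ∃ u ∈ {x : S | IsCritical M Φ x ∧ Φ x = c}, ∃ φ : ℕ → ℕ, StrictMono φ ∧
        Tendsto (fun n => ⨅ g : G, pathDist B S (g • (x (φ n) : X)) u) atTop (𝓝 0) := by
    intro x hx
    have hd : ∀ n, dualNormAt B M Φ (x n) = 0 := fun n =>
      (h.isCritical_iff (x n).2.1).1 (hx n).1
    obtain ⟨φ, g, hφ, u, hu, hgu⟩ := hNCG (fun n => x n) (fun n => (x n).2)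
      (tendsto_const_nhds.congr fun n => (hx n).2.symm) (by
        refine tendsto_const_nhds.congr fun n => ?_
        rw [hd, zero_mul])
    have hmem : ∀ n, g n • (x (φ n) : X) ∈ S := fun n => h.smul_mem_invariantPart (x (φ n)).2 _
    refine ⟨⟨u, hu⟩, ⟨?_, ?_⟩, φ, hφ, ?_⟩
    · refine h.isCritical_of_tendsto hmem hu hgu ?_
      refine tendsto_const_nhds.congr fun n => ?_
      rw [h.dualNormAt_smul (x (φ n)).2.1, hd]
    · have h1 : Tendsto (fun n => Φ (g n • (x (φ n) : X))) atTop (𝓝 (Φ u)) :=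
        (continuousOn_of_isC11OnManifold h.regular u hu.1).tendsto.comp
          (tendsto_nhdsWithin_iff.2 ⟨hgu, Eventually.of_forall fun n => (hmem n).1⟩)
      refine tendsto_nhds_unique h1 (tendsto_const_nhds.congr fun n => ?_)
      rw [h.smul_eq _ (x (φ n)).2.1]
      exact (hx _).2.symm
    · refine tendsto_of_tendsto_of_tendsto_of_le_of_le tendsto_const_nhds
        (h.tendsto_pathDist_of_tendsto hu hmem hgu) (fun _ => zero_le) fun n => ?_
      refine iInf_le_of_le (g n) ?_
      rw [pathDist_comm h.metric h0]
  obtain ⟨t, htK, ht⟩ := exists_finset_cover_of_seqCompact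
    (fun x y : S => ⨅ g : G, pathDist B S (g • (x : X)) y)
    (fun x => by
      refine le_antisymm (iInf_le_of_le 1 ?_) zero_le
      rw [one_smul, pathDist_self x.2])
    (fun x y => le_iInf fun g => iInf_le_of_le g⁻¹ (by
      have := h.pathDist_smul g⁻¹ (x : X) (g • (y : X))
      rw [inv_smul_smul] at this
      rw [this, pathDist_comm h.metric h0]))
    (fun x y z => ENNReal.le_iInf_add_iInf fun g k => iInf_le_of_le (k * g) (by
      rw [mul_smul, ← h.pathDist_smul k (g • (x : X)) y]
      exact pathDist_triangle h.metric h0))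
    {x : S | IsCritical M Φ x ∧ Φ x = c} hlim (fun u => {x | (x : X) ∈ orbitBall G (u : X) (r u)})
    (fun u hu => by
      obtain ⟨η, hη, hlt⟩ := exists_pathDist_lt_imp_norm_lt h.metric h0 u.2
        (hr u u.2 hu.1 hu.2)
      refine ⟨ENNReal.ofReal η, ENNReal.ofReal_pos.2 hη, fun x hx => ?_⟩
      obtain ⟨g, hg⟩ := iInf_lt_iff.1 hx
      exact ⟨g, hlt _ (by rwa [pathDist_comm h.metric h0])⟩)
  refine ⟨t.image Subtype.val, fun u hu => ?_, fun x hx hxc hxΦ => ?_⟩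
  · obtain ⟨u, hu', rfl⟩ := Finset.mem_image.1 hu
    exact ⟨u.2, htK hu'⟩
  · obtain ⟨u, hu, hxu⟩ := ht ⟨x, hx⟩ ⟨hxc, hxΦ⟩
    exact ⟨u, Finset.mem_image_of_mem _ hu, hxu⟩

/-- Away from the critical orbits, `(NCG₀)_c` bounds `‖Φ'(x)‖_x (1 + N(x))` from below near the
level `c`. -/
theorem exists_lower_bound {c : ℝ} (hNCG : NCG₀ B M Φ G₀ c) {O : Set X} (hO : IsOpen O)
    (hOG : ∀ (g : G) x, g • x ∈ O → x ∈ O)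
    (hK : ∀ x ∈ invariantPart G₀ M, IsCritical M Φ x → Φ x = c → x ∈ O) :
    ∃ ε > 0, ∃ δ > 0, ∀ x ∈ invariantPart G₀ M, |Φ x - c| ≤ ε → x ∉ O →
      ENNReal.ofReal δ ≤ dualNormAt B M Φ x * (1 + NFun B (invariantPart G₀ M) x) := by
  by_contra! hcon
  have hpos : ∀ n : ℕ, 0 < 1 / ((n : ℝ) + 1) := fun n => by positivity
  choose x hx hxc hxO hxd using fun n : ℕ => hcon _ (hpos n) _ (hpos n)
  have hlim := tendsto_one_div_add_atTop_nhds_zero_nat (𝕜 := ℝ)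
  have hprod : Tendsto (fun n => dualNormAt B M Φ (x n) *
      (1 + NFun B (invariantPart G₀ M) (x n))) atTop (𝓝 0) := by
    refine tendsto_of_tendsto_of_tendsto_of_le_of_le tendsto_const_nhds ?_ (fun _ => zero_le)
      fun n => (hxd n).le
    simpa using ENNReal.tendsto_ofReal hlim
  have hΦ : Tendsto (fun n => Φ (x n)) atTop (𝓝 c) := by
    rw [tendsto_iff_norm_sub_tendsto_zero]
    exact squeeze_zero (fun _ => norm_nonneg _) hxc hlim
  obtain ⟨φ, g, hφ, u, hu, hgu⟩ := hNCG x hx hΦ hprod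
  have hmem : ∀ n, g n • x (φ n) ∈ invariantPart G₀ M := fun n =>
    h.smul_mem_invariantPart (hx _) _
  have hcrit : IsCritical M Φ u := by
    refine h.isCritical_of_tendsto hmem hu hgu ?_
    refine tendsto_of_tendsto_of_tendsto_of_le_of_le tendsto_const_nhds
      (hprod.comp hφ.tendsto_atTop) (fun _ => zero_le) fun n => ?_
    rw [h.dualNormAt_smul (hx _).1]
    exact le_mul_of_one_le_right zero_le le_self_add
  have hΦu : Φ u = c := by
    have h1 : Tendsto (fun n => Φ (g n • x (φ n))) atTop (𝓝 (Φ u)) :=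
      (continuousOn_of_isC11OnManifold h.regular u hu.1).tendsto.comp
        (tendsto_nhdsWithin_iff.2 ⟨hgu, Eventually.of_forall fun n => (hmem n).1⟩)
    refine tendsto_nhds_unique h1 ((hΦ.comp hφ.tendsto_atTop).congr fun n => ?_)
    rw [h.smul_eq _ (hx _).1]
    rfl
  obtain ⟨n, hn⟩ := (hgu.eventually (hO.mem_nhds (hK u hu hcrit hΦu))).exists
  exact hxO _ (hOG _ _ hn)

omit [SMulCommClass G ℝ X] [CompleteSpace X] in
/-- A sequence along which `Φ` decreases, and whose steps have a length controlled by `1 + N` times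
the decrease of `Φ`, converges: `N` grows at most exponentially in the decrease of `Φ`, so that
the total length is finite. -/
theorem exists_limit {c₀ c₁ : ℝ} (hcomplete : IsCompleteFor (pathDist B (invariantPart G₀ M))
      {u | u ∈ invariantPart G₀ M ∧ Φ u ∈ Icc c₀ c₁}) {L : ℝ} (hL : 0 ≤ L) (x : ℕ → X)
    (hx : ∀ n, x n ∈ invariantPart G₀ M) (hxc : ∀ n, Φ (x n) ∈ Icc c₀ c₁)
    (hanti : ∀ n, Φ (x (n + 1)) ≤ Φ (x n))
    (hstep : ∀ n, pathDist B (invariantPart G₀ M) (x n) (x (n + 1)) ≤ ENNReal.ofReal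
      (L * (1 + (NFun B (invariantPart G₀ M) (x n)).toReal) * (Φ (x n) - Φ (x (n + 1))))) :
    ∃ z ∈ invariantPart G₀ M, Tendsto x atTop (𝓝 z) := by
  have h0 := h.zero_notMem_invariantPart
  set N : ℕ → ℝ := fun n => (NFun B (invariantPart G₀ M) (x n)).toReal with hN
  have hN0 : ∀ n, 0 ≤ N n := fun n => ENNReal.toReal_nonneg
  have hgrow : ∀ n, 1 + N n ≤ (1 + N 0) * Real.exp (L * (Φ (x 0) - Φ (x n))) := by
    intro n
    induction n with
    | zero => simp
    | succ n ih =>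
      have hδ : 0 ≤ Φ (x n) - Φ (x (n + 1)) := sub_nonneg.2 (hanti n)
      have h1 : N (n + 1) ≤ N n + L * (1 + N n) * (Φ (x n) - Φ (x (n + 1))) :=
        h.toReal_NFun_le_add (hx n) (by have := hN0 n; positivity) (hstep n)
      calc 1 + N (n + 1) ≤ (1 + N n) * (L * (Φ (x n) - Φ (x (n + 1))) + 1) := by linarith
        _ ≤ (1 + N n) * Real.exp (L * (Φ (x n) - Φ (x (n + 1)))) := by
            gcongr
            exact Real.add_one_le_exp _
        _ ≤ (1 + N 0) * Real.exp (L * (Φ (x 0) - Φ (x n))) *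
              Real.exp (L * (Φ (x n) - Φ (x (n + 1)))) := by gcongr
        _ = (1 + N 0) * Real.exp (L * (Φ (x 0) - Φ (x (n + 1)))) := by
            rw [mul_assoc, ← Real.exp_add]; ring_nf
  set D := L * ((1 + N 0) * Real.exp (L * (Φ (x 0) - c₀))) with hD
  have hD0 : 0 ≤ D := by have := hN0 0; positivity
  have hstep' : ∀ n, pathDist B (invariantPart G₀ M) (x n) (x (n + 1)) ≤
      ENNReal.ofReal (D * (Φ (x n) - Φ (x (n + 1)))) := by
    intro n
    refine (hstep n).trans (ENNReal.ofReal_le_ofReal ?_)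
    refine mul_le_mul_of_nonneg_right ?_ (sub_nonneg.2 (hanti n))
    refine mul_le_mul_of_nonneg_left ((hgrow n).trans ?_) hL
    have := hN0 0
    gcongr
    exact (hxc n).1
  have hA : Antitone fun n => Φ (x n) := antitone_nat_of_succ_le hanti
  have hdist : ∀ m k, pathDist B (invariantPart G₀ M) (x m) (x (m + k)) ≤
      ENNReal.ofReal (D * (Φ (x m) - Φ (x (m + k)))) := by
    intro m k
    induction k with
    | zero => rw [add_zero, pathDist_self (hx m)]; exact zero_le
    | succ k ih =>
      refine (pathDist_triangle (v := x (m + k)) h.metric h0).trans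
        ((add_le_add ih (hstep' (m + k))).trans (le_of_eq ?_))
      have e1 : Φ (x (m + k)) ≤ Φ (x m) := hA (Nat.le_add_right m k)
      have e2 := hanti (m + k)
      rw [← ENNReal.ofReal_add (mul_nonneg hD0 (sub_nonneg.2 e1))
        (mul_nonneg hD0 (sub_nonneg.2 e2))]
      congr 1
      rw [← add_assoc]
      ring
  have hcauchy : CauchySeq fun n => Φ (x n) :=
    (tendsto_atTop_ciInf hA ⟨c₀, by rintro _ ⟨n, rfl⟩; exact (hxc n).1⟩).cauchySeq
  obtain ⟨z, hz, hlim⟩ := hcomplete x (fun n => ⟨hx n, hxc n⟩) (by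
    intro ε hε
    obtain ⟨e, he0, he, heε⟩ := ENNReal.lt_iff_exists_real_btwn.1 hε
    rw [ENNReal.ofReal_pos] at he
    obtain ⟨n₀, hn₀⟩ := Metric.cauchySeq_iff.1 hcauchy (e / (D + 1)) (by positivity)
    have key : ∀ m ≥ n₀, ∀ k, pathDist B (invariantPart G₀ M) (x m) (x (m + k)) < ε := by
      intro m hm k
      refine (hdist m k).trans_lt (lt_of_le_of_lt (ENNReal.ofReal_le_ofReal ?_) heε)
      have h1 := hn₀ m hm (m + k) (hm.trans (Nat.le_add_right m k))
      rw [Real.dist_eq] at h1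
      have h2 := (le_abs_self _).trans h1.le
      rw [le_div_iff₀ (by positivity)] at h2
      have e1 : Φ (x (m + k)) ≤ Φ (x m) := hA (Nat.le_add_right m k)
      nlinarith
    refine ⟨n₀, fun m hm n hn => ?_⟩
    rcases le_total m n with hmn | hmn
    · obtain ⟨k, rfl⟩ := Nat.exists_eq_add_of_le hmn
      exact key m hm k
    · obtain ⟨k, rfl⟩ := Nat.exists_eq_add_of_le hmn
      rw [pathDist_comm h.metric h0]
      exact key n hn k)
  exact ⟨z, hz.1, tendsto_of_tendsto_pathDist h.metric h0 hz.1 hlim⟩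

end IsSymmetricSetting

/-! ### Deformation of sublevel sets -/

namespace IsSymmetricSetting

variable {X G : Type*} [NormedAddCommGroup X] [InnerProductSpace ℝ X]
  [Group G] [DistribMulAction G X] [SMulCommClass G ℝ X]
  {B : X → X →ₗ[ℝ] X →ₗ[ℝ] ℝ} {M : Set X} {Φ : X → ℝ} {G₀ : Subgroup G}
  (h : IsSymmetricSetting B M Φ G₀)
include h

omit [SMulCommClass G ℝ X] in
/-- Even radii `r u` for the critical points `u` at the level `c`, such that the norms `‖·‖_y` are
uniformly equivalent on the ball of radius `r u`, and the orbits that meet this ball do not meet its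
mirror image. -/
theorem exists_radii {c : ℝ} (hI : IPrime M Φ G₀ c) : ∃ r C : X → ℝ, (∀ u, r (-u) = r u) ∧
    ∀ u ∈ invariantPart G₀ M, IsCritical M Φ u → Φ u = c → 0 < r u ∧ 0 < C u ∧
      (∀ y ∈ Metric.ball u (r u), ∀ v, ‖v‖ ≤ C u * normAt B y v ∧ normAt B y v ≤ C u * ‖v‖) ∧
      ∀ x ∈ orbitBall G u (r u), -x ∉ orbitBall G u (r u) := by
  have key : ∀ u ∈ invariantPart G₀ M, IsCritical M Φ u → Φ u = c → ∃ r > 0, ∃ C > 0,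
      (∀ y ∈ Metric.ball u r, ∀ v, ‖v‖ ≤ C * normAt B y v ∧ normAt B y v ≤ C * ‖v‖) ∧
      ∀ x ∈ orbitBall G u r, -x ∉ orbitBall G u r := by
    intro u hu huc huΦ
    obtain ⟨R, hR, C, hC, h1⟩ := h.metric.exists_ball (h.ne_zero hu.1)
    obtain ⟨r, hr, h2⟩ := h.exists_orbitBall_disjoint_neg (h.ne_zero hu.1)
      (h.smul_ne_neg hI hu huc huΦ)
    have hsub : ∀ x, x ∈ orbitBall G u (min R r) → x ∈ orbitBall G u r := fun x ⟨g, hg⟩ =>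
      ⟨g, hg.trans_le (min_le_right _ _)⟩
    refine ⟨min R r, lt_min hR hr, C, hC, fun y hy v => ?_, fun x hx hx' =>
      h2 x (hsub _ hx) (hsub _ hx')⟩
    exact (h1 y (Metric.ball_subset_ball (min_le_left _ _) hy)).2 v
  choose! r hr C hC h1 h2 using key
  refine ⟨fun u => min (r u) (r (-u)), C, fun u => by simp only [neg_neg, min_comm],
    fun u hu huc huΦ => ?_⟩
  have hu' := h.neg_mem_invariantPart hu
  have huc' := h.isCritical_neg hu.1 huc
  have huΦ' : Φ (-u) = c := by rw [h.even u hu.1, huΦ]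
  have hsub : ∀ x, x ∈ orbitBall G u (min (r u) (r (-u))) → x ∈ orbitBall G u (r u) :=
    fun x ⟨g, hg⟩ => ⟨g, hg.trans_le (min_le_left _ _)⟩
  exact ⟨lt_min (hr u hu huc huΦ) (hr _ hu' huc' huΦ'), hC u hu huc huΦ,
    fun y hy => h1 u hu huc huΦ y (Metric.ball_subset_ball (min_le_left _ _) hy),
    fun x hx hx' => h2 u hu huc huΦ x (hsub _ hx) (hsub _ hx')⟩

omit h [SMulCommClass G ℝ X] in
/-- The bound on `‖Φ'(z)‖_z (1 + N(z))` in terms of real numbers. -/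
theorem lt_dualNormAt_of_le_mul {z : X} (hz : z ∈ invariantPart G₀ M) {δ : ℝ} (hδ : 0 < δ)
    (hd : ENNReal.ofReal δ ≤ dualNormAt B M Φ z * (1 + NFun B (invariantPart G₀ M) z)) :
    ENNReal.ofReal (δ / (2 * (1 + (NFun B (invariantPart G₀ M) z).toReal))) <
      dualNormAt B M Φ z := by
  by_contra! hcon
  set n := (NFun B (invariantPart G₀ M) z).toReal with hn
  have hn0 : 0 ≤ n := ENNReal.toReal_nonneg
  have e : 1 + NFun B (invariantPart G₀ M) z = ENNReal.ofReal (1 + n) := by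
    rw [ENNReal.ofReal_add zero_le_one hn0, ENNReal.ofReal_one, hn,
      ENNReal.ofReal_toReal (NFun_ne_top hz)]
  have h1 := hd.trans (mul_le_mul_left hcon _)
  rw [e, ← ENNReal.ofReal_mul (by positivity), ENNReal.ofReal_le_ofReal_iff (by positivity)] at h1
  have : δ / (2 * (1 + n)) * (1 + n) = δ / 2 := by field_simp
  linarith

variable [CompleteSpace X]

/-- Descent near a point `z` of `M₀`, with a bound on the distance travelled from `x` that depends
on `N(x)` instead of `N(z)`. -/
theorem exists_controlled_homotopy {z : X} (hz : z ∈ invariantPart G₀ M) {δ : ℝ} (hδ : 0 < δ)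
    (hd : ENNReal.ofReal δ ≤ dualNormAt B M Φ z * (1 + NFun B (invariantPart G₀ M) z)) :
    ∃ r > 0, ∃ H : X → ℝ → X,
      ContinuousOn (Function.uncurry H) (Metric.ball z r ×ˢ Icc 0 1) ∧
      ∀ x ∈ Metric.ball z r, x ∈ invariantPart G₀ M → H x 0 = x ∧ ∀ t ∈ Icc (0 : ℝ) 1,
        H x t ∈ invariantPart G₀ M ∧ ‖H x t - x‖ ≤ t ∧
        pathDist B (invariantPart G₀ M) x (H x t) ≤ ENNReal.ofReal (4 / δ *
          (1 + (NFun B (invariantPart G₀ M) x).toReal) * (Φ x - Φ (H x t))) ∧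
        pathDist B (invariantPart G₀ M) x (H x t) ≤ ENNReal.ofReal 1 ∧
        Φ (H x t) ≤ Φ x ∧ (0 < t → Φ (H x t) < Φ x) := by
  have h0 := h.zero_notMem_invariantPart
  have hn0 : ∀ x, 0 ≤ (NFun B (invariantPart G₀ M) x).toReal := fun _ => ENNReal.toReal_nonneg
  obtain ⟨r, hr, H, hHc, hH⟩ := h.exists_descent_homotopy hz
    (σ := δ / (2 * (1 + (NFun B (invariantPart G₀ M) z).toReal)))
    (by have := hn0 z; positivity) (lt_dualNormAt_of_le_mul hz hδ hd)
  have hev := (h.tendsto_pathDist hz).eventually_lt_const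
    (show (0 : ℝ≥0∞) < ENNReal.ofReal 1 by simp)
  rw [eventually_nhdsWithin_iff] at hev
  obtain ⟨r', hr', hball⟩ := Metric.eventually_nhds_iff_ball.1 hev
  refine ⟨min r r', lt_min hr hr', H, hHc.mono (prod_mono
    (Metric.ball_subset_ball (min_le_left _ _)) Subset.rfl), fun x hx hxM => ?_⟩
  obtain ⟨hx0, hxH⟩ := hH x (Metric.ball_subset_ball (min_le_left _ _) hx) hxM
  refine ⟨hx0, fun t ht => ?_⟩
  obtain ⟨h1, h2, h3, h4, h5, h6⟩ := hxH t ht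
  refine ⟨h1, h2, h3.trans (ENNReal.ofReal_le_ofReal ?_), h4, h5, h6⟩
  have hzx := hball x (Metric.ball_subset_ball (min_le_right _ _) hx) hxM
  rw [pathDist_comm h.metric h0] at hzx
  have hN := h.toReal_NFun_le_add hxM zero_le_one hzx.le
  set a := (NFun B (invariantPart G₀ M) z).toReal
  set b := (NFun B (invariantPart G₀ M) x).toReal
  have ha : 0 ≤ a := hn0 z
  have hb : 0 ≤ b := hn0 x
  have e : (Φ x - Φ (H x t)) / (δ / (2 * (1 + a))) = 2 / δ * (1 + a) * (Φ x - Φ (H x t)) := by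
    field_simp
  rw [e]
  refine mul_le_mul_of_nonneg_right ?_ (sub_nonneg.2 h5)
  calc 2 / δ * (1 + a) ≤ 2 / δ * (2 * (1 + b)) := by gcongr; linarith
    _ = 4 / δ * (1 + b) := by ring

/-- If the level `c` has a neighbourhood of complete levels and satisfies `(NCG₀)_c` and `(I)'_c`,
then passing the level `c` increases the genus by a finite amount only, and not at all if `c` is
not a critical value. -/
theorem exists_genus_le {c c₀ c₁ : ℝ} (hc₀ : c₀ < c) (hc₁ : c < c₁)
    (hcomplete : IsCompleteFor (pathDist B (invariantPart G₀ M))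
      {u | u ∈ invariantPart G₀ M ∧ Φ u ∈ Icc c₀ c₁})
    (hNCG : NCG₀ B M Φ G₀ c) (hI : IPrime M Φ G₀ c) :
    ∃ ε > 0, ∃ m : ℕ, ((∀ u ∈ invariantPart G₀ M, IsCritical M Φ u → Φ u ≠ c) → m = 0) ∧
      genus (sublevel (invariantPart G₀ M) Φ (c + ε)) ≤
        genus (sublevel (invariantPart G₀ M) Φ (c - ε)) + m := by
  classical
  have h0 := h.zero_notMem_invariantPart
  obtain ⟨r, C, hrneg, hrC⟩ := h.exists_radii hI
  -- a finite symmetric set `s` of critical points, near whose orbits all critical points lie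
  obtain ⟨t, htK, hcov⟩ := h.exists_finite_cover hNCG (fun u => 1 / 2 * r u)
    (fun u hu huc huΦ => by have := (hrC u hu huc huΦ).1; positivity)
  let s : Finset X := t ∪ t.image fun u => -u
  have hsK : ∀ u ∈ s, u ∈ invariantPart G₀ M ∧ IsCritical M Φ u ∧ Φ u = c := by
    intro u hu
    rcases Finset.mem_union.1 hu with hu | hu
    · exact htK u hu
    · obtain ⟨v, hv, rfl⟩ := Finset.mem_image.1 hu
      obtain ⟨h1, h2, h3⟩ := htK v hv
      exact ⟨h.neg_mem_invariantPart h1, h.isCritical_neg h1.1 h2, by rw [h.even v h1.1, h3]⟩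
  have hsneg : ∀ u ∈ s, -u ∈ s := by
    intro u hu
    rcases Finset.mem_union.1 hu with hu | hu
    · exact Finset.mem_union_right _ (Finset.mem_image_of_mem _ hu)
    · obtain ⟨v, hv, rfl⟩ := Finset.mem_image.1 hu
      rw [neg_neg]
      exact Finset.mem_union_left _ hv
  have hs : ∀ u ∈ s, 0 < r u ∧ 0 < C u ∧
      (∀ y ∈ Metric.ball u (r u), ∀ v, ‖v‖ ≤ C u * normAt B y v ∧ normAt B y v ≤ C u * ‖v‖) ∧
      ∀ x ∈ orbitBall G u (r u), -x ∉ orbitBall G u (r u) := fun u hu =>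
    hrC u (hsK u hu).1 (hsK u hu).2.1 (hsK u hu).2.2
  -- the bound for the derivative away from the critical orbits
  obtain ⟨ε₀, hε₀, δ, hδ, hlow⟩ := h.exists_lower_bound hNCG
    (O := ⋃ u ∈ s, orbitBall G u (1 / 2 * r u))
    (isOpen_biUnion fun u _ => h.isOpen_orbitBall u _)
    (fun g x hx => by simpa only [mem_iUnion, smul_mem_orbitBall_iff] using hx)
    (fun x hx hxc hxΦ => by
      obtain ⟨u, hu, hxu⟩ := hcov x hx hxc hxΦ
      exact mem_biUnion (Finset.mem_coe.2 (Finset.mem_union_left _ hu)) hxu)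
  -- a curve of descent changes `capDist u` by at most `κ` times the decrease of `Φ`
  let κ : ℝ := ∑ u ∈ s, C u / r u * (4 / δ * (2 + C u * (‖u‖ + r u)))
  have hκu : ∀ u ∈ s, C u / r u * (4 / δ * (2 + C u * (‖u‖ + r u))) ≤ κ := fun u hu =>
    Finset.single_le_sum (f := fun u => C u / r u * (4 / δ * (2 + C u * (‖u‖ + r u))))
      (fun u hu => by
        obtain ⟨h1, h2, -⟩ := hs u hu
        positivity) hu
  have hκ0 : 0 ≤ κ := Finset.sum_nonneg fun u hu => by
    obtain ⟨h1, h2, -⟩ := hs u hu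
    positivity
  obtain ⟨ε, hε, hε1, hε2, hε3, hε4⟩ : ∃ ε : ℝ, 0 < ε ∧ 2 * ε ≤ ε₀ ∧ c₀ ≤ c - 2 * ε ∧
      c + ε ≤ c₁ ∧ κ * (3 * ε) ≤ 1 / 2 := by
    refine ⟨min (min (ε₀ / 2) ((c - c₀) / 2)) (min (c₁ - c) (1 / (6 * (κ + 1)))), ?_, ?_, ?_, ?_,
      ?_⟩
    · have : 0 < c - c₀ := sub_pos.2 hc₀
      have : 0 < c₁ - c := sub_pos.2 hc₁
      positivity
    · have := (min_le_left (min (ε₀ / 2) ((c - c₀) / 2))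
        (min (c₁ - c) (1 / (6 * (κ + 1))))).trans (min_le_left _ _)
      linarith
    · have := (min_le_left (min (ε₀ / 2) ((c - c₀) / 2))
        (min (c₁ - c) (1 / (6 * (κ + 1))))).trans (min_le_right _ _)
      linarith
    · have := (min_le_right (min (ε₀ / 2) ((c - c₀) / 2))
        (min (c₁ - c) (1 / (6 * (κ + 1))))).trans (min_le_left _ _)
      linarith
    · have h1 := (min_le_right (min (ε₀ / 2) ((c - c₀) / 2))
        (min (c₁ - c) (1 / (6 * (κ + 1))))).trans (min_le_right _ _)
      have h2 : κ * (3 * (1 / (6 * (κ + 1)))) ≤ 1 / 2 := by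
        have e : κ * (3 * (1 / (6 * (κ + 1)))) = κ / (κ + 1) * (1 / 2) := by
          field_simp; ring
        rw [e]
        have : κ / (κ + 1) ≤ 1 := (div_le_one (by positivity)).2 (by linarith)
        linarith
      refine le_trans ?_ h2
      gcongr
  -- `Z` is the part of `Y` that lies outside neighbourhoods of the critical orbits. The neighbourhoods
  -- shrink as `Φ` decreases, and are dropped below the level `c - 2ε`, so that descent preserves `Z`.
  let Y := sublevel (invariantPart G₀ M) Φ (c + ε)
  let Z : Set X := {x | x ∈ Y ∧ (Φ x ≤ c - 2 * ε ∨
    ∀ u ∈ s, 1 - κ * (c + ε - Φ x) ≤ capDist G u (r u) x)}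
  let A := sublevel (invariantPart G₀ M) Φ (c - ε)
  have hsubneg : ∀ (a : ℝ), ∀ x ∈ sublevel (invariantPart G₀ M) Φ a,
      -x ∈ sublevel (invariantPart G₀ M) Φ a := fun a x hx =>
    ⟨h.neg_mem_invariantPart hx.1, by rw [h.even x hx.1.1]; exact hx.2⟩
  have hZneg : ∀ x ∈ Z, -x ∈ Z := by
    rintro x ⟨hxY, hx⟩
    refine ⟨hsubneg _ x hxY, ?_⟩
    rw [h.even x hxY.1.1]
    refine hx.imp_right fun hx u hu => ?_
    rw [capDist_neg, ← hrneg u]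
    exact hx _ (hsneg u hu)
  have hΦY : Continuous fun x : Y => Φ x :=
    ((continuousOn_of_isC11OnManifold h.regular).mono fun x hx => hx.1.1).comp_continuous
      continuous_subtype_val fun x => x.2
  have hcapY : ∀ u ∈ s, Continuous fun x : Y => capDist G u (r u) x := fun u hu => by
    obtain ⟨h1, h2, h3, -⟩ := hs u hu
    exact ((h.continuousOn_capDist h1 h2 fun y hy v => (h3 y hy v).1).mono
      fun x hx => hx.1).comp_continuous continuous_subtype_val fun x => x.2
  have hZclosed : IsClosed ((fun y : Y => (y : X)) ⁻¹' Z) := by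
    have e : ((fun y : Y => (y : X)) ⁻¹' Z) = {x : Y | Φ x ≤ c - 2 * ε} ∪
        ⋂ u ∈ s, {x : Y | 1 - κ * (c + ε - Φ x) ≤ capDist G u (r u) x} := by
      ext x
      simp only [Z, mem_preimage, mem_ofPred_eq, mem_union, mem_iInter, x.2, true_and]
    rw [e]
    refine (isClosed_le hΦY continuous_const).union (isClosed_biInter fun u hu => ?_)
    exact isClosed_le (continuous_const.sub (continuous_const.mul (continuous_const.sub hΦY)))
      (hcapY u hu)
  -- the set `Z` avoids the critical orbits above the level `c - 2ε`
  have hZlow : ∀ x ∈ Z, c - 2 * ε < Φ x →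
      ENNReal.ofReal δ ≤ dualNormAt B M Φ x * (1 + NFun B (invariantPart G₀ M) x) := by
    rintro x ⟨hxY, hx⟩ hxΦ
    have hxΦ' : Φ x ≤ c + ε := hxY.2
    refine hlow x hxY.1 (abs_le.2 ⟨by linarith, by linarith⟩) fun hxO => ?_
    obtain ⟨u, hu, hxu⟩ := mem_iUnion₂.1 hxO
    have h1 := (capDist_lt_iff (hs u hu).1 (by norm_num)).2 hxu
    have h2 := hx.resolve_left (not_le.2 hxΦ) u hu
    have h3 : κ * (c + ε - Φ x) ≤ κ * (3 * ε) := by gcongr; linarith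
    linarith
  -- descent does not leave `Z`
  have hZinv : ∀ x ∈ Z, ∀ y ∈ invariantPart G₀ M, Φ y ≤ Φ x →
      pathDist B (invariantPart G₀ M) x y ≤ ENNReal.ofReal
        (4 / δ * (1 + (NFun B (invariantPart G₀ M) x).toReal) * (Φ x - Φ y)) →
      pathDist B (invariantPart G₀ M) x y ≤ ENNReal.ofReal 1 → y ∈ Z := by
    rintro x ⟨hxY, hx⟩ y hy hyx hd hd1
    have hxc : Φ x ≤ c + ε := hxY.2
    refine ⟨⟨hy, hyx.trans hxY.2⟩, ?_⟩
    by_cases hyc : Φ y ≤ c - 2 * ε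
    · exact Or.inl hyc
    refine Or.inr fun u hu => ?_
    have hx' := hx.resolve_left (fun hx => hyc (hyx.trans hx)) u hu
    obtain ⟨hr, hC, hR, -⟩ := hs u hu
    by_cases hcap : capDist G u (r u) y < 1
    · rw [pathDist_comm h.metric h0] at hd hd1
      have hN1 : (NFun B (invariantPart G₀ M) y).toReal ≤ C u * (‖u‖ + r u) :=
        ENNReal.toReal_le_of_le_ofReal (by positivity)
          (h.NFun_le_of_capDist_lt hr hC (fun y hy v => (hR y hy v).2) hy hcap)
      have hN2 := h.toReal_NFun_le_add hy zero_le_one hd1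
      have hℓ : pathDist B (invariantPart G₀ M) y x ≤ ENNReal.ofReal
          (4 / δ * (2 + C u * (‖u‖ + r u)) * (Φ x - Φ y)) := by
        refine hd.trans (ENNReal.ofReal_le_ofReal ?_)
        refine mul_le_mul_of_nonneg_right ?_ (sub_nonneg.2 hyx)
        refine mul_le_mul_of_nonneg_left ?_ (by positivity)
        linarith
      have h1 := h.capDist_le_add hr hC (fun y hy v => (hR y hy v).1)
        (mul_nonneg (by positivity) (sub_nonneg.2 hyx)) hℓ
      have h2 : C u / r u * (4 / δ * (2 + C u * (‖u‖ + r u)) * (Φ x - Φ y)) ≤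
          κ * (Φ x - Φ y) := by
        rw [← mul_assoc]
        exact mul_le_mul_of_nonneg_right (hκu u hu) (sub_nonneg.2 hyx)
      nlinarith
    · have : 0 ≤ κ * (c + ε - Φ y) := mul_nonneg hκ0 (by linarith)
      linarith
  -- the elementary homotopies
  obtain ⟨E, hEc, hE0, hEQ, hE1⟩ := exists_countable_steps (Y := Z)
    {x : Z | c - 2 * ε < Φ x}
    (fun x y => Φ y ≤ Φ x ∧ pathDist B (invariantPart G₀ M) x y ≤ ENNReal.ofReal
      (4 / δ * (1 + (NFun B (invariantPart G₀ M) x).toReal) * (Φ x - Φ y)))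
    (fun x y => Φ y < Φ x)
    (fun x => ⟨le_rfl, by rw [pathDist_self x.2.1.1]; exact zero_le⟩)
    (fun z hz => by
      obtain ⟨ρ, hρ, H, hHc, hH⟩ :=
        h.exists_controlled_homotopy z.2.1.1 hδ (hZlow z z.2 hz)
      have hHZ : ∀ x : Z, x ∈ Metric.ball z ρ → ∀ τ ∈ Icc (0 : ℝ) 1, H x τ ∈ Z := by
        intro x hx τ hτ
        obtain ⟨h1, h2, h3, h4, h5, -⟩ := (hH x hx x.2.1.1).2 τ hτ
        exact hZinv x x.2 _ h1 h5 h3 h4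
      let H' : Z → ℝ → Z := fun x τ => if hm : H x τ ∈ Z then ⟨H x τ, hm⟩ else x
      have hH' : ∀ x : Z, x ∈ Metric.ball z ρ → ∀ τ ∈ Icc (0 : ℝ) 1, (H' x τ : X) = H x τ := by
        intro x hx τ hτ
        simp only [H', dif_pos (hHZ x hx τ hτ)]
      refine ⟨ρ, hρ, H', ?_, fun x hx => ?_⟩
      · rw [Topology.IsInducing.subtypeVal.continuousOn_iff]
        refine ContinuousOn.congr (f := fun p : Z × ℝ => H p.1 p.2) ?_ fun p hp =>
          hH' p.1 hp.1 p.2 hp.2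
        exact hHc.comp (f := fun p : Z × ℝ => ((p.1 : X), p.2)) (by fun_prop)
          fun p hp => ⟨hp.1, hp.2⟩
      · have hHx := hH x hx x.2.1.1
        refine ⟨Subtype.ext ?_, fun τ hτ => ?_⟩
        · rw [hH' x hx 0 ⟨le_rfl, zero_le_one⟩, hHx.1]
        · obtain ⟨h1, h2, h3, h4, h5, h6⟩ := hHx.2 τ hτ
          rw [Subtype.dist_eq, dist_eq_norm, hH' x hx τ hτ]
          exact ⟨⟨h5, h3⟩, h2, h6⟩)
  have hΦZ : Continuous fun x : Z => Φ x :=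
    hΦY.comp (continuous_subtype_val.subtype_mk fun x : Z => x.2.1)
  obtain ⟨R, hRc, hR0, hRΦ, hR1⟩ := exists_homotopy_of_steps hΦZ (c - ε) E hEc hE0
    (fun n y τ => (hEQ n y τ).1) (fun z hz => hE1 z (show c - 2 * ε < Φ z by linarith)) (by
      intro σ x hx hxa
      obtain ⟨z, hz, hlim⟩ := h.exists_limit hcomplete (L := 4 / δ) (by positivity)
        (fun n => (x n : X)) (fun n => (x n).2.1.1)
        (fun n => ⟨by linarith [hxa n], (x n).2.1.2.trans hε3⟩)
        (fun n => by rw [hx n]; exact (hEQ _ _ _).1)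
        (fun n => by rw [hx n]; exact (hEQ _ _ _).2)
      have hzY : z ∈ Y := by
        refine ⟨hz, le_of_tendsto' (f := fun n => Φ (x n)) (x := atTop) ?_
          fun n => (x n).2.1.2⟩
        exact (continuousOn_of_isC11OnManifold h.regular z hz.1).tendsto.comp
          (tendsto_nhdsWithin_iff.2 ⟨hlim, Eventually.of_forall fun n => (x n).2.1.1.1⟩)
      have hlimY : Tendsto (fun n => (⟨x n, (x n).2.1⟩ : Y)) atTop (𝓝 ⟨z, hzY⟩) :=
        tendsto_subtype_rng.2 hlim
      have hzZ : z ∈ Z := hZclosed.mem_of_tendsto hlimY (Eventually.of_forall fun n => (x n).2)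
      exact ⟨⟨z, hzZ⟩, tendsto_subtype_rng.2 hlim⟩)
  obtain ⟨F, hFc, hFA, hFodd⟩ := exists_odd_map_of_homotopy (Z := Z) (A := A)
    (fun hx => h0 hx.1.1) hZneg (hsubneg _) R hRc hR0
    (fun y τ hy => ⟨(R (y, τ)).2.1.1, (hRΦ y τ).trans hy.2⟩)
    (fun y => ⟨(R (y, 1)).2.1.1, (hR1 y).le⟩)
  have hZA : genus Z ≤ genus A := genus_le_of_odd_map hZneg F hFc hFA hFodd
  -- odd functions that do not vanish simultaneously near the critical orbits
  choose l hlc hl using fun u : X => exists_continuous_pos_iff (h.isOpen_orbitBall u (r u))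
  have hYZ := genus_le_genus_add (hsubneg (c + ε)) (Z := Z) (fun x hx => hx.1) hZclosed hZneg
    (ι := s) (fun u x => (l u x : ℝ) - l u (-x))
    (fun u => by
      have := hlc u
      exact Continuous.continuousOn (by fun_prop))
    (fun u y _ => by simp only [neg_neg, neg_sub]) (by
      intro y hy hyZ
      have h1 : ¬ ∀ u ∈ s, 1 - κ * (c + ε - Φ y) ≤ capDist G u (r u) y :=
        fun hcon => hyZ ⟨hy, Or.inr hcon⟩
      push Not at h1
      obtain ⟨u, hu, hlt⟩ := h1
      have hle : 0 ≤ κ * (c + ε - Φ y) := mul_nonneg hκ0 (sub_nonneg.2 hy.2)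
      have h2 := (capDist_lt_iff (hs u hu).1 le_rfl).1 (hlt.trans_le (by linarith))
      rw [one_mul] at h2
      refine ⟨⟨u, hu⟩, ?_⟩
      have h3 : l u (-y) = 0 := by
        by_contra hne
        exact (hs u hu).2.2.2 y h2 ((hl u (-y)).1 (unitInterval.pos_iff_ne_zero.2 hne))
      have h4 : 0 < l u y := (hl u y).2 h2
      simp only [h3]
      have h5 : (0 : ℝ) < l u y := h4
      simpa using h5.ne')
  refine ⟨ε, hε, Fintype.card s, fun hK => ?_, hYZ.trans (add_le_add_left hZA _)⟩
  rw [Fintype.card_eq_zero_iff]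
  exact ⟨fun u => hK u (hsK u u.2).1 (hsK u u.2).2.1 (hsK u u.2).2.2⟩

end IsSymmetricSetting

/-! ### Critical values -/

theorem sublevel_mono {X : Type*} {S : Set X} {Φ : X → ℝ} {a b : ℝ} (hab : a ≤ b) :
    sublevel S Φ a ⊆ sublevel S Φ b := fun _ hx => ⟨hx.1, hx.2.trans hab⟩

section LsValue

variable {X : Type*} [NormedAddCommGroup X] {S : Set X} {Φ : X → ℝ} {k : ℕ}

theorem lsValue_le {c : ℝ} (hc : (k : ℕ∞) ≤ genus (sublevel S Φ c)) :
    lsValue S Φ k ≤ (c : EReal) := iInf₂_le c hc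

theorem lsValue_mono : Monotone (lsValue S Φ) := fun k l hkl =>
  le_iInf₂ fun _ hc => lsValue_le ((Nat.cast_le.2 hkl : (k : ℕ∞) ≤ l).trans hc)

theorem genus_sublevel_lt {c : ℝ} (hc : (c : EReal) < lsValue S Φ k) :
    genus (sublevel S Φ c) < k := by
  by_contra! hcon
  exact (lsValue_le hcon).not_gt hc

theorem le_lsValue {c : ℝ} (hc : genus (sublevel S Φ c) < k) : (c : EReal) ≤ lsValue S Φ k := by
  refine le_iInf₂ fun a ha => ?_
  by_contra! hcon
  exact (ha.trans (genus_mono (sublevel_mono (EReal.coe_lt_coe_iff.1 hcon).le))).not_gt hc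

theorem le_genus_sublevel {c : ℝ} (hc : lsValue S Φ k < (c : EReal)) :
    (k : ℕ∞) ≤ genus (sublevel S Φ c) := by
  by_contra! hcon
  exact (le_lsValue hcon).not_gt hc

end LsValue

end LSTheory

theorem mainTheorem7
    {X : Type*} [NormedAddCommGroup X] [InnerProductSpace ℝ X] [CompleteSpace X]
    {G : Type*} [Group G] [TopologicalSpace G] [IsTopologicalGroup G]
    [DistribMulAction G X] [SMulCommClass G ℝ X]
    (B : X → X →ₗ[ℝ] X →ₗ[ℝ] ℝ)
    (hB : LSTheory.IsScalarProductFamily B)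
    (hM1 : LSTheory.LocallyUniformlyEquivalent B)
    (hM2 : LSTheory.LocallyLipschitzFamily B)
    (hM3 : LSTheory.InvariantFamily G B)
    (M : Set X) (hM : LSTheory.IsC11Submanifold M) (hM0 : (0 : X) ∉ M)
    (hMsymm : ∀ u ∈ M, -u ∈ M) (hMG : ∀ u ∈ M, ∀ g : G, g • u ∈ M)
    (Φ : X → ℝ) (hΦ : LSTheory.IsC11OnManifold M Φ)
    (hΦeven : ∀ u ∈ M, Φ (-u) = Φ u) (hΦG : ∀ u ∈ M, ∀ g : G, Φ (g • u) = Φ u)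
    (G₀ : Subgroup G) [G₀.Normal] (hG₀ : IsClosed (G₀ : Set G))
    (hGstar : LSTheory.GStar G X)
    (M₀ : Set X) (hM₀ : M₀ = LSTheory.invariantPart G₀ M)
    (cstar : ℝ) (cinf : EReal) (hc : (cstar : EReal) < cinf)
    (hcomplete : ∀ c : ℝ, (c : EReal) < cinf →
      LSTheory.IsCompleteFor (LSTheory.pathDist B M₀) {u | u ∈ M₀ ∧ Φ u ∈ Icc cstar c})
    (kstar : ℕ)
    (hkstar : Tendsto (fun c : ℝ => LSTheory.genus (LSTheory.sublevel M₀ Φ c))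
      (𝓝[>] cstar) (𝓝 (kstar : ℕ∞)))
    (hgenus : Tendsto (fun c : ℝ => LSTheory.genus (LSTheory.sublevel M₀ Φ c))
      (comap (fun c : ℝ => (c : EReal)) (𝓝[<] cinf)) (𝓝 ⊤))
    (hNCG : ∀ c : ℝ, cstar < c → (c : EReal) < cinf → LSTheory.NCG₀ B M Φ G₀ c)
    (hI : ∀ c : ℝ, cstar < c → (c : EReal) < cinf → LSTheory.IPrime M Φ G₀ c) :
    (∀ k : ℕ, kstar < k →
      (cstar : EReal) < LSTheory.lsValue M₀ Φ k ∧
      LSTheory.lsValue M₀ Φ k ≤ LSTheory.lsValue M₀ Φ (k + 1) ∧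
      LSTheory.lsValue M₀ Φ k < cinf ∧
      ∃ u ∈ M₀, LSTheory.IsCritical M Φ u ∧ LSTheory.lsValue M₀ Φ k = (Φ u : EReal)) ∧
    Tendsto (fun k : ℕ => LSTheory.lsValue M₀ Φ k) atTop (𝓝 cinf) ∧
    ∃ u : ℕ → X,
      (∀ k, u k ∈ M₀ ∧ LSTheory.IsCritical M Φ (u k) ∧
        -u k ∈ M₀ ∧ LSTheory.IsCritical M Φ (-u k)) ∧
      Tendsto (fun k => (Φ (u k) : EReal)) atTop (𝓝 cinf) := by
  open LSTheory in
  subst hM₀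
  have h : IsSymmetricSetting B M Φ G₀ :=
    ⟨⟨hB, hM1, hM2⟩, hM3, hM, hM0, hMsymm, hMG, hΦ, hΦeven, hΦG, inferInstance, hGstar⟩
  have hbelow : ∀ k : ℕ, kstar < k → (cstar : EReal) < lsValue (invariantPart G₀ M) Φ k := by
    intro k hk
    obtain ⟨c, hck, hc⟩ := ((hkstar.eventually_lt_const
      (Nat.cast_lt.2 hk : (kstar : ℕ∞) < k)).and self_mem_nhdsWithin).exists
    exact (EReal.coe_lt_coe_iff.2 hc).trans_le (le_lsValue hck)
  have hne : (comap (fun c : ℝ => (c : EReal)) (𝓝[<] cinf)).NeBot := by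
    refine comap_neBot fun t ht => ?_
    obtain ⟨l, hl, hlt⟩ := (mem_nhdsLT_iff_exists_Ioo_subset' hc).1 ht
    obtain ⟨a, ha⟩ := EReal.lt_iff_exists_real_btwn.1 hl
    exact ⟨a, hlt ha⟩
  have habove : ∀ k : ℕ, lsValue (invariantPart G₀ M) Φ k < cinf := by
    intro k
    obtain ⟨c, hck, hc⟩ := ((hgenus.eventually_const_lt (ENat.natCast_lt_top k)).and
      (preimage_mem_comap self_mem_nhdsWithin)).exists
    exact (lsValue_le hck.le).trans_lt hc
  -- the behaviour of the genus at a level between `cstar` and `cinf`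
  have hlevel : ∀ c : ℝ, cstar < c → (c : EReal) < cinf → ∃ ε > 0, ∃ m : ℕ,
      ((∀ u ∈ invariantPart G₀ M, IsCritical M Φ u → Φ u ≠ c) → m = 0) ∧
      genus (sublevel (invariantPart G₀ M) Φ (c + ε)) ≤
        genus (sublevel (invariantPart G₀ M) Φ (c - ε)) + m := by
    intro c h1 h2
    obtain ⟨c₁, h3, h4⟩ := EReal.lt_iff_exists_real_btwn.1 h2
    exact h.exists_genus_le h1 (EReal.coe_lt_coe_iff.1 h3) (hcomplete c₁ h4) (hNCG c h1 h2)
      (hI c h1 h2)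
  have hreal : ∀ a : EReal, (cstar : EReal) < a → a < cinf → ∃ c : ℝ, (c : EReal) = a := by
    intro a h1 h2
    exact ⟨a.toReal, EReal.coe_toReal (ne_top_of_lt h2) (ne_bot_of_gt h1)⟩
  have hcrit : ∀ k : ℕ, kstar < k → ∃ u ∈ invariantPart G₀ M, IsCritical M Φ u ∧
      lsValue (invariantPart G₀ M) Φ k = (Φ u : EReal) := by
    intro k hk
    obtain ⟨c, hck⟩ := hreal _ (hbelow k hk) (habove k)
    obtain ⟨ε, hε, m, hm, hle⟩ := hlevel c
      (EReal.coe_lt_coe_iff.1 (hck ▸ hbelow k hk)) (hck ▸ habove k)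
    by_contra! hcon
    have hm0 : m = 0 := hm fun u hu huc huΦ => hcon u hu huc (by rw [← hck, huΦ])
    have h1 : (k : ℕ∞) ≤ genus (sublevel (invariantPart G₀ M) Φ (c + ε)) :=
      le_genus_sublevel (by rw [← hck]; exact EReal.coe_lt_coe_iff.2 (by linarith))
    have h2 : genus (sublevel (invariantPart G₀ M) Φ (c - ε)) < k :=
      genus_sublevel_lt (by rw [← hck]; exact EReal.coe_lt_coe_iff.2 (by linarith))
    rw [hm0, Nat.cast_zero, add_zero] at hle
    exact (h1.trans hle).not_gt h2
  have hsup : ⨆ k, lsValue (invariantPart G₀ M) Φ k = cinf := by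
    refine le_antisymm (iSup_le fun k => (habove k).le) ?_
    by_contra! hlt
    have hle := le_iSup (lsValue (invariantPart G₀ M) Φ)
    obtain ⟨c, hcs⟩ := hreal _ ((hbelow _ (Nat.lt_succ_self kstar)).trans_le (hle _)) hlt
    obtain ⟨ε, hε, m, -, hgen⟩ := hlevel c (EReal.coe_lt_coe_iff.1
      (hcs ▸ (hbelow _ (Nat.lt_succ_self kstar)).trans_le (hle _))) (hcs ▸ hlt)
    -- the genus is infinite just above the supremum and finite just below it
    have h1 : genus (sublevel (invariantPart G₀ M) Φ (c + ε)) = ⊤ := by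
      refine ENat.eq_top_iff_forall_ge.2 fun k => le_genus_sublevel ((hle k).trans_lt ?_)
      rw [← hcs]
      exact EReal.coe_lt_coe_iff.2 (by linarith)
    obtain ⟨k, hk⟩ := lt_iSup_iff.1 (show ((c - ε : ℝ) : EReal) <
      ⨆ k, lsValue (invariantPart G₀ M) Φ k by
        rw [← hcs]; exact EReal.coe_lt_coe_iff.2 (by linarith))
    have h2 := (genus_sublevel_lt hk).trans (ENat.natCast_lt_top k)
    rw [h1, top_le_iff, ENat.add_eq_top] at hgen
    exact hgen.elim h2.ne (ENat.natCast_ne_top m)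
  have hlim : Tendsto (fun k : ℕ => lsValue (invariantPart G₀ M) Φ k) atTop (𝓝 cinf) :=
    hsup ▸ tendsto_atTop_iSup lsValue_mono
  refine ⟨fun k hk => ⟨hbelow k hk, lsValue_mono k.le_succ, habove k, hcrit k hk⟩, hlim, ?_⟩
  choose u hu huc huΦ using fun k : ℕ => hcrit (k + (kstar + 1)) (by omega)
  refine ⟨u, fun k => ⟨hu k, huc k, h.neg_mem_invariantPart (hu k),
    h.isCritical_neg (hu k).1 (huc k)⟩, ?_⟩
  simp only [← huΦ]
  exact hlim.comp (tendsto_add_atTop_nat (kstar + 1))
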